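/- **Setting.** $\mathbb R^4_1$ is Minkowski space with $\langle x,x\rangle=-2x^1x^4+(x^2)^2+(x^3)^2$, time-oriented by $x^1+x^4>0$; $\mathcal L^+$ is its positive light cone and $L=\mathbb R^4\rtimes SO_0(3,1)$. A contact element $(x,n)\in\Lambda=\mathbb R^3\times S^2$ is identified with the null line $[\sigma(x),\nu(n)]$ through $\sigma(x)=(x^1/\sqrt2,x^2,x^3,-x^1/\sqrt2)$ with direction $\nu(n)=\big(\tfrac{1+n^1}2,\tfrac{n^2}{\sqrt2},\tfrac{n^3}{\sqrt2},\tfrac{1-n^1}2\big)$; $[a,b]$ denotes the line through $a$ with direction $b$. Let $M$ be a connected Riemann surface with a holomorphic quadratic differential $q$. A smooth map $F=(f,n):M\to\Lambda$ is an *$L$-isothermic immersion* of $(M,q)$ if $df\cdot n=0$, $\mathrm{III}=dn\cdot dn$ is positive definite and compatible with the complex structure, and the $(2,0)$-part of $\mathrm{II}=-df\cdot dn$ is $\mu q$ for a smooth real function $\mu$. The curvature lines of $F$ are the lines along which $q$ is real. Two $L$-isothermic immersions $F=(f,n)$, $\hat F=(\hat f,\hat n)$ of $(M,q)$ are *Bianchi–Darboux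 transforms* of each other if $n\ne\hat n$ everywhere and there is a smooth map $S:M\to\mathbb R^4_1$ (a sphere congruence, not required to be immersed at every point) with $S(p)\in F(p)\cap\hat F(p)$ for all $p$, which is a nondegenerate Darboux congruence: the third fundamental forms of $F$ and $\hat F$ are conformal; curvature lines correspond, i.e. along them the components of $d\nu(n)$ and $d\nu(\hat n)$ orthogonal to $\nu(n),\nu(\hat n)$ are parallel; and these components, as maps of $T_pM$ into the plane $\{\nu(n),\nu(\hat n)\}^\perp$, have opposite orientations. A real number $m$ is the *spectral parameter* of the pair if, with $a_1,a_4$ proportional to $\nu(n),\nu(\hat n)$ and scaled to $\langle a_1,a_4\rangle=-1$, the scalar product of the components of $da_4$ and $da_1$ orthogonal to $a_1,a_4$ is $m\,\mathrm{Re}\,q$. A *(normalized) curved flat framing* with envelopes $F,\hat F$ on an open set $U$ is a smooth map $A=(a_0;a_1,\dots,a_4):U\to L$ with $F=[a_0,a_1]$, $\hat F=[a_0,a_4]$, whose connection form $\alpha=(\alpha_0,\alpha')=A^{-1}dA$ satisfies $\alpha^1_0=\alpha^4_0=0$, $\alpha'_{\mathfrak m}\wedge\alpha'_{\mathfrak m}=0$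 (where $\alpha'_{\mathfrak m}$ consists of the entries $\alpha^i_j$ of $\alpha'$ with exactly one of $i,j$ in $\{1,4\}$) and $\alpha^1_1=0$. For $\lambda\in\mathbb R$, $\alpha'_\lambda$ arises from $\alpha'$ by multiplying $\alpha^1_2,\alpha^1_3$ (and the equal entries $\alpha^2_4,\alpha^3_4$) by $\lambda$. Put $$g(s,v)=\left[\begin{pmatrix}s\\0\\0\\0\end{pmatrix},\begin{pmatrix}1/v^4&v^2/v^4&v^3/v^4&v^1\\0&1&0&v^2\\0&0&1&v^3\\0&0&0&v^4\end{pmatrix}\right],\quad g^-_\lambda(s,v)=\left[\begin{pmatrix}0\\0\\0\\\lambda r/v^1\end{pmatrix},\begin{pmatrix}\lambda^{-1}v^1&0&0&0\\v^2&1&0&0\\v^3&0&1&0\\\lambda v^4&\lambda v^2/v^1&\lambda v^3/v^1&\lambda/v^1\end{pmatrix}\right],\quad r=sv^4 .$$ *Superposition.* Let $F^{(1)},F^{(2)}$ be maps $M\to\Lambda$. A superposition datum with parameter $\lambda\neq0$ on an open set $U$ consists of curved flat framings $A^{(1)},A^{(2)}$ on $U$ with first envelope $F$ and second envelopes $F^{(1)},F^{(2)}$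 such that $A^{(2)}=A^{(1)}g(s,v)$ for smooth $s:U\to\mathbb R$ and $v:U\to\mathcal L^+$ with $v^1\ne0$, $dv=-{\alpha^{(1)}_\lambda}'v$ and $dr=v^2\alpha^2_0+v^3\alpha^3_0$ ($\alpha$ being the connection form of $A^{(1)}$). One writes $F'=F^{(1)}*_FF^{(2)}$, with parameter $\lambda$, if superposition data with parameter $\lambda$ exist around every point of $M$, and every superposition datum has parameter $\lambda$ and gives $F'=[\bar a_0,\bar a_1]$, where $\bar A=A^{(1)}g^-_\lambda(s,v)$. **Theorem 5 (Permutability Theorem).** Let $F$ be an $L$-isothermic immersion of $(M,q)$ with Bianchi–Darboux transforms $F^{(1)}$ and $F^{(2)}$. Assume that $F^{(1)}$ and $F^{(2)}$ do not have the same spectral parameter with respect to $F$ and that their unit normals are different at every point. Then there are an $L$-isothermic immersion $F^*\neq F$ of $(M,q)$, which is a Bianchi–Darboux transform of both $F^{(1)}$ and $F^{(2)}$, and real numbers $\lambda,\mu$ with $\mu=\lambda(\mu-1)$ such that $$F^*=F^{(1)}*_FF^{(2)}\ \text{ (with parameter }\lambda)\quad\text{and}\quad F^*=F^{(2)}*_FF^{(1)}\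 \text{ (with parameter }\mu).$$ -/

import Mathlib

open scoped Manifold ContDiff

noncomputable section

namespace Laguerre

/-- Euclidean 3-space. -/
abbrev E3 : Type := EuclideanSpace ℝ (Fin 3)

/-- The vector space underlying Minkowski 4-space; the coordinates `x¹, …, x⁴` are indexed by
`0, 1, 2, 3`. -/
abbrev V : Type := Fin 4 → ℝ

/-- The Lorentz scalar product `-2 x¹ x⁴ + (x²)² + (x³)²`, polarized. -/
def mink (x y : V) : ℝ := -(x 0 * y 3 + x 3 * y 0) + x 1 * y 1 + x 2 * y 2

/-- Gram matrix of `mink` in the standard basis. -/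
def gram : Matrix (Fin 4) (Fin 4) ℝ :=
  !![0, 0, 0, -1; 0, 1, 0, 0; 0, 0, 1, 0; -1, 0, 0, 0]

/-- The positive light cone; the time orientation is given by `x¹ + x⁴ > 0`. -/
def lightCone : Set V := {x | mink x x = 0 ∧ 0 < x 0 + x 3}

/-- The affine line through `a` with direction `b`, written `[a, b]`. -/
def lineThrough (a b : V) : Set V := {y | ∃ t : ℝ, y = a + t • b}

/-- A point `x` of Euclidean space as a point (sphere of radius zero) of Minkowski space. -/
def pointVec (x : E3) : V := ![x 0 / √2, x 1, x 2, -(x 0) / √2]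

/-- The future null vector belonging to a unit vector `n` of Euclidean space. -/
def nullVec (n : E3) : V := ![(1 + n 0) / 2, n 1 / √2, n 2 / √2, (1 - n 0) / 2]

/-- Contact elements of Euclidean 3-space: a point and an oriented unit normal. -/
structure ContactElement where
  pt : E3
  normal : E3
  norm_normal : ‖normal‖ = 1

/-- The null line of Minkowski space that represents a contact element. Its points are the
oriented spheres in oriented contact at `c.pt` with normal `c.normal`. -/
def ContactElement.nullLine (c : ContactElement) : Set V :=
  lineThrough (pointVec c.pt) (nullVec c.normal)

section Calculus

variable {M : Type*} [TopologicalSpace M] [ChartedSpace ℂ M]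
variable {E : Type*} [NormedAddCommGroup E] [NormedSpace ℝ E]

/-- Real `C^∞` maps from a surface, on a set. -/
def SmoothOn (g : M → E) (U : Set M) : Prop := ContMDiffOn 𝓘(ℝ, ℂ) 𝓘(ℝ, E) ∞ g U

/-- Real `C^∞` maps from a surface. -/
def Smooth (g : M → E) : Prop := ContMDiff 𝓘(ℝ, ℂ) 𝓘(ℝ, E) ∞ g

/-- The real differential of `g` at `p`. Mathlib identifies the tangent space at `p` with `ℂ` by
the preferred chart at `p`; on a Riemann surface the complex structure of the tangent space is
then multiplication by `Complex.I`. -/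
def diff (g : M → E) (p : M) : ℂ →L[ℝ] E := mfderiv 𝓘(ℝ, ℂ) 𝓘(ℝ, E) g p

end Calculus

variable {M : Type*} [TopologicalSpace M] [ChartedSpace ℂ M]

variable (M) in
/-- A holomorphic quadratic differential on a Riemann surface. At `p` it is the complex quadratic
form `X ↦ coeff p * X ^ 2` on the tangent space; its coefficient in every chart of the atlas that
is a preferred chart is holomorphic. -/
structure QuadraticDifferential where
  coeff : M → ℂ
  holomorphic : ∀ p₀ : M, DifferentiableOn ℂ
    (fun z => coeff ((chartAt ℂ p₀).symm z) *
      (deriv (chartAt ℂ ((chartAt ℂ p₀).symm z) ∘ (chartAt ℂ p₀).symm) z) ^ 2)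
    (chartAt ℂ p₀).target

/-- The symmetric complex bilinear form given by a quadratic differential at `p`. -/
def QuadraticDifferential.eval (q : QuadraticDifferential M) (p : M) (X Y : ℂ) : ℂ :=
  q.coeff p * X * Y

/-! ### Legendre and `L`-isothermic immersions -/

/-- Second fundamental form `-df · dn`. -/
def secondForm (F : M → ContactElement) (p : M) (X Y : ℂ) : ℝ :=
  -inner ℝ (diff (fun x => (F x).pt) p X) (diff (fun x => (F x).normal) p Y)

/-- The Hopf differential, i.e. the `(2,0)`-part of the second fundamental form: its coefficient
with respect to `dz²`, `II(∂_z, ∂_z)` with `∂_z = (∂_x - i ∂_y) / 2`. -/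
def hopf (F : M → ContactElement) (p : M) : ℂ :=
  ((secondForm F p 1 1 - secondForm F p Complex.I Complex.I : ℝ) -
    2 * Complex.I * (secondForm F p 1 Complex.I : ℝ)) / 4

/-- `F = (f, n)` is an `L`-isothermic (Legendre) immersion of the polarized surface `(M, q)`:
it is smooth, `df · n = 0`, the third fundamental form `dn · dn` is positive definite and
compatible with the complex structure of `M`, and the Hopf differential is a smooth real multiple
of `q`. -/
structure IsLIsothermic (q : QuadraticDifferential M) (F : M → ContactElement) : Prop where
  smooth_pt : Smooth fun p => (F p).pt
  smooth_normal : Smooth fun p => (F p).normal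
  contact : ∀ (p : M) (X : ℂ), inner ℝ (diff (fun x => (F x).pt) p X) (F p).normal = 0
  third_form : ∀ p : M, ∃ c : ℝ, 0 < c ∧
    ∀ X : ℂ, ‖diff (fun x => (F x).normal) p X‖ ^ 2 = c * ‖X‖ ^ 2
  hopf_eq : ∃ μ : M → ℝ, Smooth μ ∧ ∀ p, hopf F p = (μ p : ℂ) * q.coeff p

/-! ### Sphere congruences and Bianchi-Darboux transforms -/

/-- The null directions of a map into the space of contact elements. -/
def nullDir (F : M → ContactElement) (p : M) : V := nullVec (F p).normal

/-- Orientation, as a map into the plane orthogonal to the null directions of `F` and `G`, of the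
differential of the null directions of `H`. -/
def orientationDet (F G H : M → ContactElement) (p : M) : ℝ :=
  Matrix.det (Matrix.of
    ![nullDir F p, nullDir G p, diff (nullDir H) p 1, diff (nullDir H) p Complex.I])

/-- `S` is a nondegenerate Darboux sphere congruence with envelopes `F` and `G`.
* The sphere `S p` is in oriented contact with `F` and with `G` at `p`, and the two envelopes are
  distinct.
* Ribaucour: the curvature lines correspond. The curvature directions of an `L`-isothermic
  immersion of `(M, q)` are the `X` with `q(X, X)` real (at umbilics too); along them the
  differentials of the two null directions are parallel modulo these directions.
* Darboux: the third fundamental forms are conformal.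
* Nondegenerate: the envelopes have opposite orientations. -/
structure IsDarbouxCongruence (q : QuadraticDifferential M) (F G : M → ContactElement)
    (S : M → V) : Prop where
  smooth : Smooth S
  envelope_left : ∀ p, S p ∈ (F p).nullLine
  envelope_right : ∀ p, S p ∈ (G p).nullLine
  distinct : ∀ p, (F p).normal ≠ (G p).normal
  ribaucour : ∀ (p : M) (X : ℂ), (q.eval p X X).im = 0 →
    ¬ LinearIndependent ℝ
      ![nullDir F p, nullDir G p, diff (nullDir F) p X, diff (nullDir G) p X]
  darboux : ∀ p : M, ∃ c : ℝ, 0 < c ∧ ∀ X : ℂ,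
    ‖diff (fun x => (G x).normal) p X‖ = c * ‖diff (fun x => (F x).normal) p X‖
  nondegenerate : ∀ p : M, orientationDet F G F p * orientationDet F G G p < 0

/-- `F` and `G` are Bianchi-Darboux transforms of each other: `L`-isothermic immersions of `(M, q)`
that envelop a nondegenerate Darboux congruence. -/
structure IsBianchiDarboux (q : QuadraticDifferential M) (F G : M → ContactElement) : Prop where
  isothermic_left : IsLIsothermic q F
  isothermic_right : IsLIsothermic q G
  exists_congruence : ∃ S : M → V, IsDarbouxCongruence q F G S

/-- The scalar product of the components of `dν_G` and `dν_F` orthogonal to the null directions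
`ν_F`, `ν_G`, after scaling to `⟨ν_F, ν_G⟩ = -1`. In a frame `(S; a₁, a₂, a₃, a₄)` with
`F = [S, a₁]`, `G = [S, a₄]` it is `α¹₂ α²₁ + α¹₃ α³₁`. -/
def spectralForm (F G : M → ContactElement) (p : M) (X Y : ℂ) : ℝ :=
  (mink (diff (nullDir G) p X) (diff (nullDir F) p Y) -
      mink (diff (nullDir G) p X) (nullDir F p) * mink (diff (nullDir F) p Y) (nullDir G p) /
        mink (nullDir F p) (nullDir G p)) /
    (-mink (nullDir F p) (nullDir G p))

/-- The Bianchi-Darboux pair `F`, `G` on `(M, q)` has spectral parameter `m`. -/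
def HasSpectralParameter (q : QuadraticDifferential M) (F G : M → ContactElement) (m : ℝ) : Prop :=
  ∀ (p : M) (X Y : ℂ), spectralForm F G p X Y = m * (q.eval p X Y).re

/-! ### The Laguerre group and curved flat framings -/

/-- Affine maps `x ↦ mat x + pos` of Minkowski space; equivalently a position vector `a₀` together
with the columns `a₁, …, a₄` of a matrix. -/
structure Aff where
  pos : V
  mat : Matrix (Fin 4) (Fin 4) ℝ

/-- Composition of affine maps. -/
def Aff.mul (A B : Aff) : Aff := ⟨A.pos + A.mat.mulVec B.pos, A.mat * B.mat⟩

/-- The columns `a₁, …, a₄` (indexed by `0, 1, 2, 3`). -/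
def Aff.col (A : Aff) (j : Fin 4) : V := fun i => A.mat i j

/-- Membership in the Laguerre group `L = ℝ⁴ ⋊ SO₀(3,1)`. -/
def Aff.IsLaguerre (A : Aff) : Prop :=
  A.mat.transpose * gram * A.mat = gram ∧ A.mat.det = 1 ∧ 0 < A.mat 0 0 + A.mat 3 0

/-- The linear part `α' = a⁻¹ da` of the connection form; `α^i_j` has (shifted) indices `i, j`. -/
def conn (A : M → Aff) (p : M) (X : ℂ) : Matrix (Fin 4) (Fin 4) ℝ :=
  (A p).mat⁻¹ * Matrix.of fun i j => diff (fun x => (A x).mat i j) p X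

/-- The translation part `α₀ = a⁻¹ da₀` of the connection form. -/
def connPos (A : M → Aff) (p : M) (X : ℂ) : V :=
  (A p).mat⁻¹.mulVec (diff (fun x => (A x).pos) p X)

/-- The projection of `so(3,1)` to the complement `m` of `so(2) × so(1,1)`: only the entries that
mix the indices `{0, 3}` and `{1, 2}` are kept. -/
def mPart (B : Matrix (Fin 4) (Fin 4) ℝ) : Matrix (Fin 4) (Fin 4) ℝ :=
  Matrix.of fun i j => if (i = 0 ∨ i = 3) ↔ (j = 0 ∨ j = 3) then 0 else B i j

/-- A curved flat framing on the open set `U`, normalized by `α¹₁ = 0`, with first envelope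
`F = [a₀, a₁]` and second envelope `G = [a₀, a₄]`. The condition `flat` is
`α'_m ∧ α'_m = 0`. -/
structure IsCurvedFlatFraming (F G : M → ContactElement) (U : Set M) (A : M → Aff) : Prop where
  smooth_pos : SmoothOn (fun p => (A p).pos) U
  smooth_mat : ∀ i j, SmoothOn (fun p => (A p).mat i j) U
  laguerre : ∀ p ∈ U, (A p).IsLaguerre
  tangent_one : ∀ p ∈ U, ∀ X, connPos A p X 0 = 0
  tangent_four : ∀ p ∈ U, ∀ X, connPos A p X 3 = 0
  flat : ∀ p ∈ U, ∀ X Y, mPart (conn A p X) * mPart (conn A p Y) =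
    mPart (conn A p Y) * mPart (conn A p X)
  normalized : ∀ p ∈ U, ∀ X, conn A p X 0 0 = 0
  first_envelope : ∀ p ∈ U, (F p).nullLine = lineThrough (A p).pos ((A p).col 0)
  second_envelope : ∀ p ∈ U, (G p).nullLine = lineThrough (A p).pos ((A p).col 3)

/-- The linear part `α'_λ` of the deformed form: `α¹₂` and `α¹₃` are multiplied by `λ`. -/
def deform (lam : ℝ) (B : Matrix (Fin 4) (Fin 4) ℝ) : Matrix (Fin 4) (Fin 4) ℝ :=
  !![B 0 0, lam * B 0 1, lam * B 0 2, B 0 3;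
     B 1 0, B 1 1, B 1 2, lam * B 1 3;
     B 2 0, B 2 1, B 2 2, lam * B 2 3;
     B 3 0, B 3 1, B 3 2, B 3 3]

/-- The gauge `g(s, v)`. -/
def gaugePlus (s : ℝ) (v : V) : Aff where
  pos := ![s, 0, 0, 0]
  mat := !![1 / v 3, v 1 / v 3, v 2 / v 3, v 0;
            0, 1, 0, v 1;
            0, 0, 1, v 2;
            0, 0, 0, v 3]

/-- The gauge `g⁻_λ(s, v)`, where `r = s v⁴`. -/
def gaugeMinus (lam s : ℝ) (v : V) : Aff where
  pos := ![0, 0, 0, lam * (s * v 3) / v 0]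
  mat := !![lam⁻¹ * v 0, 0, 0, 0;
            v 1, 1, 0, 0;
            v 2, 0, 1, 0;
            lam * v 3, lam * v 1 / v 0, lam * v 2 / v 0, lam / v 0]

/-! ### Superposition -/

/-- Data on the open set `U` from which the superposition of `F₁` and `F₂` with respect to `F` is
built: curved flat framings `A₁`, `A₂` with first envelope `F` and second envelopes `F₁`, `F₂`,
related by `A₂ = A₁ g(s, v)`, where `v` takes values in the positive light cone and solves
`dv = -α'_λ v`, and `r = s v⁴` satisfies `dr = v² α²₀ + v³ α³₀` (`α` is the connection form of
`A₁`). The nonvanishing of `λ` and `v¹` makes `g⁻_λ(s, v)` well defined. -/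
structure IsSuperpositionDatum (F F₁ F₂ : M → ContactElement) (U : Set M) (A₁ A₂ : M → Aff)
    (lam : ℝ) (s : M → ℝ) (v : M → V) : Prop where
  isOpen : IsOpen U
  framing_one : IsCurvedFlatFraming F F₁ U A₁
  framing_two : IsCurvedFlatFraming F F₂ U A₂
  smooth_s : SmoothOn s U
  smooth_v : SmoothOn v U
  v_mem : ∀ p ∈ U, v p ∈ lightCone
  gauge_eq : ∀ p ∈ U, A₂ p = (A₁ p).mul (gaugePlus (s p) (v p))
  v_eq : ∀ p ∈ U, ∀ X, diff v p X = -(deform lam (conn A₁ p X)).mulVec (v p)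
  r_eq : ∀ p ∈ U, ∀ X, diff (fun x => s x * v x 3) p X =
    v p 1 * connPos A₁ p X 1 + v p 2 * connPos A₁ p X 2
  lam_ne : lam ≠ 0
  v_ne : ∀ p ∈ U, v p 0 ≠ 0

/-- `F'` is the superposition `F₁ *_F F₂`, with parameter `lam`: superposition data exist around
every point, and for all such data the parameter is `lam` and `F'` is the first envelope
`[ā₀, ā₁]` of the framing `A₁ g⁻_λ(s, v)`. -/
def IsSuperposition (F F₁ F₂ : M → ContactElement) (lam : ℝ) (F' : M → ContactElement) : Prop :=
  (∀ p : M, ∃ (U : Set M) (A₁ A₂ : M → Aff) (s : M → ℝ) (v : M → V),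
    p ∈ U ∧ IsSuperpositionDatum F F₁ F₂ U A₁ A₂ lam s v) ∧
  (∀ (U : Set M) (A₁ A₂ : M → Aff) (lam' : ℝ) (s : M → ℝ) (v : M → V),
    IsSuperpositionDatum F F₁ F₂ U A₁ A₂ lam' s v → ∀ p ∈ U,
      lam' = lam ∧
      (F' p).nullLine =
        lineThrough ((A₁ p).mul (gaugeMinus lam' (s p) (v p))).pos
          (((A₁ p).mul (gaugeMinus lam' (s p) (v p))).col 0))

end Laguerre

end

/-! The theorem reduces to linear algebra of three null vector fields. Scale the null directions of
F and F₁ to lifts X, Y with ⟨X, Y⟩ = −1 and ⟨dX, Y⟩ = 0. The Darboux conditions then imply ⟨dY, dX⟩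
= m₁ Re q, so dY is dX composed with the antilinear map U ↦ conj(qU), up to a real factor
(`exists_spectral`, `LiftAt.right_eq`). Such a scaling exists locally because the form ⟨dν, ν₁⟩/⟨ν,
ν₁⟩ is closed as soon as the spectral form is symmetric (`exists_primitive`). The factor m₁ is
constant: in a chart the Laplacian of X is a multiple of Y and conversely, which makes m₁q
holomorphic, and a real holomorphic factor is constant (`spectral_const`).

Let Z be a lift of the null direction of F₂, put w = −⟨X, Z⟩, u = −⟨Y, Z⟩ and 1 − λ = m₂/m₁. Then dZ
= (1−λ)(w dY + ⟨dY, Z⟩X), and in the differential of the null vector W = Z + (λ⁻¹−1)uX + (λ−1)wY all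
terms with dY cancel: dW = ((1−λ)/λ)(u dX + λ⟨dX, Z⟩Y) (`Configuration.diff_starDir`). Modulo Y, the
field W moves like X, so the pair (Y, W) inherits the Darboux conditions from the pair (Y, X). If S
and S + sX are the spheres that F shares with F₁ and with F₂, then F* is the line through S +
(λsw/u)Y with direction W. Its second fundamental form is a combination of that of F, of Re q and of
a conformal term, so its Hopf differential is again a real multiple of q
(`IsLocalStar.isLIsothermic`, `isBianchiDarboux_star`).

Up to scale, W equals ⟨ν₁, ν₂⟩ν − λ⟨ν, ν₂⟩ν₁ − μ⟨ν, ν₁⟩ν₂ with (1−λ)(1−μ) = 1, which is the relation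
μ = λ(μ−1). This expression does not depend on the lifts, hence is global, and it is invariant under
exchanging (F₁, λ) with (F₂, μ). The lines agree as well (`lineThrough_star_swap`), so a single F*
serves both orders.

For the superposition, complete X, Y to a frame and let v be the coordinates of Z: the equation dv =
−α'_λ v is the formula for dZ (`Configuration.superpositionDatum`). Conversely, α¹₁ = 0 makes the
null columns of any framing scaled lifts, so the two spectral parameters force the value of λ, and
g⁻_λ(s, v) reproduces W (`IsSuperpositionDatum.one_sub_lam`,
`IsSuperpositionDatum.lineThrough_gaugeMinus`). -/

noncomputable section

namespace Laguerre

/-! ### Smooth maps on a surface and rules for their differentials. -/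

section Calculus
variable {M : Type*} [TopologicalSpace M] [ChartedSpace ℂ M]
variable {E : Type*} [NormedAddCommGroup E] [NormedSpace ℝ E]
variable {E' : Type*} [NormedAddCommGroup E'] [NormedSpace ℝ E']

/-- Real `C^∞` maps from a surface, at a point. -/
def SmoothAt (g : M → E) (p : M) : Prop := ContMDiffAt 𝓘(ℝ, ℂ) 𝓘(ℝ, E) ∞ g p

/-- The continuity required by smoothness on a manifold is automatic: near `p` the map is its chart
expression composed with the chart. -/
theorem smoothAt_iff {g : M → E} {p : M} :
    SmoothAt g p ↔ ContDiffAt ℝ ∞ (g ∘ (chartAt ℂ p).symm) (chartAt ℂ p p) := by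
  unfold SmoothAt
  rw [contMDiffAt_iff]
  simp only [mfld_simps, contDiffWithinAt_univ]
  refine ⟨fun h => h.2, fun h => ⟨?_, h⟩⟩
  have h1 : ContinuousAt ((g ∘ (chartAt ℂ p).symm) ∘ chartAt ℂ p) p :=
    ContinuousAt.comp h.continuousAt ((chartAt ℂ p).continuousAt (mem_chart_source ℂ p))
  refine h1.congr ?_
  filter_upwards [(chartAt ℂ p).open_source.mem_nhds (mem_chart_source ℂ p)] with x hx
  simp [(chartAt ℂ p).left_inv hx]

/-- The tangent space at `p` is read in the preferred chart at `p`, so no coordinate change enters.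
All differentiation rules below are transported from the plane through this identity. -/
theorem SmoothAt.diff_eq {g : M → E} {p : M} (h : SmoothAt g p) :
    diff g p = fderiv ℝ (g ∘ (chartAt ℂ p).symm) (chartAt ℂ p p) := by
  unfold diff
  have h2 : MDifferentiableAt 𝓘(ℝ, ℂ) 𝓘(ℝ, E) g p :=
    ContMDiffAt.mdifferentiableAt h (by simp)
  refine (h2.mfderiv : _).trans ?_
  simp only [writtenInExtChartAt, mfld_simps, fderivWithin_univ]
  rfl

theorem SmoothAt.differentiableAt {g : M → E} {p : M} (h : SmoothAt g p) :
    DifferentiableAt ℝ (g ∘ (chartAt ℂ p).symm) (chartAt ℂ p p) :=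
  (smoothAt_iff.1 h).differentiableAt (by simp)

theorem SmoothAt.hasFDerivAt {g : M → E} {p : M} (h : SmoothAt g p) :
    HasFDerivAt (g ∘ (chartAt ℂ p).symm) (diff g p) (chartAt ℂ p p) := by
  rw [h.diff_eq]; exact h.differentiableAt.hasFDerivAt

theorem SmoothAt.continuousAt {g : M → E} {p : M} (h : SmoothAt g p) : ContinuousAt g p :=
  ContMDiffAt.continuousAt h

theorem SmoothAt.congr {f g : M → E} {p : M} (h : SmoothAt g p) (he : f =ᶠ[nhds p] g) :
    SmoothAt f p :=
  ContMDiffAt.congr_of_eventuallyEq h he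

theorem diff_congr {f g : M → E} {p : M} (he : f =ᶠ[nhds p] g) : diff f p = diff g p := by
  unfold diff
  exact Filter.EventuallyEq.mfderiv_eq he

theorem Smooth.smoothAt {g : M → E} (h : Smooth g) (p : M) : SmoothAt g p := h p

theorem SmoothOn.smoothAt {g : M → E} {U : Set M} (h : SmoothOn g U) (hU : IsOpen U) {p : M}
    (hp : p ∈ U) : SmoothAt g p := (h p hp).contMDiffAt (hU.mem_nhds hp)

theorem smoothOn_of_smoothAt {g : M → E} {U : Set M} (h : ∀ p ∈ U, SmoothAt g p) :
    SmoothOn g U := fun p hp => (h p hp).contMDiffWithinAt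

theorem smoothAt_const (c : E) (p : M) : SmoothAt (fun _ : M => c) p :=
  smoothAt_iff.2 contDiffAt_const

theorem diff_const (c : E) (p : M) (X : ℂ) : diff (fun _ : M => c) p X = 0 := by
  rw [(smoothAt_const c p).diff_eq]
  change fderiv ℝ (fun _ => c) _ X = 0
  simp

theorem SmoothAt.comp_contDiffAt {g : M → E} {p : M} {Φ : E → E'} (h : SmoothAt g p)
    (hΦ : ContDiffAt ℝ ∞ Φ (g p)) : SmoothAt (fun x => Φ (g x)) p := by
  rw [smoothAt_iff] at h ⊢
  refine ContDiffAt.comp (g := Φ) (f := g ∘ (chartAt ℂ p).symm) _ ?_ h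
  simpa using hΦ

theorem diff_comp {g : M → E} {p : M} {Φ : E → E'} {Φ' : E →L[ℝ] E'} (h : SmoothAt g p)
    (hs : ContDiffAt ℝ ∞ Φ (g p)) (hΦ : HasFDerivAt Φ Φ' (g p)) (X : ℂ) :
    diff (fun x => Φ (g x)) p X = Φ' (diff g p X) := by
  have h1 := (h.comp_contDiffAt hs).hasFDerivAt
  have h2 : HasFDerivAt (Φ ∘ (g ∘ (chartAt ℂ p).symm)) (Φ' ∘L diff g p) (chartAt ℂ p p) := by
    refine HasFDerivAt.comp _ ?_ h.hasFDerivAt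
    simpa using hΦ
  exact congrArg (fun L => L X) (h1.unique h2)

theorem SmoothAt.clm {g : M → E} {p : M} (h : SmoothAt g p) (L : E →L[ℝ] E') :
    SmoothAt (fun x => L (g x)) p := h.comp_contDiffAt L.contDiff.contDiffAt

theorem diff_clm {g : M → E} {p : M} (h : SmoothAt g p) (L : E →L[ℝ] E') (X : ℂ) :
    diff (fun x => L (g x)) p X = L (diff g p X) :=
  diff_comp h L.contDiff.contDiffAt L.hasFDerivAt X

theorem SmoothAt.add {f g : M → E} {p : M} (hf : SmoothAt f p) (hg : SmoothAt g p) :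
    SmoothAt (fun x => f x + g x) p :=
  smoothAt_iff.2 ((smoothAt_iff.1 hf).add (smoothAt_iff.1 hg))

theorem diff_add {f g : M → E} {p : M} (hf : SmoothAt f p) (hg : SmoothAt g p) (X : ℂ) :
    diff (fun x => f x + g x) p X = diff f p X + diff g p X :=
  congrArg (fun L => L X) ((hf.add hg).hasFDerivAt.unique (hf.hasFDerivAt.add hg.hasFDerivAt))

theorem SmoothAt.sub {f g : M → E} {p : M} (hf : SmoothAt f p) (hg : SmoothAt g p) :
    SmoothAt (fun x => f x - g x) p :=
  smoothAt_iff.2 ((smoothAt_iff.1 hf).sub (smoothAt_iff.1 hg))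

theorem diff_sub {f g : M → E} {p : M} (hf : SmoothAt f p) (hg : SmoothAt g p) (X : ℂ) :
    diff (fun x => f x - g x) p X = diff f p X - diff g p X :=
  congrArg (fun L => L X) ((hf.sub hg).hasFDerivAt.unique (hf.hasFDerivAt.sub hg.hasFDerivAt))

theorem SmoothAt.neg {f : M → E} {p : M} (hf : SmoothAt f p) : SmoothAt (fun x => -f x) p :=
  smoothAt_iff.2 (smoothAt_iff.1 hf).neg

theorem diff_neg {f : M → E} {p : M} (hf : SmoothAt f p) (X : ℂ) :
    diff (fun x => -f x) p X = -diff f p X :=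
  congrArg (fun L => L X) (hf.neg.hasFDerivAt.unique hf.hasFDerivAt.neg)

theorem SmoothAt.smul {f : M → ℝ} {g : M → E} {p : M} (hf : SmoothAt f p) (hg : SmoothAt g p) :
    SmoothAt (fun x => f x • g x) p :=
  smoothAt_iff.2 ((smoothAt_iff.1 hf).smul (smoothAt_iff.1 hg))

theorem diff_smul {f : M → ℝ} {g : M → E} {p : M} (hf : SmoothAt f p) (hg : SmoothAt g p)
    (X : ℂ) : diff (fun x => f x • g x) p X = diff f p X • g p + f p • diff g p X := by
  have := congrArg (fun L => L X)
    ((hf.smul hg).hasFDerivAt.unique (hf.hasFDerivAt.smul hg.hasFDerivAt))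
  simp only [Function.comp_apply, (chartAt ℂ p).left_inv (mem_chart_source ℂ p)] at this
  simpa [add_comm] using this

theorem SmoothAt.mul {f g : M → ℝ} {p : M} (hf : SmoothAt f p) (hg : SmoothAt g p) :
    SmoothAt (fun x => f x * g x) p := hf.smul hg

theorem diff_mul {f g : M → ℝ} {p : M} (hf : SmoothAt f p) (hg : SmoothAt g p)
    (X : ℂ) : diff (fun x => f x * g x) p X = diff f p X * g p + f p * diff g p X :=
  diff_smul hf hg X

theorem SmoothAt.inv {f : M → ℝ} {p : M} (hf : SmoothAt f p) (h0 : f p ≠ 0) :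
    SmoothAt (fun x => (f x)⁻¹) p := hf.comp_contDiffAt (contDiffAt_inv ℝ h0)

theorem diff_inv {f : M → ℝ} {p : M} (hf : SmoothAt f p) (h0 : f p ≠ 0) (X : ℂ) :
    diff (fun x => (f x)⁻¹) p X = -diff f p X / f p ^ 2 := by
  rw [diff_comp hf (contDiffAt_inv ℝ h0) (hasFDerivAt_inv h0)]
  simp [div_eq_mul_inv]

theorem SmoothAt.div {f g : M → ℝ} {p : M} (hf : SmoothAt f p) (hg : SmoothAt g p)
    (h0 : g p ≠ 0) : SmoothAt (fun x => f x / g x) p := by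
  simpa only [div_eq_mul_inv] using hf.mul (hg.inv h0)

theorem SmoothAt.apply {ι : Type*} [Fintype ι] {g : M → ι → ℝ} {p : M} (h : SmoothAt g p)
    (i : ι) : SmoothAt (fun x => g x i) p :=
  h.clm (ContinuousLinearMap.proj (R := ℝ) (φ := fun _ : ι => ℝ) i)

theorem diff_apply {ι : Type*} [Fintype ι] {g : M → ι → ℝ} {p : M} (h : SmoothAt g p) (i : ι)
    (X : ℂ) : diff (fun x => g x i) p X = diff g p X i :=
  diff_clm h (ContinuousLinearMap.proj (R := ℝ) (φ := fun _ : ι => ℝ) i) X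

theorem smoothAt_pi {ι : Type*} [Fintype ι] {g : M → ι → ℝ} {p : M}
    (h : ∀ i, SmoothAt (fun x => g x i) p) : SmoothAt g p :=
  smoothAt_iff.2 (contDiffAt_pi.2 fun i => smoothAt_iff.1 (h i))

theorem SmoothAt.mink {f g : M → V} {p : M} (hf : SmoothAt f p) (hg : SmoothAt g p) :
    SmoothAt (fun x => mink (f x) (g x)) p := by
  unfold Laguerre.mink
  exact (((((hf.apply 0).mul (hg.apply 3)).add ((hf.apply 3).mul (hg.apply 0))).neg).add
    ((hf.apply 1).mul (hg.apply 1))).add ((hf.apply 2).mul (hg.apply 2))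

theorem diff_mink {f g : M → V} {p : M} (hf : SmoothAt f p) (hg : SmoothAt g p) (X : ℂ) :
    diff (fun x => mink (f x) (g x)) p X = mink (diff f p X) (g p) + mink (f p) (diff g p X) := by
  unfold Laguerre.mink
  rw [diff_add ((((((hf.apply 0).mul (hg.apply 3)).add ((hf.apply 3).mul (hg.apply 0))).neg).add
    ((hf.apply 1).mul (hg.apply 1)))) ((hf.apply 2).mul (hg.apply 2)),
    diff_add ((((hf.apply 0).mul (hg.apply 3)).add ((hf.apply 3).mul (hg.apply 0))).neg)
      ((hf.apply 1).mul (hg.apply 1)),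
    diff_neg (((hf.apply 0).mul (hg.apply 3)).add ((hf.apply 3).mul (hg.apply 0))),
    diff_add ((hf.apply 0).mul (hg.apply 3)) ((hf.apply 3).mul (hg.apply 0)),
    diff_mul (hf.apply 0) (hg.apply 3), diff_mul (hf.apply 3) (hg.apply 0),
    diff_mul (hf.apply 1) (hg.apply 1), diff_mul (hf.apply 2) (hg.apply 2)]
  simp only [diff_apply hf, diff_apply hg]
  ring

/-- Used to differentiate scalar relations, such as ⟨X, Y⟩ = −1, that hold only near a point. -/
theorem diff_eq_zero_of_eventually_const {f : M → E} {p : M} {c : E}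
    (h : ∀ᶠ x in nhds p, f x = c) (X : ℂ) : diff f p X = 0 := by
  rw [diff_congr (g := fun _ => c) h, diff_const]

end Calculus

/-! ### Algebra of the Lorentz scalar product -/

theorem mink_comm (x y : V) : mink x y = mink y x := by unfold mink; ring

theorem mink_add_left (x y z : V) : mink (x + y) z = mink x z + mink y z := by
  simp only [mink, Pi.add_apply]; ring

theorem mink_add_right (x y z : V) : mink x (y + z) = mink x y + mink x z := by
  simp only [mink, Pi.add_apply]; ring

theorem mink_sub_left (x y z : V) : mink (x - y) z = mink x z - mink y z := by
  simp only [mink, Pi.sub_apply]; ring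

theorem mink_sub_right (x y z : V) : mink x (y - z) = mink x y - mink x z := by
  simp only [mink, Pi.sub_apply]; ring

theorem mink_smul_left (c : ℝ) (x y : V) : mink (c • x) y = c * mink x y := by
  simp only [mink, Pi.smul_apply, smul_eq_mul]; ring

theorem mink_smul_right (c : ℝ) (x y : V) : mink x (c • y) = c * mink x y := by
  simp only [mink, Pi.smul_apply, smul_eq_mul]; ring

theorem mink_neg_left (x y : V) : mink (-x) y = -mink x y := by
  simp only [mink, Pi.neg_apply]; ring

theorem mink_neg_right (x y : V) : mink x (-y) = -mink x y := by
  simp only [mink, Pi.neg_apply]; ring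

theorem mink_zero_left (x : V) : mink 0 x = 0 := by simp [mink]

theorem mink_zero_right (x : V) : mink x 0 = 0 := by simp [mink]

/-- The determinant of four vectors of Minkowski space. -/
def det4 (a b c d : V) : ℝ := Matrix.det (Matrix.of ![a, b, c, d])

theorem det4_eq (a b c d : V) : det4 a b c d =
    a 0 * (b 1 * (c 2 * d 3 - c 3 * d 2) - b 2 * (c 1 * d 3 - c 3 * d 1)
      + b 3 * (c 1 * d 2 - c 2 * d 1))
    - a 1 * (b 0 * (c 2 * d 3 - c 3 * d 2) - b 2 * (c 0 * d 3 - c 3 * d 0)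
      + b 3 * (c 0 * d 2 - c 2 * d 0))
    + a 2 * (b 0 * (c 1 * d 3 - c 3 * d 1) - b 1 * (c 0 * d 3 - c 3 * d 0)
      + b 3 * (c 0 * d 1 - c 1 * d 0))
    - a 3 * (b 0 * (c 1 * d 2 - c 2 * d 1) - b 1 * (c 0 * d 2 - c 2 * d 0)
      + b 2 * (c 0 * d 1 - c 1 * d 0)) := by
  unfold det4
  simp [Matrix.det_succ_row_zero, Fin.sum_univ_succ, Fin.succAbove]
  ring

/-- Modulo `a` and `b` only the 2 × 2 determinant of the remaining components survives; this is how
orientations and parallelism modulo two null directions are measured. -/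
theorem det4_combination (a b e f : V) (s t x y s' t' x' y' : ℝ) :
    det4 a b (s • a + t • b + x • e + y • f) (s' • a + t' • b + x' • e + y' • f) =
      (x * y' - y * x') * det4 a b e f := by
  simp only [det4_eq, Pi.add_apply, Pi.smul_apply, smul_eq_mul]
  ring

theorem det4_eq_zero_of_dependent {a b c d : V} (h : ¬ LinearIndependent ℝ ![a, b, c, d]) :
    det4 a b c d = 0 := by
  by_contra h0
  exact h (Matrix.linearIndependent_rows_of_det_ne_zero (A := Matrix.of ![a, b, c, d]) h0)

/-- A vector orthogonal to two null vectors spanning a Lorentz plane and to an orthogonal basis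
of its orthogonal complement vanishes. -/
theorem eq_zero_of_orthogonal {X Y e f D : V} {κ : ℝ} (hκ : κ ≠ 0)
    (hXX : mink X X = 0) (hYY : mink Y Y = 0) (hXY : mink X Y = -1)
    (heX : mink e X = 0) (heY : mink e Y = 0) (hfX : mink f X = 0) (hfY : mink f Y = 0)
    (hee : mink e e = κ) (hff : mink f f = κ) (hef : mink e f = 0)
    (hX : mink D X = 0) (hY : mink D Y = 0) (he : mink D e = 0) (hf : mink D f = 0) : D = 0 := by
  set A : Matrix (Fin 4) (Fin 4) ℝ := Matrix.of ![X, Y, e, f] with hA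
  have entry : ∀ x y : V, x ⬝ᵥ gram.mulVec y = mink x y := by
    intro x y
    simp [gram, mink, dotProduct, Matrix.mulVec, Fin.sum_univ_four]; ring
  have hGram : A * gram * A.transpose = !![0, -1, 0, 0; -1, 0, 0, 0; 0, 0, κ, 0; 0, 0, 0, κ] := by
    ext i j
    have : (A * gram * A.transpose) i j = mink (![X, Y, e, f] i) (![X, Y, e, f] j) := by
      rw [← entry, Matrix.mul_assoc, Matrix.mul_apply]
      rfl
    rw [this]
    fin_cases i <;> fin_cases j <;>
      simp [hXX, hYY, hXY, heX, heY, hfX, hfY, hee, hff, hef, mink_comm Y X, mink_comm X e,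
        mink_comm X f, mink_comm Y e, mink_comm Y f, mink_comm f e]
  -- The Gram matrix has determinant −κ², so the four vectors form a basis.
  have hdet : A.det ≠ 0 := by
    intro h0
    have h1 := congrArg Matrix.det hGram
    rw [Matrix.det_mul, Matrix.det_mul, h0] at h1
    have h2 : Matrix.det !![0, -1, 0, 0; -1, 0, 0, 0; 0, 0, κ, 0; 0, 0, 0, κ] = -(κ * κ) := by
      simp [Matrix.det_succ_row_zero, Fin.sum_univ_succ, Fin.succAbove]
    rw [h2] at h1
    apply hκ
    have : κ * κ = 0 := by linarith
    simpa using this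
  have hker : A.mulVec (gram.mulVec D) = 0 := by
    ext i
    have : A.mulVec (gram.mulVec D) i = mink (![X, Y, e, f] i) D := entry _ _
    rw [this, mink_comm]
    fin_cases i <;> simp [hX, hY, he, hf]
  have hD := Matrix.eq_zero_of_mulVec_eq_zero hdet hker
  ext i
  have h0 := congrFun hD 0
  have h1 := congrFun hD 1
  have h2 := congrFun hD 2
  have h3 := congrFun hD 3
  simp [gram, Matrix.mulVec, dotProduct, Fin.sum_univ_four] at h0 h1 h2 h3
  fin_cases i <;> simp [h0, h1, h2, h3]

/-! ### Conformal maps of the plane and the pointwise spectral parameter. -/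

theorem clm_complex_apply {E : Type*} [NormedAddCommGroup E] [NormedSpace ℝ E] (L : ℂ →L[ℝ] E)
    (U : ℂ) : L U = U.re • L 1 + U.im • L Complex.I := by
  conv_lhs => rw [← Complex.re_add_im U]
  rw [map_add]
  congr 1
  · rw [← L.map_smul]; simp
  · rw [← L.map_smul]; simp

/-- A quadratic form `t` that is real wherever the quadratic form `q` is real is a real
multiple of `q`. -/
theorem exists_real_multiple {q t : ℂ} (h : ∀ X : ℂ, (q * X * X).im = 0 → (t * X * X).im = 0)
    (ht : t ≠ 0) : q ≠ 0 ∧ ∃ m : ℝ, m ≠ 0 ∧ t = m * q := by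
  have hq : q ≠ 0 := by
    rintro rfl
    have h1 := h 1 (by simp)
    -- If `q` vanished, every direction would be admissible: X = 1 kills the imaginary part of `t`,
    -- and (1 + i)² = 2i kills its real part.
    have h2 := h (1 + Complex.I) (by simp)
    apply ht
    apply Complex.ext
    · simp at h2
      simp at h1
      simp
      linarith
    · simpa using h1
  -- With X² = conj q the value qX² = |q|² is real, so t · conj q is real and t is a real multiple
  -- of q.
  obtain ⟨X, hX⟩ := IsAlgClosed.exists_eq_mul_self ((starRingEnd ℂ) q)
  have h1 := h X (by rw [mul_assoc, ← hX, Complex.mul_conj]; exact Complex.ofReal_im _)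
  rw [mul_assoc, ← hX] at h1
  have hn : Complex.normSq q ≠ 0 := by simpa using hq
  have h2 : t = (((t * (starRingEnd ℂ) q).re / Complex.normSq q : ℝ) : ℂ) * q := by
    have h3 : t * (starRingEnd ℂ) q = ((t * (starRingEnd ℂ) q).re : ℝ) :=
      Complex.ext (by simp) (by rw [h1]; simp)
    have h4 : (Complex.normSq q : ℂ) = q * (starRingEnd ℂ) q := (Complex.mul_conj q).symm
    rw [Complex.ofReal_div, ← h3, h4]
    have : (starRingEnd ℂ) q ≠ 0 := by simpa using hq
    field_simp
  refine ⟨hq, _, ?_, h2⟩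
  intro h0
  rw [h0] at h2
  simp [ht] at h2

/-- A conformal `2 × 2` matrix with negative determinant is anticonformal. -/
theorem anticonformal_of_det_neg {α β γ δ : ℝ} (c1 : α * γ + β * δ = 0)
    (c2 : γ * γ + δ * δ = α * α + β * β) (hneg : α * δ - β * γ < 0) : γ = β ∧ δ = -α := by
  have c3 : α * δ - β * γ = -(α * α + β * β) := by
    -- By Lagrange's identity the squared determinant of two orthogonal rows of equal length is the
    -- square of α² + β²; the sign hypothesis selects the negative root.
    have h1 : (α * δ - β * γ - (α * α + β * β)) * (α * δ - β * γ + (α * α + β * β)) = 0 := by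
      linear_combination (α * α + β * β) * c2 - (α * γ + β * δ) * c1
    rcases mul_eq_zero.1 h1 with h2 | h2
    · linarith [mul_self_nonneg α, mul_self_nonneg β]
    · linarith
  have c4 : (γ - β) * (γ - β) + (δ + α) * (δ + α) = 0 := by linear_combination c2 + 2 * c3
  have e1 := mul_self_nonneg (γ - β)
  have e2 := mul_self_nonneg (δ + α)
  have e3 : γ - β = 0 := mul_self_eq_zero.1 (by linarith)
  have e4 : δ + α = 0 := mul_self_eq_zero.1 (by linarith)
  exact ⟨by linarith, by linarith⟩

/-- The relation between the differentials `A`, `B` of two null vector fields with values `N`,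
`N₁` at a point, at which the two vector fields are conformal, have opposite orientations and have
corresponding curvature directions. -/
theorem exists_spectral {q : ℂ} {N N₁ : V} {A B : ℂ →L[ℝ] V} {κ κ₁ : ℝ} (hκ : 0 < κ)
    (hκ₁ : 0 < κ₁) (hN : mink N N = 0) (hN₁ : mink N₁ N₁ = 0) (hh : mink N N₁ ≠ 0)
    (hA : ∀ U, mink (A U) N = 0) (hB : ∀ U, mink (B U) N₁ = 0)
    (hAA : ∀ U W, mink (A U) (A W) = κ * (U.re * W.re + U.im * W.im))
    (hBB : ∀ U W, mink (B U) (B W) = κ₁ * (U.re * W.re + U.im * W.im))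
    (hR : ∀ U, (q * U * U).im = 0 → det4 N N₁ (A U) (B U) = 0)
    (hdet : det4 N N₁ (A 1) (A Complex.I) * det4 N N₁ (B 1) (B Complex.I) < 0) :
    q ≠ 0 ∧ ∃ m : ℝ, m ≠ 0 ∧ ∀ U W, (mink (B U) (A W) -
      mink (B U) N * mink (A W) N₁ / mink N N₁) / (-mink N N₁) = m * (q * U * W).re := by
  set h := mink N N₁ with hhdef
  have hN₁N : mink N₁ N = h := mink_comm _ _
  set a := mink (A 1) N₁ / h with ha
  set b := mink (A Complex.I) N₁ / h with hb
  set c := mink (B 1) N / h with hc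
  set d := mink (B Complex.I) N / h with hd
  have ha' : mink (A 1) N₁ = a * h := by rw [ha]; field_simp
  have hb' : mink (A Complex.I) N₁ = b * h := by rw [hb]; field_simp
  have hc' : mink (B 1) N = c * h := by rw [hc]; field_simp
  have hd' : mink (B Complex.I) N = d * h := by rw [hd]; field_simp
  -- `e` and `f` are the components of `A 1` and `A I` orthogonal to both null vectors. Subtracting
  -- multiples of the null vector `N` does not change scalar products among values of `A`.
  obtain ⟨e, he⟩ : ∃ e, e = A 1 - a • N := ⟨_, rfl⟩
  obtain ⟨f, hf⟩ : ∃ f, f = A Complex.I - b • N := ⟨_, rfl⟩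
  have hA1 : A 1 = e + a • N := by rw [he]; abel
  have hAI : A Complex.I = f + b • N := by rw [hf]; abel
  have A11 := hAA 1 1
  have A1I := hAA 1 Complex.I
  have AII := hAA Complex.I Complex.I
  have B11 := hBB 1 1
  have B1I := hBB 1 Complex.I
  have BII := hBB Complex.I Complex.I
  simp only [Complex.one_re, Complex.one_im, Complex.I_re, Complex.I_im, mul_one, mul_zero,
    add_zero, zero_add] at A11 A1I AII B11 B1I BII
  have NA1 : mink N (A 1) = 0 := by rw [mink_comm]; exact hA 1
  have NAI : mink N (A Complex.I) = 0 := by rw [mink_comm]; exact hA _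
  have heN : mink e N = 0 := by simp [he, mink_sub_left, mink_smul_left, hA, hN]
  have hfN : mink f N = 0 := by simp [hf, mink_sub_left, mink_smul_left, hA, hN]
  have heN₁ : mink e N₁ = 0 := by simp [he, mink_sub_left, mink_smul_left, ha', ← hhdef]
  have hfN₁ : mink f N₁ = 0 := by simp [hf, mink_sub_left, mink_smul_left, hb', ← hhdef]
  have hee : mink e e = κ := by
    simp [he, mink_sub_left, mink_sub_right, mink_smul_left, mink_smul_right, hA, hN, A11, NA1]
  have hff : mink f f = κ := by
    simp [hf, mink_sub_left, mink_sub_right, mink_smul_left, mink_smul_right, hA, hN, AII, NAI]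
  have hef : mink e f = 0 := by
    simp [he, hf, mink_sub_left, mink_sub_right, mink_smul_left, mink_smul_right, hA, hN, A1I, NAI]
  have hfe : mink f e = 0 := by rw [mink_comm]; exact hef
  have hNe : mink N e = 0 := by rw [mink_comm]; exact heN
  have hNf : mink N f = 0 := by rw [mink_comm]; exact hfN
  have hN₁e : mink N₁ e = 0 := by rw [mink_comm]; exact heN₁
  have hN₁f : mink N₁ f = 0 := by rw [mink_comm]; exact hfN₁
  have key : ∀ D : V, mink D N₁ = 0 → 
      D - (mink D N / h) • N₁ = (mink D e / κ) • e + (mink D f / κ) • f := by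
    intro D hD
    rw [← sub_eq_zero]
    apply eq_zero_of_orthogonal (X := N) (Y := (-h)⁻¹ • N₁) (e := e) (f := f) hκ.ne' hN
    all_goals simp only [mink_sub_left, mink_add_left, mink_smul_left, mink_smul_right, hN₁, hN₁N,
      heN, hfN, heN₁, hfN₁, hee, hff, hef, hfe, hD, hN₁e, hN₁f, ← hhdef]
    all_goals field_simp
    all_goals ring
  obtain ⟨α, hα⟩ : ∃ α, α = mink (B 1) e / κ := ⟨_, rfl⟩
  obtain ⟨β, hβ⟩ : ∃ β, β = mink (B 1) f / κ := ⟨_, rfl⟩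
  obtain ⟨γ, hγ⟩ : ∃ γ, γ = mink (B Complex.I) e / κ := ⟨_, rfl⟩
  obtain ⟨δ, hδ⟩ : ∃ δ, δ = mink (B Complex.I) f / κ := ⟨_, rfl⟩
  have hB1 : B 1 = c • N₁ + α • e + β • f := by
    have := key (B 1) (hB 1)
    rw [← hα, ← hβ, ← hc] at this
    rw [add_assoc, ← this]; abel
  have hBI : B Complex.I = d • N₁ + γ • e + δ • f := by
    have := key (B Complex.I) (hB _)
    rw [← hγ, ← hδ, ← hd] at this
    rw [add_assoc, ← this]; abel
  clear_value a b c d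
  have expand : ∀ x y z x' y' z' : ℝ, mink (z • N₁ + x • e + y • f) (z' • N₁ + x' • e + y' • f) =
      κ * (x * x' + y * y') := by
    intro x y z x' y' z'
    simp only [mink_add_left, mink_add_right, mink_smul_left, mink_smul_right, hN₁, hee, hff, hef,
      hfe, heN₁, hfN₁, hN₁e, hN₁f]
    ring
  rw [hB1, expand] at B11
  rw [hB1, hBI, expand] at B1I
  rw [hBI, expand] at BII
  have dA : det4 N N₁ (A 1) (A Complex.I) = det4 N N₁ e f := by
    have := det4_combination N N₁ e f a 0 1 0 b 0 0 1
    rw [hA1, hAI]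
    convert this using 2
    · module
    · module
    · ring
  have dB : det4 N N₁ (B 1) (B Complex.I) = (α * δ - β * γ) * det4 N N₁ e f := by
    rw [← det4_combination N N₁ e f 0 c α β 0 d γ δ, hB1, hBI]
    congr 1 <;> module
  have hneg : α * δ - β * γ < 0 := by
    rw [dA, dB] at hdet
    by_contra hcon
    have : 0 ≤ (α * δ - β * γ) * (det4 N N₁ e f * det4 N N₁ e f) :=
      mul_nonneg (not_lt.1 hcon) (mul_self_nonneg _)
    linarith
  have hD0 : det4 N N₁ e f ≠ 0 := by
    intro h0
    rw [dA, h0] at hdet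
    simp at hdet
  have c1 : α * γ + β * δ = 0 := (mul_eq_zero.1 B1I).resolve_left hκ.ne'
  have c2 : γ * γ + δ * δ = α * α + β * β := mul_left_cancel₀ hκ.ne' (BII.trans B11.symm)
  obtain ⟨hγβ, hδα⟩ := anticonformal_of_det_neg c1 c2 hneg
  subst hγβ hδα
  clear hα hβ hγ hδ key
  -- The matrix of `B` relative to `e`, `f` is anticonformal, so pairing the orthogonal components
  -- of B U and A W gives κ Re((α − iγ)UW). Division by −h produces `t`.
  obtain ⟨t, ht⟩ : ∃ t : ℂ, t = ⟨κ * α / (-h), -(κ * γ) / (-h)⟩ := ⟨_, rfl⟩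
  have hre : t.re = κ * α / (-h) := by rw [ht]
  have him : t.im = -(κ * γ) / (-h) := by rw [ht]
  have ht0 : t ≠ 0 := by
    intro h0
    rw [h0] at hre him
    have e1 : κ * α = 0 := by
      rw [Complex.zero_re, eq_comm, div_eq_zero_iff] at hre
      exact hre.resolve_right (neg_ne_zero.2 hh)
    have e2 : κ * γ = 0 := by
      rw [Complex.zero_im, eq_comm, div_eq_zero_iff] at him
      exact neg_eq_zero.1 (him.resolve_right (neg_ne_zero.2 hh))
    have : κ₁ = 0 := by rw [← B11]; linear_combination α * e1 + γ * e2
    exact hκ₁.ne' this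
  have hAU : ∀ U : ℂ, A U = (U.re * a + U.im * b) • N + (0 : ℝ) • N₁ + U.re • e + U.im • f := by
    intro U
    rw [clm_complex_apply A U, hA1, hAI]; module
  have hBU : ∀ U : ℂ, B U = (0 : ℝ) • N + (U.re * c + U.im * d) • N₁ + (U.re * α + U.im * γ) • e +
      (U.re * γ - U.im * α) • f := by
    intro U
    rw [clm_complex_apply B U, hB1, hBI]; module
  -- That A U and B U are parallel modulo the null vectors says Im(tU²) = 0, so the correspondence
  -- of curvature lines makes `t` a real multiple of `q`.
  obtain ⟨hq, m, hm, htm⟩ := exists_real_multiple (q := q) (t := t) (by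
    intro U hU
    have h1 := hR U hU
    rw [hAU, hBU, det4_combination] at h1
    have h2 := (mul_eq_zero.1 h1).resolve_right hD0
    simp only [Complex.mul_im, Complex.mul_re, hre, him]
    field_simp
    linear_combination κ * h2) ht0
  refine ⟨hq, m, hm, fun U W => ?_⟩
  have h1 : m * (q * U * W).re = (t * U * W).re := by
    rw [htm, ← Complex.re_ofReal_mul]; ring_nf
  rw [h1]
  simp only [Complex.mul_im, Complex.mul_re, hre, him]
  rw [hAU, hBU]
  simp only [mink_add_left, mink_add_right, mink_smul_left, mink_smul_right, hN, hN₁, hee, hff, hef,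
      hfe, heN₁, hfN₁, hN₁e, hN₁f, hNe, hNf, heN, hfN, ← hhdef, hN₁N]
  field_simp
  ring

/-! ### Pointwise algebra of scaled lifts. -/

/-- The values `X`, `Y` and the differentials `A`, `B` at a point of two null vector fields that
are lifts of a Bianchi-Darboux pair with spectral parameter `m`, where `c` is the coefficient of
the quadratic differential; `X`, `Y` are scaled such that `⟨X, Y⟩ = -1` and `⟨dX, Y⟩ = 0`. -/
structure LiftAt (c : ℂ) (m κ : ℝ) (X Y : V) (A B : ℂ →L[ℝ] V) : Prop where
  null_left : mink X X = 0
  null_right : mink Y Y = 0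
  pair : mink X Y = -1
  left_left : ∀ U, mink (A U) X = 0
  left_right : ∀ U, mink (A U) Y = 0
  right_left : ∀ U, mink (B U) X = 0
  right_right : ∀ U, mink (B U) Y = 0
  pos : 0 < κ
  conformal : ∀ U W, mink (A U) (A W) = κ * (U.re * W.re + U.im * W.im)
  spectral : ∀ U W, mink (B U) (A W) = m * (c * U * W).re

namespace LiftAt

variable {c : ℂ} {m κ : ℝ} {X Y : V} {A B : ℂ →L[ℝ] V}

theorem eq_zero (h : LiftAt c m κ X Y A B) {D : V} (hX : mink D X = 0) (hY : mink D Y = 0)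
    (hA : ∀ U, mink D (A U) = 0) : D = 0 := by
  refine eq_zero_of_orthogonal (X := X) (Y := Y) (e := A 1) (f := A Complex.I) h.pos.ne'
    h.null_left h.null_right h.pair (h.left_left _) (h.left_right _) (h.left_left _)
    (h.left_right _) ?_ ?_ ?_ hX hY (hA _) (hA _) <;> simp [h.conformal]

theorem pair_symm (h : LiftAt c m κ X Y A B) : mink Y X = -1 := by rw [mink_comm]; exact h.pair

/-- Both sides are orthogonal to X and Y and have the same products with all A W: conformality of A
turns the pairing with A(conj(cU)) into κ Re(cUW). -/
theorem right_eq (h : LiftAt c m κ X Y A B) (U : ℂ) :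
    κ • B U = m • A ((starRingEnd ℂ) (c * U)) := by
  rw [← sub_eq_zero]
  apply h.eq_zero
  · simp [mink_sub_left, mink_smul_left, h.right_left, h.left_left]
  · simp [mink_sub_left, mink_smul_left, h.right_right, h.left_right]
  · intro W
    simp only [mink_sub_left, mink_smul_left, h.spectral, h.conformal]
    simp
    ring

theorem decomposition (h : LiftAt c m κ X Y A B) (Z : V) :
    Z = (-mink Z Y) • X + (-mink Z X) • Y + (mink Z (A 1) / κ) • A 1 +
      (mink Z (A Complex.I) / κ) • A Complex.I := by
  rw [← sub_eq_zero]
  have hκ := h.pos.ne'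
  refine eq_zero_of_orthogonal (X := X) (Y := Y) (e := A 1) (f := A Complex.I) hκ
    h.null_left h.null_right h.pair (h.left_left _) (h.left_right _) (h.left_left _)
    (h.left_right _) ?_ ?_ ?_ ?_ ?_ ?_ ?_
  · simp [h.conformal]
  · simp [h.conformal]
  · simp [h.conformal]
  · simp [mink_sub_left, mink_add_left, mink_neg_left, mink_smul_left, h.left_left, h.null_left, h.pair_symm]
  · simp [mink_sub_left, mink_add_left, mink_smul_left, mink_neg_left, h.left_right,
      h.null_right, h.pair]
  · simp only [mink_sub_left, mink_add_left, mink_smul_left, h.conformal, mink_comm X,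
      mink_comm Y, h.left_left, h.left_right]
    simp
    field_simp
    simp
  · simp only [mink_sub_left, mink_add_left, mink_smul_left, h.conformal, mink_comm X,
      mink_comm Y, h.left_left, h.left_right]
    simp
    field_simp
    simp

/-- Z can replace Y in the basis, because its Y-component is −⟨Z, X⟩ ≠ 0. -/
theorem eq_zero_of_orthogonal_third (h : LiftAt c m κ X Y A B) {Z D : V} (hw : mink Z X ≠ 0)
    (hX : mink D X = 0) (hZ : mink D Z = 0) (hA : ∀ U, mink D (A U) = 0) : D = 0 := by
  refine h.eq_zero hX ?_ hA
  rw [h.decomposition Z] at hZ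
  simp only [mink_add_right, mink_smul_right, hX, hA, mul_zero, zero_add, add_zero] at hZ
  exact (mul_eq_zero.1 hZ).resolve_left (neg_ne_zero.2 hw)

/-- The differential `C` of a lift `Z` of a second Bianchi-Darboux transform, with spectral
parameter `m₂`. -/
theorem second_eq (h : LiftAt c m κ X Y A B) (hm : m ≠ 0) {m₂ : ℝ} {Z : V} {C : ℂ →L[ℝ] V}
    (hw : mink X Z ≠ 0) (hCX : ∀ U, mink (C U) X = 0)
    (hCZ : ∀ U, mink (C U) Z = 0)
    (hCA : ∀ U W, mink (C U) (A W) = -mink X Z * (m₂ * (c * U * W).re)) (U : ℂ) :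
    C U = (m₂ / m) • ((-mink X Z) • B U + mink (B U) Z • X) := by
  rw [← sub_eq_zero]
  have hZX : mink Z X = mink X Z := mink_comm _ _
  have hDX : mink (C U - (m₂ / m) • ((-mink X Z) • B U + mink (B U) Z • X)) X = 0 := by
    simp [mink_sub_left, mink_add_left, mink_smul_left, mink_neg_left, hCX, h.right_left, h.null_left]
  have hDA : ∀ W, mink (C U - (m₂ / m) • ((-mink X Z) • B U + mink (B U) Z • X)) (A W) = 0 := by
    intro W
    simp only [mink_sub_left, mink_add_left, mink_smul_left, hCA, h.spectral, mink_comm X (A W),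
      h.left_left]
    field_simp
    ring
  -- The X-term of the formula is chosen exactly so that its right-hand side is orthogonal to Z.
  have hDZ : mink (C U - (m₂ / m) • ((-mink X Z) • B U + mink (B U) Z • X)) Z = 0 := by
    simp only [mink_sub_left, mink_add_left, mink_smul_left, hCZ]
    ring
  exact h.eq_zero_of_orthogonal_third (by rwa [hZX]) hDX hDZ hDA

end LiftAt

/-! ### Changes of charts on a Riemann surface. -/

section Charts
variable {M : Type*} [TopologicalSpace M] [ChartedSpace ℂ M]
variable {E : Type*} [NormedAddCommGroup E] [NormedSpace ℝ E]

/-- A complex analytic surface is a real smooth surface. -/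
theorem isManifold_real [IsManifold 𝓘(ℂ, ℂ) ω M] : IsManifold 𝓘(ℝ, ℂ) ∞ M := by
  refine isManifold_of_contDiffOn _ _ _ fun e e' he he' => ?_
  have h := (StructureGroupoid.compatible (contDiffGroupoid ω 𝓘(ℂ, ℂ)) he he').1
  have h1 : ContDiffOn ℂ ω (𝓘(ℂ, ℂ) ∘ e.symm ≫ₕ e' ∘ 𝓘(ℂ, ℂ).symm)
    (𝓘(ℂ, ℂ).symm ⁻¹' (e.symm ≫ₕ e').source ∩ Set.range 𝓘(ℂ, ℂ)) := h
  exact (h1.restrict_scalars ℝ).of_le le_top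

/-- The derivative at `z` of the change from the chart at `p₀` to the preferred chart. -/
def transition (p₀ : M) (z : ℂ) : ℂ :=
  deriv (chartAt ℂ ((chartAt ℂ p₀).symm z) ∘ (chartAt ℂ p₀).symm) z

theorem hasDerivAt_transition [IsManifold 𝓘(ℂ, ℂ) ω M] {p₀ : M} {z : ℂ}
    (hz : z ∈ (chartAt ℂ p₀).target) :
    HasDerivAt (chartAt ℂ ((chartAt ℂ p₀).symm z) ∘ (chartAt ℂ p₀).symm) (transition p₀ z) z := by
  have h1 : ContMDiffAt 𝓘(ℂ, ℂ) 𝓘(ℂ, ℂ) ω (chartAt ℂ p₀).symm z :=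
    (contMDiffOn_chart_symm (I := 𝓘(ℂ, ℂ)) (n := ω) (x := p₀)).contMDiffAt
      ((chartAt ℂ p₀).open_target.mem_nhds hz)
  have h2 : ContMDiffAt 𝓘(ℂ, ℂ) 𝓘(ℂ, ℂ) ω (chartAt ℂ ((chartAt ℂ p₀).symm z))
      ((chartAt ℂ p₀).symm z) :=
    (contMDiffOn_chart (I := 𝓘(ℂ, ℂ)) (n := ω)).contMDiffAt
      ((chartAt ℂ ((chartAt ℂ p₀).symm z)).open_source.mem_nhds (mem_chart_source ℂ _))
  exact ((contMDiffAt_iff_contDiffAt.1 (h2.comp z h1)).differentiableAt (by simp)).hasDerivAt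

/-- The opposite change of charts is also holomorphic, and the chain rule for their composition,
which is locally the identity, makes the product of the two derivatives 1. -/
theorem transition_ne_zero [IsManifold 𝓘(ℂ, ℂ) ω M] {p₀ : M} {z : ℂ}
    (hz : z ∈ (chartAt ℂ p₀).target) : transition p₀ z ≠ 0 := by
  set p := (chartAt ℂ p₀).symm z with hp
  have hps : p ∈ (chartAt ℂ p₀).source := (chartAt ℂ p₀).map_target hz
  have h1 : ContMDiffAt 𝓘(ℂ, ℂ) 𝓘(ℂ, ℂ) ω (chartAt ℂ p).symm (chartAt ℂ p p) :=
    (contMDiffOn_chart_symm (I := 𝓘(ℂ, ℂ)) (n := ω) (x := p)).contMDiffAt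
      ((chartAt ℂ p).open_target.mem_nhds (mem_chart_target ℂ p))
  have hpp : (chartAt ℂ p).symm (chartAt ℂ p p) = p :=
    (chartAt ℂ p).left_inv (mem_chart_source ℂ p)
  have h2 : ContMDiffAt 𝓘(ℂ, ℂ) 𝓘(ℂ, ℂ) ω (chartAt ℂ p₀)
      ((chartAt ℂ p).symm (chartAt ℂ p p)) := by
    rw [hpp]
    exact (contMDiffOn_chart (I := 𝓘(ℂ, ℂ)) (n := ω)).contMDiffAt
      ((chartAt ℂ p₀).open_source.mem_nhds hps)
  have h3 := ((contMDiffAt_iff_contDiffAt.1 (h2.comp _ h1)).differentiableAt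
    (by simp)).hasDerivAt
  have h4 := hasDerivAt_transition hz
  rw [← hp] at h4
  have h5 : HasDerivAt ((chartAt ℂ p₀ ∘ (chartAt ℂ p).symm) ∘
      (chartAt ℂ p ∘ (chartAt ℂ p₀).symm)) _ z := HasDerivAt.comp z h3 h4
  have h6 : (chartAt ℂ p₀ ∘ (chartAt ℂ p).symm) ∘ (chartAt ℂ p ∘ (chartAt ℂ p₀).symm) =ᶠ[nhds z]
      id := by
    have h7 : ContinuousAt (chartAt ℂ p₀).symm z := (chartAt ℂ p₀).symm.continuousAt hz
    filter_upwards [(chartAt ℂ p₀).open_target.mem_nhds hz,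
      h7.preimage_mem_nhds ((chartAt ℂ p).open_source.mem_nhds (mem_chart_source ℂ p))] with y hy hy'
    simp only [Function.comp_apply, id]
    rw [(chartAt ℂ p).left_inv hy', (chartAt ℂ p₀).right_inv hy]
  have h8 := h5.unique ((hasDerivAt_id z).congr_of_eventuallyEq h6)
  intro h0
  rw [h0] at h8
  simp at h8

theorem SmoothAt.comp_chart_symm [IsManifold 𝓘(ℂ, ℂ) ω M] {p₀ : M} {z : ℂ}
    (hz : z ∈ (chartAt ℂ p₀).target) {g : M → E} (hg : SmoothAt g ((chartAt ℂ p₀).symm z)) :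
    SmoothAt (fun y => g ((chartAt ℂ p₀).symm y)) z := by
  have : IsManifold 𝓘(ℝ, ℂ) ∞ M := isManifold_real
  have h1 : ContMDiffAt 𝓘(ℝ, ℂ) 𝓘(ℝ, ℂ) ∞ (chartAt ℂ p₀).symm z :=
    (contMDiffOn_chart_symm (I := 𝓘(ℝ, ℂ)) (n := ∞) (x := p₀)).contMDiffAt
      ((chartAt ℂ p₀).open_target.mem_nhds hz)
  exact ContMDiffAt.comp z hg h1

theorem SmoothAt.comp_chart [IsManifold 𝓘(ℂ, ℂ) ω M] {p₀ p : M}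
    (hp : p ∈ (chartAt ℂ p₀).source) {g : ℂ → E} (hg : SmoothAt g (chartAt ℂ p₀ p)) :
    SmoothAt (fun y => g (chartAt ℂ p₀ y)) p := by
  have : IsManifold 𝓘(ℝ, ℂ) ∞ M := isManifold_real
  have h1 : ContMDiffAt 𝓘(ℝ, ℂ) 𝓘(ℝ, ℂ) ∞ (chartAt ℂ p₀) p :=
    (contMDiffOn_chart (I := 𝓘(ℝ, ℂ)) (n := ∞) (x := p₀)).contMDiffAt
      ((chartAt ℂ p₀).open_source.mem_nhds hp)
  exact ContMDiffAt.comp p hg h1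

theorem diff_plane (g : ℂ → E) (z : ℂ) : diff g z = fderiv ℝ g z := mfderiv_eq_fderiv

theorem smoothAt_plane {g : ℂ → E} {z : ℂ} : SmoothAt g z ↔ ContDiffAt ℝ ∞ g z :=
  contMDiffAt_iff_contDiffAt

/-- On the manifold each tangent space uses its own preferred chart; in a fixed chart the argument
therefore acquires the factor `transition`. The same factor squared appears in
`QuadraticDifferential.chartCoeff`. -/
theorem diff_comp_chart_symm [IsManifold 𝓘(ℂ, ℂ) ω M] {p₀ : M} {z : ℂ}
    (hz : z ∈ (chartAt ℂ p₀).target) {g : M → E} (hg : SmoothAt g ((chartAt ℂ p₀).symm z))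
    (U : ℂ) : diff (fun y => g ((chartAt ℂ p₀).symm y)) z U =
      diff g ((chartAt ℂ p₀).symm z) (transition p₀ z * U) := by
  set p := (chartAt ℂ p₀).symm z with hp
  have h4 : HasFDerivAt (chartAt ℂ p ∘ (chartAt ℂ p₀).symm)
      ((ContinuousLinearMap.toSpanSingleton ℂ (transition p₀ z)).restrictScalars ℝ) z :=
    (hasDerivAt_transition hz).hasFDerivAt.restrictScalars ℝ
  have h5 : HasFDerivAt ((g ∘ (chartAt ℂ p).symm) ∘ (chartAt ℂ p ∘ (chartAt ℂ p₀).symm))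
      (diff g p ∘L ((ContinuousLinearMap.toSpanSingleton ℂ (transition p₀ z)).restrictScalars ℝ))
      z := HasFDerivAt.comp z hg.hasFDerivAt h4
  have h6 : (fun y => g ((chartAt ℂ p₀).symm y)) =ᶠ[nhds z]
      (g ∘ (chartAt ℂ p).symm) ∘ (chartAt ℂ p ∘ (chartAt ℂ p₀).symm) := by
    have h7 : ContinuousAt (chartAt ℂ p₀).symm z := (chartAt ℂ p₀).symm.continuousAt hz
    filter_upwards [h7.preimage_mem_nhds
      ((chartAt ℂ p).open_source.mem_nhds (mem_chart_source ℂ p))] with y hy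
    simp only [Function.comp_apply]
    rw [(chartAt ℂ p).left_inv hy]
  rw [diff_plane, (h5.congr_of_eventuallyEq h6).fderiv]
  simp [mul_comm]

end Charts

/-! ### Second derivatives in the plane. -/

section Plane
variable {E : Type*} [NormedAddCommGroup E] [NormedSpace ℝ E]

theorem SmoothAt.diff_right {g : ℂ → E} {z : ℂ} (h : SmoothAt g z) (U : ℂ) :
    SmoothAt (fun y => diff g y U) z := by
  rw [smoothAt_plane] at h ⊢
  simp only [diff_plane]
  exact ContDiffAt.clm_apply (h.fderiv_right (m := ∞) (by simp)) contDiffAt_const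

theorem diff_diff_comm {g : ℂ → E} {z : ℂ} (h : SmoothAt g z) (U W : ℂ) :
    diff (fun y => diff g y U) z W = diff (fun y => diff g y W) z U := by
  rw [smoothAt_plane] at h
  have hd : DifferentiableAt ℝ (fderiv ℝ g) z :=
    (h.fderiv_right (m := ∞) (by simp)).differentiableAt (by simp)
  have h1 : ∀ U W : ℂ, diff (fun y => diff g y U) z W = fderiv ℝ (fderiv ℝ g) z W U := by
    intro U W
    simp only [diff_plane]
    have := (hd.hasFDerivAt.clm_apply (hasFDerivAt_const U z)).fderiv
    rw [this]
    simp
  rw [h1, h1]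
  exact h.isSymmSndFDerivAt (by simpa using ENat.LEInfty.out) W U

end Plane

/-- The conditions on X and Y are symmetric except for conformality of B, which follows from κ B U =
m A(conj(cU)) and yields the new factor m²|c|²/κ. -/
theorem LiftAt.symm {c : ℂ} {m κ : ℝ} {X Y : V} {A B : ℂ →L[ℝ] V} (h : LiftAt c m κ X Y A B)
    (hc : c ≠ 0) (hm : m ≠ 0) :
    LiftAt c m (m ^ 2 * Complex.normSq c / κ) Y X B A where
  null_left := h.null_right
  null_right := h.null_left
  pair := h.pair_symm
  left_left := h.right_right
  left_right := h.right_left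
  right_left := h.left_right
  right_right := h.left_left
  pos := by
    have := h.pos
    have := Complex.normSq_pos.2 hc
    positivity
  conformal U W := by
    have hκ := h.pos.ne'
    have h1 : mink (κ • B U) (κ • B W) = κ * κ * mink (B U) (B W) := by
      rw [mink_smul_left, mink_smul_right]; ring
    have h2 : mink (B U) (B W) = mink (κ • B U) (κ • B W) / (κ * κ) := by
      rw [h1]; field_simp
    rw [h2, h.right_eq, h.right_eq, mink_smul_left, mink_smul_right, h.conformal,
      Complex.normSq_apply]
    simp
    field_simp
    ring
  spectral U W := by
    rw [mink_comm, h.spectral]; ring_nf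

/-! ### Scaled lifts in the plane: closedness and Codazzi equations. -/

/-- The linear form `x ↦ ⟨x, y⟩`. -/
def minkForm (y : V) : V →L[ℝ] ℝ :=
  (-(y 3)) • ContinuousLinearMap.proj (R := ℝ) (φ := fun _ : Fin 4 => ℝ) 0 +
  (-(y 0)) • ContinuousLinearMap.proj (R := ℝ) (φ := fun _ : Fin 4 => ℝ) 3 +
  y 1 • ContinuousLinearMap.proj (R := ℝ) (φ := fun _ : Fin 4 => ℝ) 1 +
  y 2 • ContinuousLinearMap.proj (R := ℝ) (φ := fun _ : Fin 4 => ℝ) 2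

theorem minkForm_apply (x y : V) : minkForm y x = mink x y := by
  simp [minkForm, mink]; ring

theorem contDiff_minkForm : ContDiff ℝ ∞ minkForm := by
  unfold minkForm
  fun_prop

/-- A pair of null vector fields in the plane whose spectral form is symmetric can locally be
scaled such that `⟨dX, Y⟩ = 0`. -/
theorem exists_primitive {B : Set ℂ} (hB : IsOpen B) (hconv : Convex ℝ B) {n n₁ : ℂ → V}
    (hn : ∀ z ∈ B, SmoothAt n z) (hn₁ : ∀ z ∈ B, SmoothAt n₁ z)
    (h0 : ∀ z ∈ B, mink (n z) (n₁ z) ≠ 0)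
    (hsymm : ∀ z ∈ B, ∀ U W,
      mink (diff n₁ z U) (diff n z W) -
        mink (diff n₁ z U) (n z) * mink (diff n z W) (n₁ z) / mink (n z) (n₁ z) =
      mink (diff n₁ z W) (diff n z U) -
        mink (diff n₁ z W) (n z) * mink (diff n z U) (n₁ z) / mink (n z) (n₁ z)) :
    ∃ f : ℂ → ℝ, ∀ z ∈ B, SmoothAt f z ∧
      ∀ U, diff f z U = mink (diff n z U) (n₁ z) / mink (n z) (n₁ z) := by
  -- If df = θ, then e^{−f} n has a differential orthogonal to n₁.
  set θ : ℂ → ℂ →L[ℝ] ℝ :=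
    fun z => (mink (n z) (n₁ z))⁻¹ • (minkForm (n₁ z)).comp (fderiv ℝ n z) with hθ
  have hθa : ∀ z U, θ z U = mink (diff n z U) (n₁ z) * (mink (n z) (n₁ z))⁻¹ := by
    intro z U
    simp [hθ, minkForm_apply, diff_plane, mul_comm]
  have hθs : ∀ z ∈ B, ContDiffAt ℝ ∞ θ z := by
    intro z hz
    have h1 := smoothAt_plane.1 (((hn z hz).mink (hn₁ z hz)).inv (h0 z hz))
    have h2 : ContDiffAt ℝ ∞ (fun z => minkForm (n₁ z)) z :=
      contDiff_minkForm.contDiffAt.comp z (smoothAt_plane.1 (hn₁ z hz))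
    have h3 : ContDiffAt ℝ ∞ (fderiv ℝ n) z :=
      (smoothAt_plane.1 (hn z hz)).fderiv_right (m := ∞) (by simp)
    exact h1.smul (h2.clm_comp h3)
  have hθd : ∀ z ∈ B, ∀ U W, fderiv ℝ θ z U W =
      diff (fun y => mink (diff n y W) (n₁ y) * (mink (n y) (n₁ y))⁻¹) z U := by
    intro z hz U W
    have hd := ((hθs z hz).differentiableAt (by simp)).hasFDerivAt
    have := (hd.clm_apply (hasFDerivAt_const W z)).fderiv
    rw [diff_plane]
    simp only [hθa] at this
    rw [this]
    simp
  -- The second derivatives of n cancel on antisymmetrizing, as does the product of the two values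
  -- of ⟨dn, n₁⟩; what remains is the antisymmetric part of the spectral form divided by ⟨n, n₁⟩.
  have hclosed : ∀ z ∈ B, ∀ U W, fderiv ℝ θ z U W = fderiv ℝ θ z W U := by
    intro z hz U W
    have e : ∀ U W, fderiv ℝ θ z U W =
        (mink (diff (fun y => diff n y W) z U) (n₁ z) + mink (diff n z W) (diff n₁ z U)) *
          (mink (n z) (n₁ z))⁻¹ + mink (diff n z W) (n₁ z) *
          (-(mink (diff n z U) (n₁ z) + mink (n z) (diff n₁ z U)) / mink (n z) (n₁ z) ^ 2) := by
      intro U W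
      rw [hθd z hz, diff_mul (((hn z hz).diff_right W).mink (hn₁ z hz))
        (((hn z hz).mink (hn₁ z hz)).inv (h0 z hz)),
        diff_mink ((hn z hz).diff_right W) (hn₁ z hz),
        diff_inv ((hn z hz).mink (hn₁ z hz)) (h0 z hz), diff_mink (hn z hz) (hn₁ z hz)]
    have h1 := hsymm z hz U W
    have h2 := h0 z hz
    rw [e, e, diff_diff_comm (hn z hz) U W, mink_comm (n z) (diff n₁ z U),
      mink_comm (n z) (diff n₁ z W), mink_comm (diff n z W) (diff n₁ z U),
      mink_comm (diff n z U) (diff n₁ z W)]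
    field_simp at h1 ⊢
    linear_combination h1
  obtain ⟨f, hf⟩ := hconv.exists_forall_hasFDerivAt_of_fderiv_symmetric hB
    (fun z hz => ((hθs z hz).differentiableAt (by simp)).differentiableWithinAt) hclosed
  have hfs : ContDiffOn ℝ ∞ f B := by
    rw [contDiffOn_infty_iff_fderiv_of_isOpen hB]
    refine ⟨fun z hz => (hf z hz).differentiableAt.differentiableWithinAt, ?_⟩
    exact ContDiffOn.congr (fun z hz => (hθs z hz).contDiffWithinAt) fun z hz => (hf z hz).fderiv
  refine ⟨f, fun z hz => ⟨smoothAt_plane.2 (hfs.contDiffAt (hB.mem_nhds hz)), fun U => ?_⟩⟩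
  rw [diff_plane, (hf z hz).fderiv, hθa]
  rfl

/-- The Laplacian of the lift of an envelope is a multiple of the lift of the other envelope. -/
theorem laplacian_eq {B : Set ℂ} (hB : IsOpen B) {X Y : ℂ → V} {Q : ℂ → ℂ} {m κ : ℂ → ℝ}
    (hX : ∀ z ∈ B, SmoothAt X z) (hY : ∀ z ∈ B, SmoothAt Y z)
    (hL : ∀ z ∈ B, LiftAt (Q z) (m z) (κ z) (X z) (Y z) (diff X z) (diff Y z)) {z : ℂ}
    (hz : z ∈ B) :
    ∃ r : ℝ, diff (fun y => diff X y 1) z 1 +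
      diff (fun y => diff X y Complex.I) z Complex.I = r • Y z := by
  have s1 := (hX z hz).diff_right 1
  have sI := (hX z hz).diff_right Complex.I
  have sY := hY z hz
  have comm := diff_diff_comm (hX z hz) Complex.I 1
  have h := hL z hz
  have c1 : ∀ U, diff (fun y => mink (diff X y 1) (diff X y 1) -
      mink (diff X y Complex.I) (diff X y Complex.I)) z U = 0 := by
    refine diff_eq_zero_of_eventually_const (c := 0) ?_
    filter_upwards [hB.mem_nhds hz] with y hy
    simp [(hL y hy).conformal]
  have c2 : ∀ U, diff (fun y => mink (diff X y 1) (diff X y Complex.I)) z U = 0 := by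
    refine diff_eq_zero_of_eventually_const (c := 0) ?_
    filter_upwards [hB.mem_nhds hz] with y hy
    simp [(hL y hy).conformal]
  have c3 : ∀ W U, diff (fun y => mink (diff X y W) (Y y)) z U = 0 := by
    intro W
    refine diff_eq_zero_of_eventually_const (c := 0) ?_
    filter_upwards [hB.mem_nhds hz] with y hy
    exact (hL y hy).left_right W
  have e1 : ∀ U, 2 * mink (diff (fun y => diff X y 1) z U) (diff X z 1) =
      2 * mink (diff (fun y => diff X y Complex.I) z U) (diff X z Complex.I) := by
    intro U
    have := c1 U
    rw [diff_sub (s1.mink s1) (sI.mink sI), diff_mink s1 s1, diff_mink sI sI] at this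
    rw [mink_comm (diff X z 1), mink_comm (diff X z Complex.I)] at this
    linarith
  have e2 : ∀ U, mink (diff (fun y => diff X y 1) z U) (diff X z Complex.I) +
      mink (diff (fun y => diff X y Complex.I) z U) (diff X z 1) = 0 := by
    intro U
    have := c2 U
    rwa [diff_mink s1 sI, mink_comm (diff X z 1)] at this
  have e3 : ∀ W U, mink (diff (fun y => diff X y W) z U) (Y z) +
      mink (diff Y z U) (diff X z W) = 0 := by
    intro W U
    have := c3 W U
    rwa [diff_mink ((hX z hz).diff_right W) sY, mink_comm (diff X z W)] at this
  set L := diff (fun y => diff X y 1) z 1 + diff (fun y => diff X y Complex.I) z Complex.I with hLdef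
  -- In conformal coordinates the Laplacian is normal to the image of dX: this is the differentiated
  -- condition |X_x| = |X_y|, X_x ⊥ X_y.
  have l1 : mink L (diff X z 1) = 0 := by
    rw [hLdef, mink_add_left]
    have a1 := e1 1
    have a2 := e2 Complex.I
    rw [← comm] at a2
    linarith
  have lI : mink L (diff X z Complex.I) = 0 := by
    rw [hLdef, mink_add_left]
    have a1 := e1 Complex.I
    have a2 := e2 1
    rw [comm] at a2
    linarith
  -- By ⟨dX, Y⟩ = 0, ⟨ΔX, Y⟩ is minus the trace of ⟨dY, dX⟩, and the real part of a quadratic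
  -- differential is trace-free.
  have lY : mink L (Y z) = 0 := by
    rw [hLdef, mink_add_left]
    have a1 := e3 1 1
    have a2 := e3 Complex.I Complex.I
    rw [h.spectral] at a1 a2
    simp only [mul_assoc, Complex.I_mul_I] at a1 a2
    simp at a1 a2
    linarith
  refine ⟨-mink L (X z), ?_⟩
  rw [← sub_eq_zero]
  apply h.eq_zero
  · rw [mink_sub_left, mink_smul_left, h.pair_symm]; ring
  · rw [mink_sub_left, mink_smul_left, h.null_right, lY]; ring
  · intro U
    rw [clm_complex_apply (diff X z) U]
    simp only [mink_sub_left, mink_smul_left, mink_add_right, mink_smul_right, l1, lI,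
      mink_comm (Y z), h.left_right]
    ring

/-- The Codazzi equations of a Bianchi-Darboux pair: the spectral parameter is constant. -/
theorem spectral_const {B : Set ℂ} (hB : IsOpen B) (hpre : IsPreconnected B) {X Y : ℂ → V}
    {Q : ℂ → ℂ} {m κ : ℂ → ℝ} (hX : ∀ z ∈ B, SmoothAt X z) (hY : ∀ z ∈ B, SmoothAt Y z)
    (hL : ∀ z ∈ B, LiftAt (Q z) (m z) (κ z) (X z) (Y z) (diff X z) (diff Y z))
    (hQ : DifferentiableOn ℂ Q B) (hQ0 : ∀ z ∈ B, Q z ≠ 0) (hm : ∀ z ∈ B, m z ≠ 0) {z w : ℂ}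
    (hz : z ∈ B) (hw : w ∈ B) : m z = m w := by
  have hQs : ∀ z ∈ B, SmoothAt Q z := by
    intro z hz
    have h1 : ContDiffAt ℂ ω Q z := (hQ.analyticAt (hB.mem_nhds hz)).contDiffAt
    exact smoothAt_plane.2 ((h1.restrict_scalars ℝ).of_le le_top)
  have hre : ∀ z ∈ B, SmoothAt (fun y => (Q y).re) z := fun z hz => (hQs z hz).clm Complex.reCLM
  have him : ∀ z ∈ B, SmoothAt (fun y => (Q y).im) z := fun z hz => (hQs z hz).clm Complex.imCLM
  have hT : ∀ U W : ℂ, ∀ z ∈ B, SmoothAt (fun y => mink (diff Y y U) (diff X y W)) z :=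
    fun U W z hz => ((hY z hz).diff_right U).mink ((hX z hz).diff_right W)
  have hdT : ∀ U W : ℂ, ∀ z ∈ B, ∀ T, diff (fun y => mink (diff Y y U) (diff X y W)) z T =
      mink (diff (fun y => diff Y y U) z T) (diff X z W) +
        mink (diff Y z U) (diff (fun y => diff X y W) z T) := fun U W z hz T =>
    diff_mink ((hY z hz).diff_right U) ((hX z hz).diff_right W) T
  have hms : ∀ z ∈ B, SmoothAt m z := by
    intro z hz
    have h0 : (Q z).re * (Q z).re + (Q z).im * (Q z).im ≠ 0 := by
      rw [← Complex.normSq_apply]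
      exact (Complex.normSq_pos.2 (hQ0 z hz)).ne'
    -- The spectral form has entries m Re Q and −m Im Q; dividing by |Q|² recovers m as a smooth
    -- function.
    have h1 : SmoothAt (fun y => (mink (diff Y y 1) (diff X y 1) * (Q y).re -
        mink (diff Y y 1) (diff X y Complex.I) * (Q y).im) /
        ((Q y).re * (Q y).re + (Q y).im * (Q y).im)) z :=
      (((hT 1 1 z hz).mul (hre z hz)).sub ((hT 1 Complex.I z hz).mul (him z hz))).div
        (((hre z hz).mul (hre z hz)).add ((him z hz).mul (him z hz))) h0
    refine h1.congr ?_
    filter_upwards [hB.mem_nhds hz] with y hy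
    rw [(hL y hy).spectral, (hL y hy).spectral]
    have h0 : (Q y).re * (Q y).re + (Q y).im * (Q y).im ≠ 0 := by
      rw [← Complex.normSq_apply]
      exact (Complex.normSq_pos.2 (hQ0 y hy)).ne'
    rw [eq_div_iff h0]
    simp
    ring
  have hzero : ∀ z ∈ B, diff m z = 0 := by
    intro z hz
    have h := hL z hz
    have hs := h.symm (hQ0 z hz) (hm z hz)
    obtain ⟨r, hr⟩ := laplacian_eq hB hX hY hL hz
    obtain ⟨r', hr'⟩ := laplacian_eq hB hY hX
      (fun y hy => (hL y hy).symm (hQ0 y hy) (hm y hy)) hz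
    have p11 : ∀ T, diff m z T * (Q z).re + m z * diff (fun y => (Q y).re) z T =
        mink (diff (fun y => diff Y y 1) z T) (diff X z 1) +
        mink (diff Y z 1) (diff (fun y => diff X y 1) z T) := by
      intro T
      rw [← hdT 1 1 z hz, ← diff_mul (hms z hz) (hre z hz)]
      congr 1
      apply diff_congr
      filter_upwards [hB.mem_nhds hz] with y hy
      rw [(hL y hy).spectral]; simp
    have p1I : ∀ T, -(diff m z T * (Q z).im + m z * diff (fun y => (Q y).im) z T) =
        mink (diff (fun y => diff Y y 1) z T) (diff X z Complex.I) +
        mink (diff Y z 1) (diff (fun y => diff X y Complex.I) z T) := by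
      intro T
      rw [← hdT 1 Complex.I z hz, ← diff_mul (hms z hz) (him z hz),
        ← diff_neg ((hms z hz).mul (him z hz))]
      congr 1
      apply diff_congr
      filter_upwards [hB.mem_nhds hz] with y hy
      rw [(hL y hy).spectral]; simp
    have pI1 : ∀ T, -(diff m z T * (Q z).im + m z * diff (fun y => (Q y).im) z T) =
        mink (diff (fun y => diff Y y Complex.I) z T) (diff X z 1) +
        mink (diff Y z Complex.I) (diff (fun y => diff X y 1) z T) := by
      intro T
      rw [← hdT Complex.I 1 z hz, ← diff_mul (hms z hz) (him z hz),
        ← diff_neg ((hms z hz).mul (him z hz))]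
      congr 1
      apply diff_congr
      filter_upwards [hB.mem_nhds hz] with y hy
      rw [(hL y hy).spectral]; simp
    have pII : ∀ T, -(diff m z T * (Q z).re + m z * diff (fun y => (Q y).re) z T) =
        mink (diff (fun y => diff Y y Complex.I) z T) (diff X z Complex.I) +
        mink (diff Y z Complex.I) (diff (fun y => diff X y Complex.I) z T) := by
      intro T
      rw [← hdT Complex.I Complex.I z hz, ← diff_mul (hms z hz) (hre z hz),
        ← diff_neg ((hms z hz).mul (hre z hz))]
      congr 1
      apply diff_congr
      filter_upwards [hB.mem_nhds hz] with y hy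
      rw [(hL y hy).spectral]; simp [mul_assoc]
    have cX := diff_diff_comm (hX z hz) Complex.I 1
    have cY := diff_diff_comm (hY z hz) Complex.I 1
    -- ΔX is parallel to Y and ΔY is parallel to X, so ⟨dY, ΔX⟩ and ⟨ΔY, dX⟩ vanish; this makes the
    -- form ⟨dY, dX⟩ divergence-free.
    have l1 : mink (diff Y z 1) (diff (fun y => diff X y 1) z 1) +
        mink (diff Y z 1) (diff (fun y => diff X y Complex.I) z Complex.I) = 0 := by
      rw [← mink_add_right, hr, mink_smul_right, h.right_right, mul_zero]
    have l2 : mink (diff Y z Complex.I) (diff (fun y => diff X y 1) z 1) +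
        mink (diff Y z Complex.I) (diff (fun y => diff X y Complex.I) z Complex.I) = 0 := by
      rw [← mink_add_right, hr, mink_smul_right, h.right_right, mul_zero]
    have l3 : mink (diff (fun y => diff Y y 1) z 1) (diff X z 1) +
        mink (diff (fun y => diff Y y Complex.I) z Complex.I) (diff X z 1) = 0 := by
      rw [← mink_add_left, hr', mink_smul_left, mink_comm, h.left_left, mul_zero]
    have l4 : mink (diff (fun y => diff Y y 1) z 1) (diff X z Complex.I) +
        mink (diff (fun y => diff Y y Complex.I) z Complex.I) (diff X z Complex.I) = 0 := by
      rw [← mink_add_left, hr', mink_smul_left, mink_comm, h.left_left, mul_zero]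
    have hQz : HasDerivAt Q (deriv Q z) z :=
      ((hQ z hz).differentiableAt (hB.mem_nhds hz)).hasDerivAt
    have hQd : ∀ T, diff Q z T = deriv Q z * T := by
      intro T
      rw [diff_plane, (hQz.hasFDerivAt.restrictScalars ℝ).fderiv]
      simp [mul_comm]
    have dre : ∀ T, diff (fun y => (Q y).re) z T = (deriv Q z * T).re := by
      intro T
      rw [← hQd]
      exact diff_clm (hQs z hz) Complex.reCLM T
    have dim : ∀ T, diff (fun y => (Q y).im) z T = (deriv Q z * T).im := by
      intro T
      rw [← hQd]
      exact diff_clm (hQs z hz) Complex.imCLM T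
    have q11 := p11 1
    have q11' := p11 Complex.I
    have q1I := p1I 1
    have q1I' := p1I Complex.I
    have qI1 := pI1 1
    have qI1' := pI1 Complex.I
    have qII := pII 1
    have qII' := pII Complex.I
    rw [dre] at q11 q11' qII qII'
    rw [dim] at q1I q1I' qI1 qI1'
    rw [cX, cY] at qII
    rw [cX] at q1I
    rw [cY] at qI1
    simp only [mul_one, Complex.mul_re, Complex.mul_im, Complex.I_re, Complex.I_im, mul_zero,
      zero_sub, add_zero] at q11 q11' q1I q1I' qI1 qI1' qII qII'
    -- Trace-free and divergence-free means that mQ is holomorphic. As Q is holomorphic, its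
    -- derivatives cancel and (m_x + i m_y)Q = 0 is left, written as real and imaginary part.
    have r1 : diff m z 1 * (Q z).re - diff m z Complex.I * (Q z).im = 0 := by
      linear_combination (1 / 2) * (q11 + q1I' - qII + qI1' + l1 + l3)
    have r2 : diff m z Complex.I * (Q z).re + diff m z 1 * (Q z).im = 0 := by
      linear_combination (1 / 2) * (q11' - qI1 - qII' - q1I - l2 - l4)
    have h0 : (Q z).re * (Q z).re + (Q z).im * (Q z).im ≠ 0 := by
      rw [← Complex.normSq_apply]
      exact (Complex.normSq_pos.2 (hQ0 z hz)).ne'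
    have z1 : diff m z 1 = 0 := by
      refine (mul_eq_zero.1 (?_ : _ * ((Q z).re * (Q z).re + (Q z).im * (Q z).im) = 0)).resolve_right
        h0
      linear_combination (Q z).re * r1 + (Q z).im * r2
    have zI : diff m z Complex.I = 0 := by
      refine (mul_eq_zero.1 (?_ : _ * ((Q z).re * (Q z).re + (Q z).im * (Q z).im) = 0)).resolve_right
        h0
      linear_combination (Q z).re * r2 - (Q z).im * r1
    ext T
    rw [clm_complex_apply, z1, zI]
    simp
  refine hB.is_const_of_fderiv_eq_zero (𝕜 := ℝ) hpre (fun y hy => ?_) (fun y hy => ?_) hz hw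
  · exact ((smoothAt_plane.1 (hms y hy)).differentiableAt (by simp)).differentiableWithinAt
  · rw [← diff_plane]; exact hzero y hy

/-! ### Null vectors of unit normals -/

/-- The time function of Minkowski space. -/
def tau : V →L[ℝ] ℝ :=
  ContinuousLinearMap.proj (R := ℝ) (φ := fun _ : Fin 4 => ℝ) 0 +
    ContinuousLinearMap.proj (R := ℝ) (φ := fun _ : Fin 4 => ℝ) 3

theorem tau_apply (x : V) : tau x = x 0 + x 3 := rfl

/-- The linear part of `nullVec`. -/
def nullLin : E3 →L[ℝ] V :=
  LinearMap.toContinuousLinearMap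
    { toFun := fun n => ![n 0 / 2, n 1 / √2, n 2 / √2, -(n 0) / 2]
      map_add' := fun x y => by
        ext i; fin_cases i <;> simp <;> ring
      map_smul' := fun c x => by
        ext i; fin_cases i <;> simp <;> ring }

theorem nullLin_apply (n : E3) : nullLin n = ![n 0 / 2, n 1 / √2, n 2 / √2, -(n 0) / 2] := rfl

theorem nullVec_eq (n : E3) : nullVec n = ![1 / 2, 0, 0, 1 / 2] + nullLin n := by
  rw [nullLin_apply]
  ext i; fin_cases i <;> simp [nullVec] <;> ring

/-- `pointVec` as a linear map. -/
def pointLin : E3 →L[ℝ] V :=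
  LinearMap.toContinuousLinearMap
    { toFun := pointVec
      map_add' := fun x y => by
        ext i; fin_cases i <;> simp [pointVec] <;> ring
      map_smul' := fun c x => by
        ext i; fin_cases i <;> simp [pointVec] <;> ring }

theorem pointLin_apply (x : E3) : pointLin x = pointVec x := rfl

theorem tau_nullVec (n : E3) : tau (nullVec n) = 1 := by
  simp [tau_apply, nullVec]; ring

theorem tau_pointVec (x : E3) : tau (pointVec x) = 0 := by
  simp [tau_apply, pointVec]; ring

theorem inner_eq (x y : E3) : inner ℝ x y = x 0 * y 0 + x 1 * y 1 + x 2 * y 2 := by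
  simp [PiLp.inner_apply, Fin.sum_univ_three, mul_comm]

theorem mink_nullLin (x y : E3) : mink (nullLin x) (nullLin y) = inner ℝ x y / 2 := by
  rw [inner_eq, nullLin_apply, nullLin_apply]
  have h2' : √2 ^ 2 = (2 : ℝ) := Real.sq_sqrt (by norm_num)
  simp [mink]
  field_simp
  rw [h2']
  ring

theorem mink_pointVec_nullLin (x y : E3) : mink (pointVec x) (nullLin y) = inner ℝ x y / √2 := by
  rw [inner_eq, nullLin_apply]
  simp [mink, pointVec]
  field_simp
  ring

theorem mink_pointVec_nullVec (x y : E3) : mink (pointVec x) (nullVec y) = inner ℝ x y / √2 := by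
  rw [nullVec_eq, mink_add_right, mink_pointVec_nullLin]
  simp [mink, pointVec]
  ring

theorem mink_nullVec (x y : E3) : mink (nullVec x) (nullVec y) = (inner ℝ x y - 1) / 2 := by
  have h0 : mink (nullLin x) ![1 / 2, 0, 0, 1 / 2] = 0 := by
    simp [nullLin_apply, mink]; ring
  have h1 : mink ![1 / 2, 0, 0, 1 / 2] (nullLin y) = 0 := by
    simp [nullLin_apply, mink]; ring
  rw [nullVec_eq, nullVec_eq, mink_add_right, mink_add_left, mink_add_left, mink_nullLin, h0, h1]
  simp [mink]
  ring

theorem mink_nullVec_self {x : E3} (hx : ‖x‖ = 1) : mink (nullVec x) (nullVec x) = 0 := by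
  rw [mink_nullVec, real_inner_self_eq_norm_sq, hx]; norm_num

/-- Strict Cauchy–Schwarz for two distinct unit normals; the sign later makes all lifts positive
multiples of the null directions. -/
theorem mink_nullVec_neg {x y : E3} (hx : ‖x‖ = 1) (hy : ‖y‖ = 1) (hne : x ≠ y) :
    mink (nullVec x) (nullVec y) < 0 := by
  rw [mink_nullVec]
  have := (inner_lt_one_iff_real_of_norm_eq_one hx hy).2 hne
  linarith

theorem nullDir_null (F : ContactElement) : mink (nullVec F.normal) (nullVec F.normal) = 0 :=
  mink_nullVec_self F.norm_normal

theorem mink_nullDir_self {M : Type*} (F : M → ContactElement) (p : M) :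
    mink (nullDir F p) (nullDir F p) = 0 := nullDir_null _

theorem mink_nullDir_neg {M : Type*} {F G : M → ContactElement} {p : M} (h : (F p).normal ≠ (G p).normal) :
    mink (nullDir F p) (nullDir G p) < 0 :=
  mink_nullVec_neg (F p).norm_normal (G p).norm_normal h

/-! ### Null directions of L-isothermic immersions and their rescaling. -/

section Immersions

variable {M : Type*} [TopologicalSpace M] [ChartedSpace ℂ M]
variable {q : QuadraticDifferential M} {F G : M → ContactElement}

theorem smoothAt_nullDir (h : Smooth fun p => (F p).normal) (p : M) :
    SmoothAt (nullDir F) p := by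
  have h1 : SmoothAt (fun x => (![1 / 2, 0, 0, 1 / 2] : V) + nullLin (F x).normal) p :=
    (smoothAt_const _ p).add ((h.smoothAt p).clm nullLin)
  refine h1.congr (Filter.Eventually.of_forall fun x => nullVec_eq _)

theorem diff_nullDir (h : Smooth fun p => (F p).normal) (p : M) (U : ℂ) :
    diff (nullDir F) p U = nullLin (diff (fun x => (F x).normal) p U) := by
  have h0 : nullDir F = fun x => (![1 / 2, 0, 0, 1 / 2] : V) + nullLin (F x).normal :=
    funext fun x => nullVec_eq _
  rw [h0, diff_add (smoothAt_const _ p) ((h.smoothAt p).clm nullLin), diff_const,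
    diff_clm (h.smoothAt p), zero_add]

theorem mink_diff_self_of_null {X : M → V} {p : M} (hX : SmoothAt X p)
    (h0 : ∀ᶠ x in nhds p, mink (X x) (X x) = 0) (U : ℂ) : mink (diff X p U) (X p) = 0 := by
  have h1 := diff_eq_zero_of_eventually_const h0 U
  rw [diff_mink hX hX, mink_comm (X p)] at h1
  linarith

theorem mink_diff_nullDir_self (h : Smooth fun p => (F p).normal) (p : M) (U : ℂ) :
    mink (diff (nullDir F) p U) (nullDir F p) = 0 :=
  mink_diff_self_of_null (smoothAt_nullDir h p)
    (Filter.Eventually.of_forall (mink_nullDir_self F)) U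

theorem conformal_of_norm {E : Type*} [NormedAddCommGroup E] [InnerProductSpace ℝ E]
    {L : ℂ →L[ℝ] E} {c : ℝ} (h : ∀ X : ℂ, ‖L X‖ ^ 2 = c * ‖X‖ ^ 2) (U W : ℂ) :
    inner ℝ (L U) (L W) = c * (U.re * W.re + U.im * W.im) := by
  rw [real_inner_eq_norm_add_mul_self_sub_norm_mul_self_sub_norm_mul_self_div_two, ← map_add]
  simp only [← sq]
  rw [h, h, h, Complex.sq_norm, Complex.sq_norm, Complex.sq_norm, Complex.normSq_apply,
    Complex.normSq_apply, Complex.normSq_apply]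
  simp
  ring

theorem IsLIsothermic.exists_conformal (h : IsLIsothermic q F) (p : M) : ∃ κ : ℝ, 0 < κ ∧
    ∀ U W, mink (diff (nullDir F) p U) (diff (nullDir F) p W) =
      κ * (U.re * W.re + U.im * W.im) := by
  obtain ⟨c, hc, hcX⟩ := h.third_form p
  refine ⟨c / 2, by positivity, fun U W => ?_⟩
  rw [diff_nullDir h.smooth_normal, diff_nullDir h.smooth_normal, mink_nullLin,
    conformal_of_norm hcX]
  ring

theorem IsBianchiDarboux.distinct (h : IsBianchiDarboux q F G) (p : M) :
    (F p).normal ≠ (G p).normal := by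
  obtain ⟨S, hS⟩ := h.exists_congruence
  exact hS.distinct p

/-- The spectral form is a real multiple of the real part of the quadratic differential. -/
theorem IsBianchiDarboux.exists_spectral (h : IsBianchiDarboux q F G) (p : M) :
    q.coeff p ≠ 0 ∧ ∃ m : ℝ, m ≠ 0 ∧ ∀ U W, spectralForm F G p U W = m * (q.coeff p * U * W).re := by
  obtain ⟨S, hS⟩ := h.exists_congruence
  obtain ⟨κ, hκ, hκU⟩ := h.isothermic_left.exists_conformal p
  obtain ⟨κ₁, hκ₁, hκ₁U⟩ := h.isothermic_right.exists_conformal p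
  exact Laguerre.exists_spectral hκ hκ₁ (mink_nullDir_self F p) (mink_nullDir_self G p)
    (mink_nullDir_neg (h.distinct p)).ne (mink_diff_nullDir_self h.isothermic_left.smooth_normal p)
    (mink_diff_nullDir_self h.isothermic_right.smooth_normal p) hκU hκ₁U
    (fun U hU => det4_eq_zero_of_dependent (hS.ribaucour p U hU)) (hS.nondegenerate p)

theorem IsLIsothermic.smoothAt_nullDir (h : IsLIsothermic q F) (p : M) : SmoothAt (nullDir F) p :=
  Laguerre.smoothAt_nullDir h.smooth_normal p

/-- Scaled lifts of the null directions of a pair with given spectral form. -/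
theorem liftAt_of_scaling (hF : IsLIsothermic q F) (hG : Smooth fun p => (G p).normal) {p : M}
    {m : ℝ} (hs : ∀ U W, spectralForm F G p U W = m * (q.coeff p * U * W).re)
    {r k : M → ℝ} (hr : SmoothAt r p) (hk : SmoothAt k p) {X Y : M → V}
    (hX : X =ᶠ[nhds p] fun x => r x • nullDir F x) (hY : Y =ᶠ[nhds p] fun x => k x • nullDir G x)
    (hXY : ∀ᶠ x in nhds p, mink (X x) (Y x) = -1) (hd : ∀ U, mink (diff X p U) (Y p) = 0) :
    ∃ κ, LiftAt (q.coeff p) m κ (X p) (Y p) (diff X p) (diff Y p) := by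
  have sF := hF.smoothAt_nullDir p
  have sG := smoothAt_nullDir hG p
  have sX : SmoothAt X p := (hr.smul sF).congr hX
  have sY : SmoothAt Y p := (hk.smul sG).congr hY
  obtain ⟨κ, hκ, hκU⟩ := hF.exists_conformal p
  have nX : ∀ᶠ x in nhds p, mink (X x) (X x) = 0 := by
    filter_upwards [hX] with x hx
    rw [hx, mink_smul_left, mink_smul_right, mink_nullDir_self]; ring
  have nY : ∀ᶠ x in nhds p, mink (Y x) (Y x) = 0 := by
    filter_upwards [hY] with x hx
    rw [hx, mink_smul_left, mink_smul_right, mink_nullDir_self]; ring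
  have hXp := hX.self_of_nhds
  have hYp := hY.self_of_nhds
  have hXYp := hXY.self_of_nhds
  have dX : ∀ U, diff X p U = diff r p U • nullDir F p + r p • diff (nullDir F) p U := by
    intro U
    rw [diff_congr hX, diff_smul hr sF]
  have dY : ∀ U, diff Y p U = diff k p U • nullDir G p + k p • diff (nullDir G) p U := by
    intro U
    rw [diff_congr hY, diff_smul hk sG]
  have hFN := mink_diff_nullDir_self hF.smooth_normal p
  have hGN := mink_diff_nullDir_self hG p
  have hrk : r p * k p * mink (nullDir F p) (nullDir G p) = -1 := by
    rw [← hXYp, hXp, hYp, mink_smul_left, mink_smul_right]; ring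
  have hr0 : r p ≠ 0 := by rintro h0; rw [h0] at hrk; simp at hrk
  have hk0 : k p ≠ 0 := by rintro h0; rw [h0] at hrk; simp at hrk
  have hdr : ∀ U, diff r p U * mink (nullDir F p) (nullDir G p) +
      r p * mink (diff (nullDir F) p U) (nullDir G p) = 0 := by
    intro U
    have := hd U
    rw [dX, hYp, mink_smul_right, mink_add_left, mink_smul_left, mink_smul_left] at this
    exact (mul_eq_zero.1 this).resolve_left hk0
  refine ⟨r p ^ 2 * κ, ?_⟩
  constructor
  · exact nX.self_of_nhds
  · exact nY.self_of_nhds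
  · exact hXYp
  · exact mink_diff_self_of_null sX nX
  · exact hd
  · intro U
    have h1 := diff_eq_zero_of_eventually_const hXY U
    rw [diff_mink sX sY, hd, zero_add] at h1
    rw [mink_comm, h1]
  · exact mink_diff_self_of_null sY nY
  · positivity
  · intro U W
    simp only [dX, mink_add_left, mink_add_right, mink_smul_left, mink_smul_right, hFN,
      mink_nullDir_self, mink_comm (nullDir F p), hκU]
    ring
  · intro U W
    have e := hs U W
    have hh : mink (nullDir F p) (nullDir G p) ≠ 0 := by
      rintro h0; rw [h0] at hrk; simp at hrk
    have hkr : k p = -1 / (r p * mink (nullDir F p) (nullDir G p)) := by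
      field_simp; linarith
    -- The condition ⟨dX, Y⟩ = 0 determines dr; substituting it produces exactly the correction term
    -- in `spectralForm`.
    have hrW : diff r p W = -(r p * mink (diff (nullDir F) p W) (nullDir G p)) /
        mink (nullDir F p) (nullDir G p) := by
      field_simp; linarith [hdr W]
    rw [← e, spectralForm]
    simp only [dX, dY, mink_add_left, mink_add_right, mink_smul_left, mink_smul_right]
    rw [mink_comm (nullDir G p) (nullDir F p), mink_comm (nullDir G p) (diff (nullDir F) p W), hrW,
      hkr]
    field_simp
    ring

/-- Passing to another chart multiplies tangent vectors by `e`; the coefficient of the quadratic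
differential changes by e², while the spectral parameter `m` is unaffected. -/
theorem LiftAt.comp_mul {c : ℂ} {m κ : ℝ} {X Y : V} {A B A' B' : ℂ →L[ℝ] V}
    (h : LiftAt c m κ X Y A B) {e : ℂ} (he : e ≠ 0) (hA : ∀ U, A' U = A (e * U))
    (hB : ∀ U, B' U = B (e * U)) : LiftAt (c * e ^ 2) m (κ * Complex.normSq e) X Y A' B' where
  null_left := h.null_left
  null_right := h.null_right
  pair := h.pair
  left_left U := by rw [hA]; exact h.left_left _
  left_right U := by rw [hA]; exact h.left_right _
  right_left U := by rw [hB]; exact h.right_left _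
  right_right U := by rw [hB]; exact h.right_right _
  pos := mul_pos h.pos (Complex.normSq_pos.2 he)
  conformal U W := by
    rw [hA, hA, h.conformal, Complex.normSq_apply]
    simp
    ring
  spectral U W := by
    rw [hB, hA, h.spectral]
    ring_nf

end Immersions

/-! ### Local scaled lifts and constancy of the spectral parameter. -/

section Lifts

variable {M : Type*} [TopologicalSpace M] [ChartedSpace ℂ M]
variable {q : QuadraticDifferential M} {F G : M → ContactElement}

theorem spectralForm_numerator {p : M} (h : mink (nullDir F p) (nullDir G p) ≠ 0) (U W : ℂ) :
    mink (diff (nullDir G) p U) (diff (nullDir F) p W) -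
      mink (diff (nullDir G) p U) (nullDir F p) * mink (diff (nullDir F) p W) (nullDir G p) /
        mink (nullDir F p) (nullDir G p) =
      -mink (nullDir F p) (nullDir G p) * spectralForm F G p U W := by
  unfold spectralForm
  field_simp

/-- Around every point of a chart there is a ball that lies in a given neighbourhood. -/
theorem exists_chart_ball {U : Set M} {p₀ : M} (hU : U ∈ nhds p₀) :
    ∃ ε > 0, Metric.ball (chartAt ℂ p₀ p₀) ε ⊆ (chartAt ℂ p₀).target ∧
      ∀ z ∈ Metric.ball (chartAt ℂ p₀ p₀) ε, (chartAt ℂ p₀).symm z ∈ U := by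
  have h1 : ContinuousAt (chartAt ℂ p₀).symm (chartAt ℂ p₀ p₀) :=
    (chartAt ℂ p₀).symm.continuousAt (mem_chart_target ℂ p₀)
  have h2 : (chartAt ℂ p₀).symm ⁻¹' U ∈ nhds (chartAt ℂ p₀ p₀) := by
    apply h1.preimage_mem_nhds
    rwa [(chartAt ℂ p₀).left_inv (mem_chart_source ℂ p₀)]
  obtain ⟨ε, hε, hb⟩ := Metric.mem_nhds_iff.1 (Filter.inter_mem h2
    ((chartAt ℂ p₀).open_target.mem_nhds (mem_chart_target ℂ p₀)))
  exact ⟨ε, hε, fun z hz => (hb hz).2, fun z hz => (hb hz).1⟩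

/-- The coefficient of the quadratic differential in the chart at `p₀`. -/
def QuadraticDifferential.chartCoeff (q : QuadraticDifferential M) (p₀ : M) (z : ℂ) : ℂ :=
  q.coeff ((chartAt ℂ p₀).symm z) * transition p₀ z ^ 2

variable [IsManifold 𝓘(ℂ, ℂ) ω M]

/-- The spectral form is a multiple of Re q at each point, with no constancy of the factor known
yet. It is therefore symmetric, which is all that `exists_primitive` needs in a chart ball. -/
theorem exists_scaling (h : IsBianchiDarboux q F G) (p₀ : M) :
    ∃ (U : Set M) (ρ : M → ℝ), IsOpen U ∧ p₀ ∈ U ∧ ∀ p ∈ U, SmoothAt ρ p ∧ 0 < ρ p ∧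
      ∀ T, diff ρ p T * mink (nullDir F p) (nullDir G p) +
        ρ p * mink (diff (nullDir F) p T) (nullDir G p) = 0 := by
  obtain ⟨ε, hε, hb, -⟩ := exists_chart_ball (U := Set.univ) (p₀ := p₀) Filter.univ_mem
  set φ := chartAt ℂ p₀ with hφ
  set B := Metric.ball (φ p₀) ε with hB
  have sF : ∀ p, SmoothAt (nullDir F) p := h.isothermic_left.smoothAt_nullDir
  have sG : ∀ p, SmoothAt (nullDir G) p := h.isothermic_right.smoothAt_nullDir
  have h0 : ∀ p, mink (nullDir F p) (nullDir G p) ≠ 0 := fun p =>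
    (mink_nullDir_neg (h.distinct p)).ne
  obtain ⟨f, hf⟩ := exists_primitive (B := B) Metric.isOpen_ball (convex_ball _ _)
    (n := fun z => nullDir F (φ.symm z)) (n₁ := fun z => nullDir G (φ.symm z))
    (fun z hz => (sF _).comp_chart_symm (hb hz)) (fun z hz => (sG _).comp_chart_symm (hb hz))
    (fun z _ => h0 _) (by
      intro z hz U W
      obtain ⟨-, m, -, hm⟩ := h.exists_spectral (φ.symm z)
      rw [diff_comp_chart_symm (hb hz) (sF _), diff_comp_chart_symm (hb hz) (sG _),
        diff_comp_chart_symm (hb hz) (sF _), diff_comp_chart_symm (hb hz) (sG _),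
        spectralForm_numerator (h0 _), spectralForm_numerator (h0 _), hm, hm]
      ring_nf)
  -- The factor e^{−f} solves the scaling equation because df is the obstruction form, and it is
  -- positive.
  refine ⟨φ.source ∩ φ ⁻¹' B, fun p => Real.exp (-f (φ p)),
    φ.isOpen_inter_preimage Metric.isOpen_ball,
    ⟨mem_chart_source ℂ p₀, Metric.mem_ball_self hε⟩, ?_⟩
  rintro p ⟨hps, hpB⟩
  have hpp : φ.symm (φ p) = p := φ.left_inv hps
  obtain ⟨sf, df⟩ := hf (φ p) hpB
  have s1 : SmoothAt (fun x => -f (φ x)) p := (sf.comp_chart hps).neg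
  have s2 : SmoothAt (fun x => Real.exp (-f (φ x))) p :=
    s1.comp_contDiffAt Real.contDiff_exp.contDiffAt
  refine ⟨s2, Real.exp_pos _, fun T => ?_⟩
  rw [diff_comp s1 Real.contDiff_exp.contDiffAt (Real.hasDerivAt_exp _).hasFDerivAt,
    diff_neg (sf.comp_chart hps)]
  have he := transition_ne_zero (hb hpB)
  have h1 : diff (fun x => f (φ x)) p T =
      mink (diff (nullDir F) p T) (nullDir G p) / mink (nullDir F p) (nullDir G p) := by
    have sp : SmoothAt (fun x => f (φ x)) (φ.symm (φ p)) := by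
      rw [hpp]; exact sf.comp_chart hps
    have h2 := diff_comp_chart_symm (hb hpB) sp ((transition p₀ (φ p))⁻¹ * T)
    have h3 := df ((transition p₀ (φ p))⁻¹ * T)
    rw [diff_comp_chart_symm (hb hpB) (sF _)] at h3
    rw [mul_inv_cancel_left₀ he, ← hφ, hpp] at h2 h3
    rw [← h2, ← h3]
    congr 1
    apply diff_congr
    filter_upwards [φ.open_target.mem_nhds (hb hpB)] with y hy
    rw [φ.right_inv hy]
  rw [h1]
  have := h0 p
  simp
  field_simp
  ring

/-- Around every point, a Bianchi-Darboux pair has scaled lifts. -/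
theorem exists_lift (h : IsBianchiDarboux q F G) (p₀ : M) :
    ∃ (U : Set M) (ρ k : M → ℝ), IsOpen U ∧ p₀ ∈ U ∧ ∀ p ∈ U, SmoothAt ρ p ∧ SmoothAt k p ∧
      0 < ρ p ∧ 0 < k p ∧ ∀ m, (∀ T W, spectralForm F G p T W = m * (q.coeff p * T * W).re) →
      ∃ κ, LiftAt (q.coeff p) m κ (ρ p • nullDir F p) (k p • nullDir G p)
        (diff (fun x => ρ x • nullDir F x) p) (diff (fun x => k x • nullDir G x) p) := by
  obtain ⟨U, ρ, hU, hp₀, hρ⟩ := exists_scaling h p₀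
  have sF : ∀ p, SmoothAt (nullDir F) p := h.isothermic_left.smoothAt_nullDir
  have sG : ∀ p, SmoothAt (nullDir G) p := h.isothermic_right.smoothAt_nullDir
  have h0 : ∀ p, mink (nullDir F p) (nullDir G p) < 0 := fun p => mink_nullDir_neg (h.distinct p)
  -- The second factor is forced by ⟨X, Y⟩ = −1; it is positive since null directions with distinct
  -- normals have negative product.
  refine ⟨U, ρ, fun p => (-(ρ p * mink (nullDir F p) (nullDir G p)))⁻¹, hU, hp₀, fun p hp => ?_⟩
  obtain ⟨sρ, hpos, hd⟩ := hρ p hp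
  have hk0 : ∀ x ∈ U, 0 < -(ρ x * mink (nullDir F x) (nullDir G x)) := fun x hx =>
    neg_pos.2 (mul_neg_of_pos_of_neg (hρ x hx).2.1 (h0 x))
  have sk : SmoothAt (fun x => (-(ρ x * mink (nullDir F x) (nullDir G x)))⁻¹) p :=
    (sρ.mul ((sF p).mink (sG p))).neg.inv (hk0 p hp).ne'
  refine ⟨sρ, sk, hpos, inv_pos.2 (hk0 p hp), fun m hm => ?_⟩
  refine liftAt_of_scaling h.isothermic_left h.isothermic_right.smooth_normal hm sρ sk
    Filter.EventuallyEq.rfl Filter.EventuallyEq.rfl ?_ ?_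
  · filter_upwards [hU.mem_nhds hp] with x hx
    rw [mink_smul_left, mink_smul_right]
    have := (hk0 x hx).ne'
    have h2 : ρ x * mink (nullDir F x) (nullDir G x) ≠ 0 := neg_ne_zero.1 this
    have h3 : ρ x ≠ 0 := left_ne_zero_of_mul h2
    have h4 := (h0 x).ne
    field_simp
  · intro T
    rw [diff_smul sρ (sF p), mink_smul_right, mink_add_left, mink_smul_left, mink_smul_left, hd,
      mul_zero]

/-- Pointwise parameters exist; the Codazzi equations in a chart ball make them locally constant,
and connectedness makes them globally constant. -/
theorem exists_spectral_parameter [ConnectedSpace M] (h : IsBianchiDarboux q F G) :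
    ∃ m : ℝ, m ≠ 0 ∧ ∀ p U W, spectralForm F G p U W = m * (q.coeff p * U * W).re := by
  choose hq m hm0 hm using fun p => h.exists_spectral p
  have hloc : IsLocallyConstant m := by
    rw [IsLocallyConstant.iff_eventually_eq]
    intro p₀
    obtain ⟨U, ρ, k, hU, hp₀, hρ⟩ := exists_lift h p₀
    obtain ⟨ε, hε, hb, hbU⟩ := exists_chart_ball (hU.mem_nhds hp₀)
    set φ := chartAt ℂ p₀ with hφ
    set B := Metric.ball (φ p₀) ε with hB
    have sF : ∀ p, SmoothAt (nullDir F) p := h.isothermic_left.smoothAt_nullDir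
    have sG : ∀ p, SmoothAt (nullDir G) p := h.isothermic_right.smoothAt_nullDir
    have hlift : ∀ z, ∃ κ, z ∈ B → LiftAt (q.chartCoeff p₀ z) (m (φ.symm z)) κ
        (ρ (φ.symm z) • nullDir F (φ.symm z)) (k (φ.symm z) • nullDir G (φ.symm z))
        (diff (fun z => ρ (φ.symm z) • nullDir F (φ.symm z)) z)
        (diff (fun z => k (φ.symm z) • nullDir G (φ.symm z)) z) := by
      intro z
      by_cases hz : z ∈ B
      · obtain ⟨sρ, sk, -, -, hl⟩ := hρ _ (hbU z hz)
        obtain ⟨κ, hκ⟩ := hl _ (hm _)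
        exact ⟨_, fun _ => hκ.comp_mul (transition_ne_zero (hb hz))
          (fun T => diff_comp_chart_symm (hb hz) (sρ.smul (sF _)) T)
          (fun T => diff_comp_chart_symm (hb hz) (sk.smul (sG _)) T)⟩
      -- A junk value outside the ball lets the conformal factor be chosen as a function on the
      -- whole plane.
      · exact ⟨0, fun hz' => absurd hz' hz⟩
    choose κ hκ using hlift
    have hcont : ContinuousAt φ p₀ := φ.continuousAt (mem_chart_source ℂ p₀)
    filter_upwards [φ.open_source.mem_nhds (mem_chart_source ℂ p₀),
      hcont.preimage_mem_nhds (Metric.ball_mem_nhds _ hε)] with p hps hpB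
    have := spectral_const (B := B) Metric.isOpen_ball (convex_ball _ _).isPreconnected
      (m := fun z => m (φ.symm z))
      (fun z hz => ((hρ _ (hbU z hz)).1.smul (sF _)).comp_chart_symm (hb hz))
      (fun z hz => ((hρ _ (hbU z hz)).2.1.smul (sG _)).comp_chart_symm (hb hz)) hκ
      ((q.holomorphic p₀).mono hb)
      (fun z hz => mul_ne_zero (hq _) (pow_ne_zero 2 (transition_ne_zero (hb hz))))
      (fun z _ => hm0 _) hpB (Metric.mem_ball_self hε)
    simp only [φ.left_inv hps, φ.left_inv (mem_chart_source ℂ p₀)] at this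
    exact this
  obtain ⟨p₀⟩ : Nonempty M := inferInstance
  refine ⟨m p₀, hm0 p₀, fun p U W => ?_⟩
  rw [hm, hloc.apply_eq_of_preconnectedSpace p p₀]

end Lifts

/-! ### Contact elements as null lines, parametrized by the time function. -/

theorem ContactElement.mem_nullLine_iff {c : ContactElement} {x : V} :
    x ∈ c.nullLine ↔ x = pointVec c.pt + tau x • nullVec c.normal := by
  constructor
  · rintro ⟨t, ht⟩
    have h1 : tau x = t := by
      rw [ht, map_add, map_smul, tau_pointVec, tau_nullVec]; simp
    rw [h1, ht]
  · intro h; exact ⟨_, h⟩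

/-- Two points of the null line of a contact element differ by a multiple of the direction. -/
theorem ContactElement.sub_eq {c : ContactElement} {x y : V} (hx : x ∈ c.nullLine)
    (hy : y ∈ c.nullLine) : y = x + (tau y - tau x) • nullVec c.normal := by
  rw [mem_nullLine_iff] at hx hy
  rw [sub_smul]
  nth_rewrite 1 [hy]
  nth_rewrite 1 [hx]
  abel

theorem ContactElement.of_nullLine_eq {c : ContactElement} {a b : V}
    (h : c.nullLine = lineThrough a b) :
    tau b ≠ 0 ∧ b = tau b • nullVec c.normal ∧ pointVec c.pt = a - tau a • nullVec c.normal := by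
  have ha : a ∈ c.nullLine := by rw [h]; exact ⟨0, by simp⟩
  have hab : a + b ∈ c.nullLine := by rw [h]; exact ⟨1, by simp⟩
  have hb : b = tau b • nullVec c.normal := by
    have := sub_eq ha hab
    rw [map_add, add_sub_cancel_left] at this
    exact add_left_cancel this
  refine ⟨?_, hb, ?_⟩
  · intro h0
    rw [h0, zero_smul] at hb
    have hP : pointVec c.pt + nullVec c.normal ∈ lineThrough a b := by
      rw [← h]; exact ⟨1, by simp⟩
    have hP' : pointVec c.pt ∈ lineThrough a b := by
      rw [← h]; exact ⟨0, by simp⟩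
    obtain ⟨t, ht⟩ := hP
    obtain ⟨t', ht'⟩ := hP'
    have h1 := congrArg tau ht
    have h2 := congrArg tau ht'
    rw [hb] at h1 h2
    simp only [map_add, tau_pointVec, tau_nullVec, smul_zero, map_zero] at h1 h2
    linarith
  · rw [mem_nullLine_iff] at ha
    nth_rewrite 1 [ha]
    abel

theorem lineThrough_congr {a a' b b' : V} {c t : ℝ} (hc : c ≠ 0) (hb : b' = c • b)
    (ha : a' = a + t • b) : lineThrough a' b' = lineThrough a b := by
  subst hb ha
  ext y
  constructor
  · rintro ⟨z, rfl⟩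
    exact ⟨t + z * c, by module⟩
  · rintro ⟨z, rfl⟩
    refine ⟨(z - t) / c, ?_⟩
    have : ((z - t) / c) • c • b = (z - t) • b := by
      rw [smul_smul]; congr 1; field_simp
    rw [this]; module

/-! ### Two transforms of one immersion in common lifts. -/

section Configurations

variable {M : Type*} [TopologicalSpace M] [ChartedSpace ℂ M]
variable {q : QuadraticDifferential M} {F G F₁ F₂ : M → ContactElement}

/-- Writing S = σ(f) + tν(n), the contact condition df · n = 0 gives ⟨dσ(f), ν⟩ = 0, and the other
terms vanish because ν is null. -/
theorem mink_diff_of_contact (h : IsLIsothermic q F) {S : M → V} {p : M} (hS : SmoothAt S p)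
    (hmem : ∀ᶠ x in nhds p, S x ∈ (F x).nullLine) (T : ℂ) :
    mink (diff S p T) (nullDir F p) = 0 := by
  have sN := h.smoothAt_nullDir p
  have sP : SmoothAt (fun x => pointLin (F x).pt) p := (h.smooth_pt.smoothAt p).clm _
  have st : SmoothAt (fun x => tau (S x)) p := hS.clm tau
  have e : S =ᶠ[nhds p] fun x => pointLin (F x).pt + tau (S x) • nullDir F x := by
    filter_upwards [hmem] with x hx
    exact ContactElement.mem_nullLine_iff.1 hx
  rw [diff_congr e, diff_add sP (st.smul sN), diff_smul st sN, diff_clm (h.smooth_pt.smoothAt p)]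
  simp only [mink_add_left, mink_smul_left, mink_nullDir_self,
    mink_diff_nullDir_self h.smooth_normal]
  have := mink_pointVec_nullVec (diff (fun x => (F x).pt) p T) (F p).normal
  rw [h.contact] at this
  rw [nullDir, pointLin_apply, this]
  simp

/-- Local lifts `X`, `Y`, `Z` of the null directions of an `L`-isothermic immersion `F` and two
Bianchi-Darboux transforms `F₁`, `F₂` of it, with sphere congruences `S` and `S + s X`. -/
structure Configuration (q : QuadraticDifferential M) (F F₁ F₂ : M → ContactElement)
    (S : M → V) (m₁ m₂ : ℝ) (U : Set M) (X Y Z : M → V) (s : M → ℝ) : Prop where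
  isOpen : IsOpen U
  smooth_X : ∀ p ∈ U, SmoothAt X p
  smooth_Y : ∀ p ∈ U, SmoothAt Y p
  smooth_Z : ∀ p ∈ U, SmoothAt Z p
  smooth_s : ∀ p ∈ U, SmoothAt s p
  smooth_S : ∀ p ∈ U, SmoothAt S p
  direction_X : ∀ p ∈ U, ∃ a : ℝ, 0 < a ∧ X p = a • nullDir F p
  direction_Y : ∀ p ∈ U, ∃ a : ℝ, 0 < a ∧ Y p = a • nullDir F₁ p
  direction_Z : ∀ p ∈ U, ∃ a : ℝ, 0 < a ∧ Z p = a • nullDir F₂ p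
  lift : ∀ p ∈ U, ∃ κ, LiftAt (q.coeff p) m₁ κ (X p) (Y p) (diff X p) (diff Y p)
  neg_XZ : ∀ p ∈ U, mink (X p) (Z p) < 0
  neg_YZ : ∀ p ∈ U, mink (Y p) (Z p) < 0
  null_Z : ∀ p ∈ U, mink (Z p) (Z p) = 0
  diff_Z : ∀ p ∈ U, ∀ T, diff Z p T =
    (m₂ / m₁) • ((-mink (X p) (Z p)) • diff Y p T + mink (diff Y p T) (Z p) • X p)
  mem_F : ∀ p ∈ U, S p ∈ (F p).nullLine
  mem_F₁ : ∀ p ∈ U, S p ∈ (F₁ p).nullLine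
  mem_F₂ : ∀ p ∈ U, S p + s p • X p ∈ (F₂ p).nullLine
  diff_S_X : ∀ p ∈ U, ∀ T, mink (diff S p T) (X p) = 0
  diff_S_Y : ∀ p ∈ U, ∀ T, mink (diff S p T) (Y p) = 0
  diff_r : ∀ p ∈ U, ∀ T, diff (fun x => s x * -mink (X x) (Z x)) p T = mink (diff S p T) (Z p)

/-- X and Y are the lifts belonging to (F, F₁), and Z is the second lift belonging to (F, F₂). The
first lift of the latter pair differs from X by a scale. Both spheres lie on the null line of F, so
they differ by a multiple of X. -/
theorem exists_configuration [IsManifold 𝓘(ℂ, ℂ) ω M] (h₁ : IsBianchiDarboux q F F₁)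
    (h₂ : IsBianchiDarboux q F F₂) (hne : ∀ p, (F₁ p).normal ≠ (F₂ p).normal) {m₁ m₂ : ℝ}
    (hm₁ : m₁ ≠ 0) (hs₁ : ∀ p U W, spectralForm F F₁ p U W = m₁ * (q.coeff p * U * W).re)
    (hs₂ : ∀ p U W, spectralForm F F₂ p U W = m₂ * (q.coeff p * U * W).re) {S₁ S₂ : M → V}
    (hS₁ : IsDarbouxCongruence q F F₁ S₁) (hS₂ : IsDarbouxCongruence q F F₂ S₂) (p₀ : M) :
    ∃ U X Y Z s, p₀ ∈ U ∧ Configuration q F F₁ F₂ S₁ m₁ m₂ U X Y Z s ∧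
      ∀ p ∈ U, S₂ p = S₁ p + s p • X p := by
  obtain ⟨U₁, ρ, k, hU₁, hp₁, hl₁⟩ := exists_lift h₁ p₀
  obtain ⟨U₂, ρ', k', hU₂, hp₂, hl₂⟩ := exists_lift h₂ p₀
  have sF := h₁.isothermic_left.smoothAt_nullDir
  have sF₁ := h₁.isothermic_right.smoothAt_nullDir
  have sF₂ := h₂.isothermic_right.smoothAt_nullDir
  have hU : IsOpen (U₁ ∩ U₂) := hU₁.inter hU₂
  have sX : ∀ p ∈ U₁ ∩ U₂, SmoothAt (fun x => ρ x • nullDir F x) p := fun p hp =>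
    (hl₁ p hp.1).1.smul (sF p)
  have sY : ∀ p ∈ U₁ ∩ U₂, SmoothAt (fun x => k x • nullDir F₁ x) p := fun p hp =>
    (hl₁ p hp.1).2.1.smul (sF₁ p)
  have sZ : ∀ p ∈ U₁ ∩ U₂, SmoothAt (fun x => k' x • nullDir F₂ x) p := fun p hp =>
    (hl₂ p hp.2).2.1.smul (sF₂ p)
  have ss : ∀ p ∈ U₁ ∩ U₂, SmoothAt (fun x => (tau (S₂ x) - tau (S₁ x)) / ρ x) p := fun p hp =>
    (((hS₂.smooth.smoothAt p).clm tau).sub ((hS₁.smooth.smoothAt p).clm tau)).div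
      (hl₁ p hp.1).1 (hl₁ p hp.1).2.2.1.ne'
  have hS : ∀ p ∈ U₁ ∩ U₂,
      S₂ p = S₁ p + ((tau (S₂ p) - tau (S₁ p)) / ρ p) • ρ p • nullDir F p := by
    intro p hp
    have := ContactElement.sub_eq (hS₁.envelope_left p) (hS₂.envelope_left p)
    rw [smul_smul, div_mul_cancel₀ _ (hl₁ p hp.1).2.2.1.ne']
    exact this
  have neg1 : ∀ p ∈ U₁ ∩ U₂, mink (ρ p • nullDir F p) (k' p • nullDir F₂ p) < 0 := by
    intro p hp
    rw [mink_smul_left, mink_smul_right]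
    exact mul_neg_of_pos_of_neg (hl₁ p hp.1).2.2.1
      (mul_neg_of_pos_of_neg (hl₂ p hp.2).2.2.2.1 (mink_nullDir_neg (h₂.distinct p)))
  -- Replacing the F-lift of the second pair by X multiplies its spectral form by the ratio of
  -- scales, which is −⟨X, Z⟩; the derivative of the scale drops out because dZ is orthogonal to X.
  have second : ∀ p ∈ U₁ ∩ U₂, (∀ T, mink (diff (fun x => k' x • nullDir F₂ x) p T)
      (ρ p • nullDir F p) = 0) ∧
      (∀ T, mink (diff (fun x => k' x • nullDir F₂ x) p T) (k' p • nullDir F₂ p) = 0) ∧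
      ∀ T W, mink (diff (fun x => k' x • nullDir F₂ x) p T) (diff (fun x => ρ x • nullDir F x) p W)
        = -mink (ρ p • nullDir F p) (k' p • nullDir F₂ p) * (m₂ * (q.coeff p * T * W).re) := by
    intro p hp
    obtain ⟨sρ, sk, hρ, hk, -⟩ := hl₁ p hp.1
    obtain ⟨sρ', sk', hρ', hk', hl'⟩ := hl₂ p hp.2
    obtain ⟨κ', L'⟩ := hl' m₂ (hs₂ p)
    have c1 : ∀ T, mink (diff (fun x => k' x • nullDir F₂ x) p T) (nullDir F p) = 0 := by
      intro T
      have := L'.right_left T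
      rw [mink_smul_right] at this
      exact (mul_eq_zero.1 this).resolve_left hρ'.ne'
    refine ⟨fun T => by rw [mink_smul_right, c1, mul_zero], L'.right_right, fun T W => ?_⟩
    have e1 := L'.spectral T W
    have e2 := L'.pair
    rw [diff_smul sρ' (sF p), mink_add_right, mink_smul_right, mink_smul_right, c1] at e1
    rw [diff_smul sρ (sF p), mink_add_right, mink_smul_right, mink_smul_right, c1]
    rw [mink_smul_left] at e2 ⊢
    have e3 : mink (diff (fun x => k' x • nullDir F₂ x) p T) (diff (nullDir F) p W) =
        m₂ * (q.coeff p * T * W).re / ρ' p := by field_simp; linarith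
    have e4 : mink (nullDir F p) (k' p • nullDir F₂ p) = -1 / ρ' p := by field_simp; linarith
    rw [e3, e4]
    field_simp
    ring
  have dSX : ∀ p, ∀ T, mink (diff S₁ p T) (nullDir F p) = 0 := fun p =>
    mink_diff_of_contact h₁.isothermic_left (hS₁.smooth.smoothAt p)
      (Filter.Eventually.of_forall hS₁.envelope_left)
  refine ⟨U₁ ∩ U₂, fun x => ρ x • nullDir F x, fun x => k x • nullDir F₁ x,
    fun x => k' x • nullDir F₂ x, fun x => (tau (S₂ x) - tau (S₁ x)) / ρ x, ⟨hp₁, hp₂⟩,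
    { isOpen := hU
      smooth_X := sX
      smooth_Y := sY
      smooth_Z := sZ
      smooth_s := ss
      smooth_S := fun p _ => hS₁.smooth.smoothAt p
      direction_X := fun p hp => ⟨ρ p, (hl₁ p hp.1).2.2.1, rfl⟩
      direction_Y := fun p hp => ⟨k p, (hl₁ p hp.1).2.2.2.1, rfl⟩
      direction_Z := fun p hp => ⟨k' p, (hl₂ p hp.2).2.2.2.1, rfl⟩
      lift := fun p hp => (hl₁ p hp.1).2.2.2.2 m₁ (hs₁ p)
      neg_XZ := neg1
      neg_YZ := ?_
      null_Z := ?_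
      diff_Z := ?_
      mem_F := fun p _ => hS₁.envelope_left p
      mem_F₁ := fun p _ => hS₁.envelope_right p
      mem_F₂ := fun p hp => by
        rw [← hS p hp]; exact hS₂.envelope_right p
      diff_S_X := fun p _ T => by rw [mink_smul_right, dSX, mul_zero]
      diff_S_Y := fun p _ T => by
        rw [mink_smul_right, mink_diff_of_contact h₁.isothermic_right (hS₁.smooth.smoothAt p)
          (Filter.Eventually.of_forall hS₁.envelope_right), mul_zero]
      diff_r := ?_ }, hS⟩
  · intro p hp
    rw [mink_smul_left, mink_smul_right]
    exact mul_neg_of_pos_of_neg (hl₁ p hp.1).2.2.2.1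
      (mul_neg_of_pos_of_neg (hl₂ p hp.2).2.2.2.1 (mink_nullDir_neg (hne p)))
  · intro p _
    rw [mink_smul_left, mink_smul_right, mink_nullDir_self]; ring
  · intro p hp T
    obtain ⟨κ, L⟩ := (hl₁ p hp.1).2.2.2.2 m₁ (hs₁ p)
    obtain ⟨c1, c2, c3⟩ := second p hp
    exact L.second_eq hm₁ (neg1 p hp).ne c1 c2 c3 T
  · intro p hp T
    obtain ⟨c1, c2, c3⟩ := second p hp
    have sXZ := (sX p hp).mink (sZ p hp)
    have e1 := mink_diff_of_contact h₂.isothermic_right (hS₂.smooth.smoothAt p)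
      (Filter.Eventually.of_forall hS₂.envelope_right) T
    have e2 : mink (diff S₂ p T) (k' p • nullDir F₂ p) = 0 := by
      rw [mink_smul_right, e1, mul_zero]
    have ev : S₂ =ᶠ[nhds p]
        fun x => S₁ x + ((tau (S₂ x) - tau (S₁ x)) / ρ x) • ρ x • nullDir F x :=
      Filter.eventually_of_mem (hU.mem_nhds hp) hS
    rw [diff_congr ev, diff_add (hS₁.smooth.smoothAt p) ((ss p hp).smul (sX p hp)),
      diff_smul (ss p hp) (sX p hp)] at e2
    rw [diff_mul (ss p hp) sXZ.neg, diff_neg sXZ, diff_mink (sX p hp) (sZ p hp),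
      mink_comm _ (diff (fun x => k' x • nullDir F₂ x) p T), c1]
    simp only [mink_add_left, mink_smul_left _ (_ : V)] at e2 ⊢
    linear_combination -e2

end Configurations

/-- The linear map that recovers a unit normal from its null vector. -/
def nullInv : V →L[ℝ] E3 :=
  LinearMap.toContinuousLinearMap
    { toFun := fun x => WithLp.toLp 2 ![x 0 - x 3, √2 * x 1, √2 * x 2]
      map_add' := fun x y => by
        ext i; fin_cases i <;> simp <;> ring
      map_smul' := fun c x => by
        ext i; fin_cases i <;> simp <;> ring }

theorem nullInv_nullVec (n : E3) : nullInv (nullVec n) = n := by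
  have h2 : √2 ≠ 0 := by positivity
  ext i
  fin_cases i <;> simp [nullInv, nullVec] <;> field_simp
  ring

/-- The linear map that recovers a point from its point vector. -/
def pointInv : V →L[ℝ] E3 :=
  LinearMap.toContinuousLinearMap
    { toFun := fun x => WithLp.toLp 2 ![√2 * x 0, x 1, x 2]
      map_add' := fun x y => by
        ext i; fin_cases i <;> simp <;> ring
      map_smul' := fun c x => by
        ext i; fin_cases i <;> simp <;> ring }

theorem pointInv_pointVec (x : E3) : pointInv (pointVec x) = x := by
  have h2 : √2 ≠ 0 := by positivity
  ext i
  fin_cases i <;> simp [pointInv, pointVec]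
  field_simp

/-! ### The superposition in local lifts. -/

section Star

variable {M : Type*} [TopologicalSpace M] [ChartedSpace ℂ M]
variable {q : QuadraticDifferential M} {F F₁ F₂ Fs : M → ContactElement}

/-- The null vector field of the superposition. -/
def starDir (lam : ℝ) (X Y Z : M → V) (p : M) : V :=
  Z p + ((lam⁻¹ - 1) * -mink (Y p) (Z p)) • X p + ((lam - 1) * -mink (X p) (Z p)) • Y p

/-- The sphere congruence of the superposition. -/
def starPos (lam : ℝ) (S X Y Z : M → V) (s : M → ℝ) (p : M) : V :=
  S p + (lam * (s p * -mink (X p) (Z p)) / -mink (Y p) (Z p)) • Y p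

namespace Configuration

variable {S : M → V} {m₁ m₂ lam : ℝ} {U : Set M} {X Y Z : M → V} {s : M → ℝ} {p : M}

theorem smooth_w (C : Configuration q F F₁ F₂ S m₁ m₂ U X Y Z s) (hp : p ∈ U) :
    SmoothAt (fun x => -mink (X x) (Z x)) p := ((C.smooth_X p hp).mink (C.smooth_Z p hp)).neg

theorem smooth_u (C : Configuration q F F₁ F₂ S m₁ m₂ U X Y Z s) (hp : p ∈ U) :
    SmoothAt (fun x => -mink (Y x) (Z x)) p := ((C.smooth_Y p hp).mink (C.smooth_Z p hp)).neg

theorem smooth_starDir (C : Configuration q F F₁ F₂ S m₁ m₂ U X Y Z s) (hp : p ∈ U) :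
    SmoothAt (starDir lam X Y Z) p :=
  ((C.smooth_Z p hp).add (((smoothAt_const (lam⁻¹ - 1) p).mul (C.smooth_u hp)).smul
    (C.smooth_X p hp))).add
    (((smoothAt_const (lam - 1) p).mul (C.smooth_w hp)).smul (C.smooth_Y p hp))

theorem smooth_starCoeff (C : Configuration q F F₁ F₂ S m₁ m₂ U X Y Z s) (hp : p ∈ U) :
    SmoothAt (fun x => lam * (s x * -mink (X x) (Z x)) / -mink (Y x) (Z x)) p :=
  ((smoothAt_const lam p).mul ((C.smooth_s p hp).mul (C.smooth_w hp))).div (C.smooth_u hp)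
    (neg_ne_zero.2 (C.neg_YZ p hp).ne)

theorem smooth_starPos (C : Configuration q F F₁ F₂ S m₁ m₂ U X Y Z s) (hp : p ∈ U) :
    SmoothAt (starPos lam S X Y Z s) p :=
  (C.smooth_S p hp).add ((C.smooth_starCoeff hp).smul (C.smooth_Y p hp))

theorem mink_Y_diff_Z (C : Configuration q F F₁ F₂ S m₁ m₂ U X Y Z s) (hp : p ∈ U) (T : ℂ) :
    mink (Y p) (diff Z p T) = -(m₂ / m₁) * mink (diff Y p T) (Z p) := by
  obtain ⟨κ, L⟩ := C.lift p hp
  rw [C.diff_Z p hp, mink_smul_right, mink_add_right, mink_smul_right, mink_smul_right,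
    mink_comm (Y p) (diff Y p T), L.right_right, L.pair_symm]
  ring

theorem mink_X_diff_Z (C : Configuration q F F₁ F₂ S m₁ m₂ U X Y Z s) (hp : p ∈ U) (T : ℂ) :
    mink (X p) (diff Z p T) = 0 := by
  obtain ⟨κ, L⟩ := C.lift p hp
  rw [C.diff_Z p hp, mink_smul_right, mink_add_right, mink_smul_right, mink_smul_right,
    mink_comm (X p) (diff Y p T), L.right_left, L.null_left]
  ring

/-- Both factors vary: ⟨Y, dZ⟩ equals −(1−λ)⟨dY, Z⟩, so only the fraction λ of the full derivative
remains. -/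
theorem diff_u (C : Configuration q F F₁ F₂ S m₁ m₂ U X Y Z s) (hlam : 1 - lam = m₂ / m₁)
    (hp : p ∈ U) (T : ℂ) :
    diff (fun x => -mink (Y x) (Z x)) p T = -lam * mink (diff Y p T) (Z p) := by
  rw [diff_neg ((C.smooth_Y p hp).mink (C.smooth_Z p hp)),
    diff_mink (C.smooth_Y p hp) (C.smooth_Z p hp), C.mink_Y_diff_Z hp, ← hlam]
  ring

theorem diff_w (C : Configuration q F F₁ F₂ S m₁ m₂ U X Y Z s) (hp : p ∈ U) (T : ℂ) :
    diff (fun x => -mink (X x) (Z x)) p T = -mink (diff X p T) (Z p) := by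
  rw [diff_neg ((C.smooth_X p hp).mink (C.smooth_Z p hp)),
    diff_mink (C.smooth_X p hp) (C.smooth_Z p hp), C.mink_X_diff_Z hp]
  ring

/-- The X-term in dZ cancels against the derivative of u, and the dY-term against (λ−1)w dY. The two
coefficients in `starDir` are chosen for these cancellations. -/
theorem diff_starDir (C : Configuration q F F₁ F₂ S m₁ m₂ U X Y Z s) (hlam : 1 - lam = m₂ / m₁)
    (h0 : lam ≠ 0) (hp : p ∈ U) (T : ℂ) :
    diff (starDir lam X Y Z) p T = ((1 - lam) / lam) •
      ((-mink (Y p) (Z p)) • diff X p T + (lam * mink (diff X p T) (Z p)) • Y p) := by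
  have a1 : SmoothAt (fun x => (lam⁻¹ - 1) * -mink (Y x) (Z x)) p :=
    (smoothAt_const (lam⁻¹ - 1) p).mul (C.smooth_u hp)
  have a2 : SmoothAt (fun x => (lam - 1) * -mink (X x) (Z x)) p :=
    (smoothAt_const (lam - 1) p).mul (C.smooth_w hp)
  have e : diff (starDir lam X Y Z) p T = _ :=
    diff_add ((C.smooth_Z p hp).add (a1.smul (C.smooth_X p hp))) (a2.smul (C.smooth_Y p hp)) T
  rw [e, diff_add (C.smooth_Z p hp) (a1.smul (C.smooth_X p hp)),
    diff_smul a1 (C.smooth_X p hp), diff_smul a2 (C.smooth_Y p hp),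
    diff_mul (smoothAt_const _ p) (C.smooth_u hp), diff_mul (smoothAt_const _ p) (C.smooth_w hp),
    diff_const, diff_const, C.diff_u hlam hp, C.diff_w hp, C.diff_Z p hp, ← hlam]
  match_scalars <;> field_simp <;> ring

theorem mink_starDir_Y (C : Configuration q F F₁ F₂ S m₁ m₂ U X Y Z s) (hp : p ∈ U) :
    mink (starDir lam X Y Z p) (Y p) = lam⁻¹ * mink (Y p) (Z p) := by
  obtain ⟨κ, L⟩ := C.lift p hp
  simp only [starDir, mink_add_left, mink_smul_left, L.null_right, L.pair,
    mink_comm (Z p) (Y p)]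
  ring

theorem diff_starPos (C : Configuration q F F₁ F₂ S m₁ m₂ U X Y Z s) (hp : p ∈ U) (T : ℂ) :
    diff (starPos lam S X Y Z s) p T = diff S p T +
      (diff (fun x => lam * (s x * -mink (X x) (Z x)) / -mink (Y x) (Z x)) p T • Y p +
      (lam * (s p * -mink (X p) (Z p)) / -mink (Y p) (Z p)) • diff Y p T) := by
  have e : diff (starPos lam S X Y Z s) p T = _ :=
    diff_add (C.smooth_S p hp) ((C.smooth_starCoeff hp).smul (C.smooth_Y p hp)) T
  rw [e, diff_smul (C.smooth_starCoeff hp) (C.smooth_Y p hp)]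

/-- The coefficient λr/u with r = sw is the one that works: ⟨dS, W⟩ is dr, ⟨Y, W⟩ is −u/λ, and du =
−λ⟨dY, Z⟩ cancels the term with dY. -/
theorem mink_diff_starPos (C : Configuration q F F₁ F₂ S m₁ m₂ U X Y Z s)
    (hlam : 1 - lam = m₂ / m₁) (h0 : lam ≠ 0) (hp : p ∈ U) (T : ℂ) :
    mink (diff (starPos lam S X Y Z s) p T) (starDir lam X Y Z p) = 0 := by
  obtain ⟨κ, L⟩ := C.lift p hp
  have sr := (C.smooth_s p hp).mul (C.smooth_w hp)
  have hu : -mink (Y p) (Z p) ≠ 0 := neg_ne_zero.2 (C.neg_YZ p hp).ne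
  have hu' : mink (Y p) (Z p) ≠ 0 := (C.neg_YZ p hp).ne
  have hg : diff (fun x => lam * (s x * -mink (X x) (Z x)) / -mink (Y x) (Z x)) p T =
      lam * mink (diff S p T) (Z p) * (-mink (Y p) (Z p))⁻¹ +
      lam * (s p * -mink (X p) (Z p)) *
        (-(-lam * mink (diff Y p T) (Z p)) / (-mink (Y p) (Z p)) ^ 2) := by
    simp only [div_eq_mul_inv]
    rw [diff_mul ((smoothAt_const lam p).mul sr) ((C.smooth_u hp).inv hu),
      diff_mul (smoothAt_const lam p) sr, diff_const, diff_inv (C.smooth_u hp) hu,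
      C.diff_r p hp, C.diff_u hlam hp]
    simp only [div_eq_mul_inv]
    ring
  have e1 : mink (diff S p T) (starDir lam X Y Z p) = mink (diff S p T) (Z p) := by
    simp only [starDir, mink_add_right, mink_smul_right, C.diff_S_X p hp, C.diff_S_Y p hp]
    ring
  have e2 : mink (diff Y p T) (starDir lam X Y Z p) = mink (diff Y p T) (Z p) := by
    simp only [starDir, mink_add_right, mink_smul_right, L.right_left, L.right_right]
    ring
  rw [C.diff_starPos hp, mink_add_left, mink_add_left, mink_smul_left, mink_smul_left, e1, e2,
    mink_comm (Y p), C.mink_starDir_Y hp, hg]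
  field_simp
  ring

/-- This is the source of the second fundamental form of the superposition: the term with dS is that
of F, and the term with dY contributes m₁ Re q through the spectral form. -/
theorem mink_diff_starPos_diff_starDir (C : Configuration q F F₁ F₂ S m₁ m₂ U X Y Z s)
    (hlam : 1 - lam = m₂ / m₁) (h0 : lam ≠ 0) (hp : p ∈ U) (T W : ℂ) :
    mink (diff (starPos lam S X Y Z s) p T) (diff (starDir lam X Y Z) p W) =
      ((1 - lam) / lam) * (-mink (Y p) (Z p) * mink (diff S p T) (diff X p W) +
        lam * (s p * -mink (X p) (Z p)) * (m₁ * (q.coeff p * T * W).re)) := by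
  obtain ⟨κ, L⟩ := C.lift p hp
  have hu' : mink (Y p) (Z p) ≠ 0 := (C.neg_YZ p hp).ne
  rw [C.diff_starPos hp, C.diff_starDir hlam h0 hp]
  simp only [mink_add_left, mink_add_right, mink_smul_left, mink_smul_right, C.diff_S_Y p hp,
    L.null_right, L.right_right, L.spectral, mink_comm (Y p) (diff X p W), L.left_right]
  field_simp
  ring

end Configuration
end Star

/-! ### The superposition is L-isothermic. -/

section Star

variable {M : Type*} [TopologicalSpace M] [ChartedSpace ℂ M]
variable {q : QuadraticDifferential M} {F F₁ F₂ Fs : M → ContactElement}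

/-- Conformal terms have no (2,0)-part, and the (2,0)-part of Re q is q/2. -/
theorem hopf_eq_of_secondForm {F G : M → ContactElement} {p : M} {a b c : ℝ}
    (h : ∀ T W, secondForm G p T W = a * secondForm F p T W + b * (q.coeff p * T * W).re +
      c * (T.re * W.re + T.im * W.im)) :
    hopf G p = a * hopf F p + (b / 2 : ℝ) * q.coeff p := by
  unfold hopf
  rw [h, h, h]
  apply Complex.ext
  · simp; ring
  · simp; ring

namespace Configuration

variable {S : M → V} {m₁ m₂ lam : ℝ} {U : Set M} {X Y Z : M → V} {s : M → ℝ} {p : M}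

/-- Null directions have time component 1, so normalizing the smooth field W by its time component
recovers the null direction. -/
theorem smoothAt_nullDir_star (C : Configuration q F F₁ F₂ S m₁ m₂ U X Y Z s)
    (hline : ∀ p ∈ U, (Fs p).nullLine =
      lineThrough (starPos lam S X Y Z s p) (starDir lam X Y Z p)) (hp : p ∈ U) :
    SmoothAt (nullDir Fs) p := by
  have h1 : SmoothAt (fun x => (tau (starDir lam X Y Z x))⁻¹ • starDir lam X Y Z x) p :=
    (((C.smooth_starDir hp).clm tau).inv (ContactElement.of_nullLine_eq (hline p hp)).1).smul
      (C.smooth_starDir hp)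
  refine h1.congr ?_
  filter_upwards [C.isOpen.mem_nhds hp] with x hx
  obtain ⟨h2, h3, -⟩ := ContactElement.of_nullLine_eq (hline x hx)
  nth_rewrite 2 [h3]
  rw [inv_smul_smul₀ h2]
  rfl

theorem smoothAt_normal_star (C : Configuration q F F₁ F₂ S m₁ m₂ U X Y Z s)
    (hline : ∀ p ∈ U, (Fs p).nullLine =
      lineThrough (starPos lam S X Y Z s p) (starDir lam X Y Z p)) (hp : p ∈ U) :
    SmoothAt (fun x => (Fs x).normal) p :=
  ((C.smoothAt_nullDir_star hline hp).clm nullInv).congr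
    (Filter.Eventually.of_forall fun _ => (nullInv_nullVec _).symm)

theorem pointVec_star (C : Configuration q F F₁ F₂ S m₁ m₂ U X Y Z s)
    (hline : ∀ p ∈ U, (Fs p).nullLine =
      lineThrough (starPos lam S X Y Z s p) (starDir lam X Y Z p)) (hp : p ∈ U) :
    (fun x => pointVec (Fs x).pt) =ᶠ[nhds p]
      fun x => starPos lam S X Y Z s x - tau (starPos lam S X Y Z s x) • nullDir Fs x := by
  filter_upwards [C.isOpen.mem_nhds hp] with x hx
  exact (ContactElement.of_nullLine_eq (hline x hx)).2.2

theorem smoothAt_pt_star (C : Configuration q F F₁ F₂ S m₁ m₂ U X Y Z s)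
    (hline : ∀ p ∈ U, (Fs p).nullLine =
      lineThrough (starPos lam S X Y Z s p) (starDir lam X Y Z p)) (hp : p ∈ U) :
    SmoothAt (fun x => (Fs x).pt) p := by
  have h1 : SmoothAt (fun x => pointVec (Fs x).pt) p :=
    ((C.smooth_starPos hp).sub (((C.smooth_starPos hp).clm tau).smul
      (C.smoothAt_nullDir_star hline hp))).congr (C.pointVec_star hline hp)
  exact (h1.clm pointInv).congr (Filter.Eventually.of_forall fun _ => (pointInv_pointVec _).symm)

theorem diff_starDir_eq (C : Configuration q F F₁ F₂ S m₁ m₂ U X Y Z s)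
    (hline : ∀ p ∈ U, (Fs p).nullLine =
      lineThrough (starPos lam S X Y Z s p) (starDir lam X Y Z p)) (hp : p ∈ U) (T : ℂ) :
    diff (starDir lam X Y Z) p T =
      diff (fun x => tau (starDir lam X Y Z x)) p T • nullDir Fs p +
        tau (starDir lam X Y Z p) • diff (nullDir Fs) p T := by
  rw [← diff_smul ((C.smooth_starDir hp).clm tau) (C.smoothAt_nullDir_star hline hp)]
  congr 1
  apply diff_congr
  filter_upwards [C.isOpen.mem_nhds hp] with x hx
  exact (ContactElement.of_nullLine_eq (hline x hx)).2.1

theorem diff_pt_star (C : Configuration q F F₁ F₂ S m₁ m₂ U X Y Z s)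
    (hline : ∀ p ∈ U, (Fs p).nullLine =
      lineThrough (starPos lam S X Y Z s p) (starDir lam X Y Z p)) (hp : p ∈ U) (T : ℂ) :
    pointVec (diff (fun x => (Fs x).pt) p T) = diff (starPos lam S X Y Z s) p T -
      (diff (fun x => tau (starPos lam S X Y Z s x)) p T • nullDir Fs p +
        tau (starPos lam S X Y Z s p) • diff (nullDir Fs) p T) := by
  have st := (C.smooth_starPos (lam := lam) hp).clm tau
  have sN := C.smoothAt_nullDir_star hline hp
  rw [← diff_smul st sN, ← diff_sub (C.smooth_starPos hp) (st.smul sN),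
    ← diff_congr (C.pointVec_star hline hp), ← pointLin_apply,
    ← diff_clm (C.smoothAt_pt_star hline hp)]
  rfl

end Configuration

/-- The superposition is locally given by lifts. -/
def IsLocalStar (q : QuadraticDifferential M) (F F₁ F₂ : M → ContactElement) (S : M → V)
    (m₁ m₂ lam : ℝ) (Fs : M → ContactElement) : Prop :=
  ∀ p₀ : M, ∃ U X Y Z s, p₀ ∈ U ∧ Configuration q F F₁ F₂ S m₁ m₂ U X Y Z s ∧
    ∀ p ∈ U, (Fs p).nullLine = lineThrough (starPos lam S X Y Z s p) (starDir lam X Y Z p)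

variable {S : M → V} {m₁ m₂ lam : ℝ}

theorem IsLocalStar.smooth_normal (H : IsLocalStar q F F₁ F₂ S m₁ m₂ lam Fs) :
    Smooth fun p => (Fs p).normal := fun p => by
  obtain ⟨U, X, Y, Z, s, hp, C, hline⟩ := H p
  exact C.smoothAt_normal_star hline hp

theorem IsLocalStar.smooth_pt (H : IsLocalStar q F F₁ F₂ S m₁ m₂ lam Fs) :
    Smooth fun p => (Fs p).pt := fun p => by
  obtain ⟨U, X, Y, Z, s, hp, C, hline⟩ := H p
  exact C.smoothAt_pt_star hline hp

theorem IsLocalStar.mink_diff_nullDir (H : IsLocalStar q F F₁ F₂ S m₁ m₂ lam Fs)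
    {U : Set M} {X Y Z : M → V} {s : M → ℝ} {p : M}
    (C : Configuration q F F₁ F₂ S m₁ m₂ U X Y Z s)
    (hline : ∀ p ∈ U, (Fs p).nullLine =
      lineThrough (starPos lam S X Y Z s p) (starDir lam X Y Z p)) (hp : p ∈ U)
    (hlam : 1 - lam = m₂ / m₁) (h0 : lam ≠ 0) {κ : ℝ}
    (L : LiftAt (q.coeff p) m₁ κ (X p) (Y p) (diff X p) (diff Y p)) (T W : ℂ) :
    mink (diff (nullDir Fs) p T) (diff (nullDir Fs) p W) =
      ((1 - lam) / lam * mink (Y p) (Z p) / tau (starDir lam X Y Z p)) ^ 2 * κ *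
        (T.re * W.re + T.im * W.im) := by
  have ht := (ContactElement.of_nullLine_eq (hline p hp)).1
  have hN := mink_diff_nullDir_self H.smooth_normal p
  have e1 : mink (diff (starDir lam X Y Z) p T) (diff (starDir lam X Y Z) p W) =
      tau (starDir lam X Y Z p) ^ 2 *
        mink (diff (nullDir Fs) p T) (diff (nullDir Fs) p W) := by
    rw [C.diff_starDir_eq hline hp, C.diff_starDir_eq hline hp]
    simp only [mink_add_left, mink_add_right, mink_smul_left, mink_smul_right, hN,
      mink_nullDir_self, mink_comm (nullDir Fs p)]
    ring
  rw [C.diff_starDir hlam h0 hp, C.diff_starDir hlam h0 hp] at e1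
  simp only [mink_add_left, mink_add_right, mink_smul_left, mink_smul_right, L.conformal,
    L.left_right, L.null_right, mink_comm (Y p) (diff X p W)] at e1
  field_simp at e1 ⊢
  linear_combination -e1

theorem IsLocalStar.isLIsothermic (H : IsLocalStar q F F₁ F₂ S m₁ m₂ lam Fs)
    (hF : IsLIsothermic q F) (hq : ∀ p, q.coeff p ≠ 0) (hlam : 1 - lam = m₂ / m₁)
    (h0 : lam ≠ 0) (h1 : lam ≠ 1) : IsLIsothermic q Fs where
  smooth_pt := H.smooth_pt
  smooth_normal := H.smooth_normal
  contact p T := by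
    obtain ⟨U, X, Y, Z, s, hp, C, hline⟩ := H p
    obtain ⟨ht, hW, -⟩ := ContactElement.of_nullLine_eq (hline p hp)
    have e1 := mink_pointVec_nullVec (diff (fun x => (Fs x).pt) p T) (Fs p).normal
    have e2 := C.mink_diff_starPos hlam h0 hp T
    rw [hW, mink_smul_right] at e2
    have e3 : mink (diff (starPos lam S X Y Z s) p T) (nullDir Fs p) = 0 :=
      (mul_eq_zero.1 e2).resolve_left ht
    have e4 : mink (pointVec (diff (fun x => (Fs x).pt) p T)) (nullDir Fs p) = 0 := by
      rw [C.diff_pt_star hline hp]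
      simp only [mink_sub_left, mink_add_left, mink_smul_left, mink_nullDir_self,
        mink_diff_nullDir_self H.smooth_normal, e3]
      ring
    rw [nullDir] at e4
    rw [e4, eq_comm, div_eq_zero_iff] at e1
    exact e1.resolve_right (by positivity)
  third_form p := by
    obtain ⟨U, X, Y, Z, s, hp, C, hline⟩ := H p
    obtain ⟨κ, L⟩ := C.lift p hp
    have ht := (ContactElement.of_nullLine_eq (hline p hp)).1
    have hu := (C.neg_YZ p hp).ne
    have h1' : 1 - lam ≠ 0 := sub_ne_zero.2 h1.symm
    have hκ := L.pos
    refine ⟨2 * (((1 - lam) / lam * mink (Y p) (Z p) / tau (starDir lam X Y Z p)) ^ 2 * κ),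
      by positivity, fun T => ?_⟩
    have e1 := H.mink_diff_nullDir C hline hp hlam h0 L T T
    rw [diff_nullDir H.smooth_normal, mink_nullLin, real_inner_self_eq_norm_sq] at e1
    rw [Complex.sq_norm, Complex.normSq_apply]
    linarith
  hopf_eq := by
    obtain ⟨μ, hμ, hμq⟩ := hF.hopf_eq
    have key : ∀ p₀, ∃ (U : Set M) (μ' : M → ℝ), p₀ ∈ U ∧ IsOpen U ∧ ∀ p ∈ U, SmoothAt μ' p ∧
        hopf Fs p = (μ' p : ℂ) * q.coeff p := by
      intro p₀
      obtain ⟨U, X, Y, Z, s, hp₀, C, hline⟩ := H p₀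
      -- The factor is read off from `eS` below: the coefficient of the second form of F times μ,
      -- plus half the coefficient of Re q.
      refine ⟨U, fun p => ((1 - lam) / lam) / tau (starDir lam X Y Z p) *
        (-mink (Y p) (Z p) * tau (X p) * μ p -
          lam * (s p * -mink (X p) (Z p)) * (m₁ / √2)), hp₀, C.isOpen, fun p hp => ⟨?_, ?_⟩⟩
      · exact ((smoothAt_const _ p).div ((C.smooth_starDir hp).clm tau)
          (ContactElement.of_nullLine_eq (hline p hp)).1).mul
          ((((C.smooth_u hp).mul ((C.smooth_X p hp).clm tau)).mul (hμ.smoothAt p)).sub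
          (((smoothAt_const lam p).mul ((C.smooth_s p hp).mul (C.smooth_w hp))).mul
            (smoothAt_const _ p)))
      · obtain ⟨κ, L⟩ := C.lift p hp
        obtain ⟨ht, hW, -⟩ := ContactElement.of_nullLine_eq (hline p hp)
        have h2 : √2 ≠ 0 := by positivity
        have h22 : √2 * √2 = 2 := Real.mul_self_sqrt (by norm_num)
        -- The constant √2 comes from the scaling of `pointVec` and `nullVec`: pairing them gives
        -- the Euclidean product divided by √2.
        have second : ∀ (G : M → ContactElement), Smooth (fun x => (G x).normal) → ∀ T W,
            secondForm G p T W = -√2 * mink (pointVec (diff (fun x => (G x).pt) p T))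
              (diff (nullDir G) p W) := by
          intro G hG T W
          rw [diff_nullDir hG, mink_pointVec_nullLin, secondForm]
          field_simp
        obtain ⟨κF, -, hκF⟩ := hF.exists_conformal p
        have sX := C.smooth_X p hp
        -- the second fundamental form of `F` in terms of the lift
        have eF : ∀ T W, mink (diff S p T) (diff X p W) = tau (X p) *
            (-(secondForm F p T W) / √2 + tau (S p) * (κF * (T.re * W.re + T.im * W.im))) := by
          intro T W
          have sN := hF.smoothAt_nullDir p
          have sS := C.smooth_S p hp
          have hXe : X =ᶠ[nhds p] fun x => tau (X x) • nullDir F x := by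
            filter_upwards [C.isOpen.mem_nhds hp] with x hx
            obtain ⟨a, -, ha⟩ := C.direction_X x hx
            have : tau (X x) = a := by rw [ha, map_smul, nullDir, tau_nullVec]; simp
            rw [this, ha]
          have hSe : S =ᶠ[nhds p] fun x => pointLin (F x).pt + tau (S x) • nullDir F x := by
            filter_upwards [C.isOpen.mem_nhds hp] with x hx
            exact ContactElement.mem_nullLine_iff.1 (C.mem_F x hx)
          have hSN : mink (diff S p T) (nullDir F p) = 0 := by
            obtain ⟨a, ha0, ha⟩ := C.direction_X p hp
            have := C.diff_S_X p hp T
            rw [ha, mink_smul_right] at this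
            exact (mul_eq_zero.1 this).resolve_left ha0.ne'
          have hNd : mink (nullDir F p) (diff (nullDir F) p W) = 0 := by
            rw [mink_comm]; exact mink_diff_nullDir_self hF.smooth_normal p W
          rw [diff_congr hXe, diff_smul (sX.clm tau) sN, mink_add_right, mink_smul_right,
            mink_smul_right, hSN, diff_congr hSe,
            diff_add ((hF.smooth_pt.smoothAt p).clm pointLin) ((sS.clm tau).smul sN),
            diff_smul (sS.clm tau) sN, diff_clm (hF.smooth_pt.smoothAt p), second F hF.smooth_normal]
          simp only [mink_add_left, mink_smul_left, hNd, hκF, pointLin_apply]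
          field_simp
          ring
        have eS : ∀ T W, secondForm Fs p T W =
            ((1 - lam) / lam / tau (starDir lam X Y Z p) * (-mink (Y p) (Z p)) * tau (X p)) *
              secondForm F p T W +
            (-√2 * ((1 - lam) / lam) / tau (starDir lam X Y Z p) * lam *
              (s p * -mink (X p) (Z p)) * m₁) * (q.coeff p * T * W).re +
            (-√2 * ((1 - lam) / lam / tau (starDir lam X Y Z p) * (-mink (Y p) (Z p)) * tau (X p) *
              tau (S p) * κF -
              tau (starPos lam S X Y Z s p) *
              (((1 - lam) / lam * mink (Y p) (Z p) / tau (starDir lam X Y Z p)) ^ 2 * κ))) *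
              (T.re * W.re + T.im * W.im) := by
          intro T W
          have e1 := C.mink_diff_starPos hlam h0 hp T
          rw [hW, mink_smul_right] at e1
          have e2 : mink (diff (starPos lam S X Y Z s) p T) (nullDir Fs p) = 0 :=
            (mul_eq_zero.1 e1).resolve_left ht
          have e3 := C.mink_diff_starPos_diff_starDir hlam h0 hp T W
          have hNd : mink (nullDir Fs p) (diff (nullDir Fs) p W) = 0 := by
            rw [mink_comm]; exact mink_diff_nullDir_self H.smooth_normal p W
          rw [C.diff_starDir_eq hline hp, mink_add_right, mink_smul_right, mink_smul_right, e2,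
            eF, mul_zero, zero_add] at e3
          have e4 := eq_div_of_mul_eq ht ((mul_comm _ _).trans e3)
          rw [second Fs H.smooth_normal, C.diff_pt_star hline hp]
          simp only [mink_sub_left, mink_add_left, mink_smul_left, hNd,
            H.mink_diff_nullDir C hline hp hlam h0 L]
          rw [e4]
          field_simp
          ring
        rw [hopf_eq_of_secondForm eS, hμq, ← mul_assoc, ← add_mul]
        congr 1
        rw [← Complex.ofReal_mul, ← Complex.ofReal_add]
        congr 1
        field_simp
        linear_combination (lam * s p * mink (X p) (Z p) * m₁) * h22
    -- Since q has no zeros here, the multiplier is unique and the local formulas glue to a global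
    -- smooth function.
    refine ⟨fun p => (hopf Fs p / q.coeff p).re, fun p₀ => ?_, fun p => ?_⟩
    · obtain ⟨U, μ', hp₀, hU, hμ'⟩ := key p₀
      refine (hμ' p₀ hp₀).1.congr ?_
      filter_upwards [hU.mem_nhds hp₀] with x hx
      rw [(hμ' x hx).2, mul_div_cancel_right₀ _ (hq x), Complex.ofReal_re]
    · obtain ⟨U, μ', hp, hU, hμ'⟩ := key p
      change _ = (((hopf Fs p / q.coeff p).re : ℝ) : ℂ) * q.coeff p
      rw [(hμ' p hp).2, mul_div_cancel_right₀ _ (hq p), Complex.ofReal_re]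

end Star

/-! ### Linear dependence and determinants for the Darboux conditions. -/

theorem not_linearIndependent_of_relation {a b c d : V} {α β γ δ : ℝ} (hγ : γ ≠ 0)
    (h : α • a + β • b + γ • c + δ • d = 0) : ¬ LinearIndependent ℝ ![a, b, c, d] := by
  rw [Fintype.not_linearIndependent_iff]
  exact ⟨![α, β, γ, δ], by simpa [Fin.sum_univ_four] using h, 2, hγ⟩

theorem det4_smul_smul (a b c d : V) (r : ℝ) :
    det4 a b (r • c) (r • d) = r ^ 2 * det4 a b c d := by
  simp only [det4_eq, Pi.smul_apply, smul_eq_mul]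
  ring

theorem det4_smul_left (a b c d : V) (r s : ℝ) :
    det4 (r • a) (s • b) c d = r * s * det4 a b c d := by
  simp only [det4_eq, Pi.smul_apply, smul_eq_mul]
  ring

theorem det4_second_combination (a b e f : V) (r s x y : ℝ) :
    det4 b (r • a + s • b + x • e + y • f) e f = -r * det4 a b e f := by
  simp only [det4_eq, Pi.add_apply, Pi.smul_apply, smul_eq_mul]
  ring

/-- A kernel vector v of the matrix, transformed by the Gram matrix, would be Lorentz-orthogonal to
X, Y and all values of A, hence zero. -/
theorem LiftAt.det4_ne_zero {c : ℂ} {m κ : ℝ} {X Y : V} {A B : ℂ →L[ℝ] V}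
    (L : LiftAt c m κ X Y A B) : det4 X Y (A 1) (A Complex.I) ≠ 0 := by
  intro h
  obtain ⟨v, hv, hv0⟩ := Matrix.exists_mulVec_eq_zero_iff.2 h
  have key : ∀ x : V, mink ![-v 3, v 1, v 2, -v 0] x = x ⬝ᵥ v := by
    intro x
    simp [mink, dotProduct, Fin.sum_univ_four]
    ring
  have hD : ![-v 3, v 1, v 2, -v 0] = 0 := by
    refine L.eq_zero ?_ ?_ fun U => ?_
    · rw [key]; exact congrFun hv0 0
    · rw [key]; exact congrFun hv0 1
    · have h2 : A 1 ⬝ᵥ v = 0 := congrFun hv0 2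
      have h3 : A Complex.I ⬝ᵥ v = 0 := congrFun hv0 3
      rw [clm_complex_apply, mink_add_right, mink_smul_right, mink_smul_right, key, key, h2, h3]
      ring
  apply hv
  ext i
  have h0 := congrFun hD 0
  have h1 := congrFun hD 1
  have h2 := congrFun hD 2
  have h3 := congrFun hD 3
  fin_cases i <;> simp_all

/-- In a direction where the quadratic differential is real, the differentials of the two lifts
are parallel. -/
theorem LiftAt.right_eq_smul {c : ℂ} {m κ : ℝ} {X Y : V} {A B : ℂ →L[ℝ] V}
    (L : LiftAt c m κ X Y A B) {T : ℂ} (hT : (c * T * T).im = 0) : ∃ t : ℝ, B T = t • A T := by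
  by_cases h0 : T = 0
  · exact ⟨0, by simp [h0]⟩
  have hn : Complex.normSq T ≠ 0 := (Complex.normSq_pos.2 h0).ne'
  have hκ := L.pos.ne'
  -- When cT² is real, conj(cT) · conj T = cT², so multiplying by T shows that conj(cT) is a real
  -- multiple of T.
  have h1 : (starRingEnd ℂ) (c * T) = ((c * T * T).re / Complex.normSq T : ℝ) • T := by
    have h2 : (starRingEnd ℂ) (c * T) * (starRingEnd ℂ) T = ((c * T * T).re : ℂ) := by
      rw [← map_mul, Complex.conj_eq_iff_im.2 hT]
      exact (Complex.ext rfl (by simpa using hT))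
    have h3 : (Complex.normSq T : ℂ) = (starRingEnd ℂ) T * T := Complex.normSq_eq_conj_mul_self
    have h4 : (Complex.normSq T : ℂ) ≠ 0 := by exact_mod_cast hn
    rw [Complex.real_smul, Complex.ofReal_div, ← h2]
    field_simp
    rw [h3]
    ring
  have h2 := L.right_eq T
  rw [h1, map_smul, smul_smul] at h2
  refine ⟨κ⁻¹ * (m * ((c * T * T).re / Complex.normSq T)), ?_⟩
  rw [← smul_smul, ← h2, inv_smul_smul₀ hκ]

/-! ### The first transform and the superposition form a Bianchi–Darboux pair. -/

section Star

variable {M : Type*} [TopologicalSpace M] [ChartedSpace ℂ M]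
variable {q : QuadraticDifferential M} {F F₁ F₂ Fs : M → ContactElement}
variable {S : M → V} {m₁ m₂ lam : ℝ}

namespace Configuration

variable {U : Set M} {X Y Z : M → V} {s : M → ℝ} {p : M}

theorem eq_tau_Y (C : Configuration q F F₁ F₂ S m₁ m₂ U X Y Z s) (hp : p ∈ U) :
    0 < tau (Y p) ∧ Y p = tau (Y p) • nullDir F₁ p := by
  obtain ⟨a, ha, h⟩ := C.direction_Y p hp
  have : tau (Y p) = a := by rw [h, map_smul, nullDir, tau_nullVec]; simp
  rw [this]
  exact ⟨ha, h⟩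

theorem diff_Y_eq (C : Configuration q F F₁ F₂ S m₁ m₂ U X Y Z s)
    (hF₁ : Smooth fun p => (F₁ p).normal) (hp : p ∈ U) (T : ℂ) :
    diff Y p T = diff (fun x => tau (Y x)) p T • nullDir F₁ p +
      tau (Y p) • diff (nullDir F₁) p T := by
  rw [← diff_smul ((C.smooth_Y p hp).clm tau) (smoothAt_nullDir hF₁ p)]
  congr 1
  apply diff_congr
  filter_upwards [C.isOpen.mem_nhds hp] with x hx
  exact (C.eq_tau_Y hx).2

theorem distinct_star (C : Configuration q F F₁ F₂ S m₁ m₂ U X Y Z s) (h0 : lam ≠ 0)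
    (hline : ∀ p ∈ U, (Fs p).nullLine =
      lineThrough (starPos lam S X Y Z s p) (starDir lam X Y Z p)) (hp : p ∈ U) :
    (F₁ p).normal ≠ (Fs p).normal := by
  intro h
  have e := C.mink_starDir_Y (lam := lam) hp
  obtain ⟨-, hW, -⟩ := ContactElement.of_nullLine_eq (hline p hp)
  rw [hW, (C.eq_tau_Y hp).2, nullDir, h, mink_smul_left, mink_smul_right, nullDir_null,
    mink_smul_left] at e
  have hu := (C.neg_YZ p hp).ne
  rw [(C.eq_tau_Y hp).2, nullDir, h, mink_smul_left] at hu
  have := mul_ne_zero (inv_ne_zero h0) hu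
  apply this
  rw [← e]
  ring

/-- In a curvature direction dY = t dX, while dW is a multiple of dX modulo Y; eliminating dX gives
a linear relation. -/
theorem ribaucour_star (C : Configuration q F F₁ F₂ S m₁ m₂ U X Y Z s)
    (hF₁ : Smooth fun p => (F₁ p).normal) (hlam : 1 - lam = m₂ / m₁)
    (h0 : lam ≠ 0) (h1 : lam ≠ 1)
    (hline : ∀ p ∈ U, (Fs p).nullLine =
      lineThrough (starPos lam S X Y Z s p) (starDir lam X Y Z p)) (hp : p ∈ U) {T : ℂ}
    (hT : (q.coeff p * T * T).im = 0) : ¬ LinearIndependent ℝ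
      ![nullDir F₁ p, nullDir Fs p, diff (nullDir F₁) p T, diff (nullDir Fs) p T] := by
  obtain ⟨κ, L⟩ := C.lift p hp
  obtain ⟨t, ht⟩ := L.right_eq_smul hT
  have eY := C.diff_Y_eq hF₁ hp T
  have eW := C.diff_starDir_eq hline hp T
  have hu := neg_ne_zero.2 (C.neg_YZ p hp).ne
  rw [C.diff_starDir hlam h0 hp] at eW
  set c₁ := (1 - lam) / lam with hc₁
  have hc₁0 : c₁ ≠ 0 := div_ne_zero (sub_ne_zero.2 h1.symm) h0
  have hY := (C.eq_tau_Y hp).2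
  set A := diff X p T
  -- The coefficient γ of the differential of ν(n₁) contains no t, so the relation is nontrivial
  -- even if t = 0.
  refine not_linearIndependent_of_relation
    (α := c₁ * -mink (Y p) (Z p) * diff (fun x => tau (Y x)) p T +
      t * (c₁ * (lam * mink A (Z p)) * tau (Y p)))
    (β := -t * diff (fun x => tau (starDir lam X Y Z x)) p T)
    (γ := c₁ * -mink (Y p) (Z p) * tau (Y p)) (δ := -t * tau (starDir lam X Y Z p))
    (mul_ne_zero (mul_ne_zero hc₁0 hu) (C.eq_tau_Y hp).1.ne') ?_
  rw [ht] at eY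
  have hYl : (lam * mink A (Z p)) • Y p = (lam * mink A (Z p) * tau (Y p)) • nullDir F₁ p := by
    conv_lhs => rw [hY, smul_smul]
  rw [hYl] at eW
  linear_combination (norm := module) (-(c₁ * -mink (Y p) (Z p))) • eY + t • eW

/-- Relative to dX and modulo the two null directions, dY is the orientation-reversing map U ↦
conj(qU) up to a real factor and dW is a real multiple of the identity. Their determinants are a
negative and a positive multiple of the same nonzero number D. -/
theorem orientation_star (C : Configuration q F F₁ F₂ S m₁ m₂ U X Y Z s)
    (hF₁ : Smooth fun p => (F₁ p).normal) (hm : m₁ ≠ 0) (hq : q.coeff p ≠ 0)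
    (hlam : 1 - lam = m₂ / m₁) (h0 : lam ≠ 0) (h1 : lam ≠ 1)
    (hline : ∀ p ∈ U, (Fs p).nullLine =
      lineThrough (starPos lam S X Y Z s p) (starDir lam X Y Z p)) (hp : p ∈ U) :
    orientationDet F₁ Fs F₁ p * orientationDet F₁ Fs Fs p < 0 := by
  obtain ⟨κ, L⟩ := C.lift p hp
  have hκ := L.pos
  have hu := neg_ne_zero.2 (C.neg_YZ p hp).ne
  obtain ⟨hτ, hW, -⟩ := ContactElement.of_nullLine_eq (hline p hp)
  obtain ⟨hy, hY⟩ := C.eq_tau_Y hp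
  set c₁ := (1 - lam) / lam with hc₁
  have hc₁0 : c₁ ≠ 0 := div_ne_zero (sub_ne_zero.2 h1.symm) h0
  set D := det4 (nullDir F₁ p) (nullDir Fs p) (diff X p 1) (diff X p Complex.I) with hD
  have hD0 : D ≠ 0 := by
    have e1 : det4 (Y p) (starDir lam X Y Z p) (diff X p 1) (diff X p Complex.I) ≠ 0 := by
      rw [L.decomposition (starDir lam X Y Z p), det4_second_combination, C.mink_starDir_Y hp]
      refine mul_ne_zero ?_ L.det4_ne_zero
      rw [neg_neg]
      exact mul_ne_zero (inv_ne_zero h0) (C.neg_YZ p hp).ne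
    rw [hY, hW, det4_smul_left] at e1
    exact right_ne_zero_of_mul e1
  have f1 : ∀ T, (κ * tau (Y p)) • diff (nullDir F₁) p T =
      (-(κ * diff (fun x => tau (Y x)) p T)) • nullDir F₁ p + (0 : ℝ) • nullDir Fs p +
        (m₁ * ((starRingEnd ℂ) (q.coeff p * T)).re) • diff X p 1 +
        (m₁ * ((starRingEnd ℂ) (q.coeff p * T)).im) • diff X p Complex.I := by
    intro T
    have e1 := L.right_eq T
    rw [C.diff_Y_eq hF₁ hp, clm_complex_apply (diff X p)] at e1
    linear_combination (norm := module) e1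
  have f2 : ∀ T : ℂ, tau (starDir lam X Y Z p) • diff (nullDir Fs) p T =
      (c₁ * (lam * mink (diff X p T) (Z p)) * tau (Y p)) • nullDir F₁ p +
        (-diff (fun x => tau (starDir lam X Y Z x)) p T) • nullDir Fs p +
        (c₁ * -mink (Y p) (Z p) * T.re) • diff X p 1 +
        (c₁ * -mink (Y p) (Z p) * T.im) • diff X p Complex.I := by
    intro T
    have e1 := C.diff_starDir_eq hline hp T
    have hYl : (lam * mink (diff X p T) (Z p)) • Y p =
        (lam * mink (diff X p T) (Z p) * tau (Y p)) • nullDir F₁ p := by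
      conv_lhs => rw [hY, smul_smul]
    rw [C.diff_starDir hlam h0 hp, hYl] at e1
    have e2 := clm_complex_apply (diff X p) T
    linear_combination (norm := module) -e1 + (c₁ * -mink (Y p) (Z p)) • e2
  have g1 : (κ * tau (Y p)) ^ 2 * orientationDet F₁ Fs F₁ p =
      -(m₁ ^ 2 * Complex.normSq (q.coeff p)) * D := by
    change _ * det4 (nullDir F₁ p) (nullDir Fs p) (diff (nullDir F₁) p 1)
      (diff (nullDir F₁) p Complex.I) = _
    rw [← det4_smul_smul, f1, f1, det4_combination, Complex.normSq_apply]
    simp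
    ring
  have g2 : tau (starDir lam X Y Z p) ^ 2 * orientationDet F₁ Fs Fs p =
      (c₁ * -mink (Y p) (Z p)) ^ 2 * D := by
    change _ * det4 (nullDir F₁ p) (nullDir Fs p) (diff (nullDir Fs) p 1)
      (diff (nullDir Fs) p Complex.I) = _
    rw [← det4_smul_smul, f2, f2, det4_combination]
    simp
    ring
  have hpos : 0 < (κ * tau (Y p)) ^ 2 * tau (starDir lam X Y Z p) ^ 2 := by positivity
  have hq' := Complex.normSq_pos.2 hq
  have hneg : (κ * tau (Y p)) ^ 2 * tau (starDir lam X Y Z p) ^ 2 *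
      (orientationDet F₁ Fs F₁ p * orientationDet F₁ Fs Fs p) < 0 := by
    have : (κ * tau (Y p)) ^ 2 * tau (starDir lam X Y Z p) ^ 2 *
      (orientationDet F₁ Fs F₁ p * orientationDet F₁ Fs Fs p) =
      -(m₁ ^ 2 * Complex.normSq (q.coeff p) * (c₁ * -mink (Y p) (Z p)) ^ 2 * D ^ 2) := by
      linear_combination (tau (starDir lam X Y Z p) ^ 2 * orientationDet F₁ Fs Fs p) * g1 -
        (m₁ ^ 2 * Complex.normSq (q.coeff p)) * D * g2
    rw [this, neg_lt_zero]
    have : 0 < (c₁ * -mink (Y p) (Z p)) ^ 2 :=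
      sq_pos_of_ne_zero (mul_ne_zero hc₁0 hu)
    positivity
  exact (pos_iff_neg_of_mul_neg hneg).1 hpos

end Configuration

/-- `Sb` is a single global map; every condition is checked in the local lifts around a point. Both
third forms are conformal to the complex structure, which gives the Darboux condition. -/
theorem isBianchiDarboux_star (h₁ : IsBianchiDarboux q F F₁) {Sb : M → V}
    (H : ∀ p₀ : M, ∃ U X Y Z s, p₀ ∈ U ∧ Configuration q F F₁ F₂ S m₁ m₂ U X Y Z s ∧
      ∀ p ∈ U, Sb p = starPos lam S X Y Z s p ∧
        (Fs p).nullLine = lineThrough (starPos lam S X Y Z s p) (starDir lam X Y Z p))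
    (hm : m₁ ≠ 0) (hlam : 1 - lam = m₂ / m₁) (h0 : lam ≠ 0) (h1 : lam ≠ 1) :
    IsBianchiDarboux q F₁ Fs := by
  have hq : ∀ p, q.coeff p ≠ 0 := fun p => (h₁.exists_spectral p).1
  have H' : IsLocalStar q F F₁ F₂ S m₁ m₂ lam Fs := fun p => by
    obtain ⟨U, X, Y, Z, s, hp, C, h⟩ := H p
    exact ⟨U, X, Y, Z, s, hp, C, fun p hp => (h p hp).2⟩
  have hs := H'.isLIsothermic h₁.isothermic_left hq hlam h0 h1
  refine ⟨h₁.isothermic_right, hs, Sb, ?_⟩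
  constructor
  · intro p
    obtain ⟨U, X, Y, Z, s, hp, C, h⟩ := H p
    refine (C.smooth_starPos (lam := lam) hp).congr ?_
    filter_upwards [C.isOpen.mem_nhds hp] with x hx using (h x hx).1
  · intro p
    obtain ⟨U, X, Y, Z, s, hp, C, h⟩ := H p
    obtain ⟨t, ht⟩ := C.mem_F₁ p hp
    rw [(h p hp).1, starPos, (C.eq_tau_Y hp).2, ht, smul_smul, nullDir, add_assoc, ← add_smul]
    exact ⟨_, rfl⟩
  · intro p
    obtain ⟨U, X, Y, Z, s, hp, C, h⟩ := H p
    rw [(h p hp).2, (h p hp).1]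
    exact ⟨0, by simp⟩
  · intro p
    obtain ⟨U, X, Y, Z, s, hp, C, h⟩ := H p
    exact C.distinct_star h0 (fun p hp => (h p hp).2) hp
  · intro p T hT
    obtain ⟨U, X, Y, Z, s, hp, C, h⟩ := H p
    exact C.ribaucour_star h₁.isothermic_right.smooth_normal hlam h0 h1
      (fun p hp => (h p hp).2) hp hT
  · intro p
    obtain ⟨c, hc, hcX⟩ := hs.third_form p
    obtain ⟨c', hc', hcX'⟩ := h₁.isothermic_right.third_form p
    refine ⟨√(c / c'), by positivity, fun T => ?_⟩
    rw [← abs_of_nonneg (norm_nonneg (diff (fun x => (Fs x).normal) p T)),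
      ← abs_of_nonneg (norm_nonneg (diff (fun x => (F₁ x).normal) p T)),
      ← Real.sqrt_sq_eq_abs, ← Real.sqrt_sq_eq_abs, hcX, hcX', ← Real.sqrt_mul (by positivity)]
    congr 1
    field_simp
  · intro p
    obtain ⟨U, X, Y, Z, s, hp, C, h⟩ := H p
    exact C.orientation_star h₁.isothermic_right.smooth_normal hm (hq p) hlam h0 h1
      (fun p hp => (h p hp).2) hp

end Star

/-! ### From null lines back to contact elements. -/

theorem nullVec_nullInv {w : V} (h : tau w = 1) : nullVec (nullInv w) = w := by
  have h2 : √2 ≠ 0 := by positivity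
  rw [tau_apply] at h
  ext i
  fin_cases i <;> simp [nullInv, nullVec]
  · linarith
  · linarith

theorem pointVec_pointInv {x : V} (h : tau x = 0) : pointVec (pointInv x) = x := by
  have h2 : √2 ≠ 0 := by positivity
  rw [tau_apply] at h
  ext i
  fin_cases i <;> simp [pointInv, pointVec]
  field_simp
  linarith

theorem norm_nullInv {w : V} (h0 : mink w w = 0) (h : tau w = 1) : ‖nullInv w‖ = 1 := by
  have h2 : √2 ^ 2 = (2 : ℝ) := Real.sq_sqrt (by norm_num)
  have e : ‖nullInv w‖ ^ 2 = 1 := by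
    rw [← real_inner_self_eq_norm_sq, inner_eq]
    rw [tau_apply] at h
    simp [mink] at h0
    simp [nullInv]
    linear_combination 2 * h0 + (w 0 + w 3 + 1) * h + (w 1 ^ 2 + w 2 ^ 2) * h2
  exact (pow_eq_one_iff_of_nonneg (norm_nonneg _) two_ne_zero).1 e

/-- On the hyperplane of time 0 the Lorentz product is positive definite. -/
theorem tau_ne_zero_of_null {w : V} (h0 : mink w w = 0) (hw : w ≠ 0) : tau w ≠ 0 := by
  intro h
  rw [tau_apply] at h
  have h3 : w 3 = -w 0 := by linarith
  simp only [mink, h3] at h0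
  have e0 : w 0 = 0 := by nlinarith [sq_nonneg (w 0), sq_nonneg (w 1), sq_nonneg (w 2)]
  have e1 : w 1 = 0 := by nlinarith [sq_nonneg (w 0), sq_nonneg (w 1), sq_nonneg (w 2)]
  have e2 : w 2 = 0 := by nlinarith [sq_nonneg (w 0), sq_nonneg (w 1), sq_nonneg (w 2)]
  apply hw
  ext i
  fin_cases i <;> simp [e0, e1, e2, h3]

/-- Every null line of Minkowski space represents a contact element. -/
theorem exists_contactElement {w : V} (h0 : mink w w = 0) (hw : w ≠ 0) (x : V) :
    ∃ c : ContactElement, c.nullLine = lineThrough x w := by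
  have ht := tau_ne_zero_of_null h0 hw
  set n := (tau w)⁻¹ • w with hn
  have h1 : tau n = 1 := by rw [hn, map_smul, smul_eq_mul, inv_mul_cancel₀ ht]
  have h2 : mink n n = 0 := by rw [hn, mink_smul_left, mink_smul_right, h0]; ring
  have h3 : tau (x - tau x • n) = 0 := by rw [map_sub, map_smul, h1]; simp
  refine ⟨⟨pointInv (x - tau x • n), nullInv n, norm_nullInv h2 h1⟩, ?_⟩
  unfold ContactElement.nullLine
  dsimp only
  rw [nullVec_nullInv h1, pointVec_pointInv h3]
  refine lineThrough_congr (c := (tau w)⁻¹) (t := -(tau x * (tau w)⁻¹)) (inv_ne_zero ht) hn ?_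
  rw [hn]
  module

/-! ### Global, symmetric formulas for the superposition. -/

section Star

variable {M : Type*}

/-- The null direction of the superposition of `F₁` and `F₂` with respect to `F`, up to scale. -/
def starNull (lam mu : ℝ) (F F₁ F₂ : M → ContactElement) (p : M) : V :=
  mink (nullDir F₁ p) (nullDir F₂ p) • nullDir F p -
    (lam * mink (nullDir F p) (nullDir F₂ p)) • nullDir F₁ p -
    (mu * mink (nullDir F p) (nullDir F₁ p)) • nullDir F₂ p

/-- The sphere congruence enveloped by `F₁` and the superposition of `F₁` and `F₂` with respect
to `F`. -/
def starCongr (lam : ℝ) (F F₁ F₂ : M → ContactElement) (S₁ S₂ : M → V) (p : M) : V :=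
  S₁ p + (lam * (tau (S₂ p) - tau (S₁ p)) * (mink (nullDir F p) (nullDir F₂ p) /
    mink (nullDir F₁ p) (nullDir F₂ p))) • nullDir F₁ p

variable {F F₁ F₂ : M → ContactElement} {S₁ S₂ : M → V} {lam mu : ℝ} {p : M}

/-- The square is 2(λμ − λ − μ) times the product of the three mutual scalar products, so it
vanishes precisely through the relation between λ and μ. -/
theorem mink_starNull_self (h : mu = lam * (mu - 1)) :
    mink (starNull lam mu F F₁ F₂ p) (starNull lam mu F F₁ F₂ p) = 0 := by
  simp only [starNull, mink_sub_left, mink_sub_right, mink_smul_left, mink_smul_right,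
    mink_nullDir_self, mink_comm (nullDir F₁ p) (nullDir F p),
    mink_comm (nullDir F₂ p) (nullDir F p), mink_comm (nullDir F₂ p) (nullDir F₁ p)]
  linear_combination (-2 * mink (nullDir F p) (nullDir F₁ p) * mink (nullDir F p) (nullDir F₂ p) *
    mink (nullDir F₁ p) (nullDir F₂ p)) * h

theorem mink_starNull (h : mu = lam * (mu - 1)) :
    mink (starNull lam mu F F₁ F₂ p) (nullDir F p) =
      -(lam * mu * mink (nullDir F p) (nullDir F₁ p) * mink (nullDir F p) (nullDir F₂ p)) := by
  simp only [starNull, mink_sub_left, mink_smul_left,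
    mink_nullDir_self, mink_comm (nullDir F₁ p) (nullDir F p),
    mink_comm (nullDir F₂ p) (nullDir F p)]
  linear_combination (-mink (nullDir F p) (nullDir F₁ p) * mink (nullDir F p) (nullDir F₂ p)) * h

theorem starNull_swap : starNull mu lam F F₂ F₁ p = starNull lam mu F F₁ F₂ p := by
  simp only [starNull, mink_comm (nullDir F₂ p) (nullDir F₁ p)]
  abel

theorem starCongr_swap (hS₁ : S₁ p ∈ (F p).nullLine) (hS₂ : S₂ p ∈ (F p).nullLine)
    (h12 : mink (nullDir F₁ p) (nullDir F₂ p) ≠ 0) :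
    starCongr mu F F₂ F₁ S₂ S₁ p = starCongr lam F F₁ F₂ S₁ S₂ p +
      ((tau (S₂ p) - tau (S₁ p)) / mink (nullDir F₁ p) (nullDir F₂ p)) •
        starNull lam mu F F₁ F₂ p := by
  have e : S₂ p = S₁ p + (tau (S₂ p) - tau (S₁ p)) • nullDir F p :=
    ContactElement.sub_eq hS₁ hS₂
  simp only [starCongr, starNull, mink_comm (nullDir F₂ p) (nullDir F₁ p)]
  nth_rewrite 1 [e]
  match_scalars <;> field_simp <;> ring

/-- The direction is literally symmetric, and the two sphere congruences differ by a multiple of it.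
This is why both orders of superposition give the same immersion. -/
theorem lineThrough_star_swap (hS₁ : S₁ p ∈ (F p).nullLine) (hS₂ : S₂ p ∈ (F p).nullLine)
    (h12 : mink (nullDir F₁ p) (nullDir F₂ p) ≠ 0) :
    lineThrough (starCongr mu F F₂ F₁ S₂ S₁ p) (starNull mu lam F F₂ F₁ p) =
      lineThrough (starCongr lam F F₁ F₂ S₁ S₂ p) (starNull lam mu F F₁ F₂ p) := by
  refine lineThrough_congr one_ne_zero ?_ (starCongr_swap hS₁ hS₂ h12)
  rw [one_smul, starNull_swap]

theorem starCongr_eq_starPos {X Y Z : M → V} {s : M → ℝ} {a b c : ℝ}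
    (hX : X p = a • nullDir F p) (hY : Y p = b • nullDir F₁ p) (hZ : Z p = c • nullDir F₂ p)
    (hb : b ≠ 0) (hc : c ≠ 0) (h12 : mink (nullDir F₁ p) (nullDir F₂ p) ≠ 0)
    (hS : S₂ p = S₁ p + s p • X p) :
    starCongr lam F F₁ F₂ S₁ S₂ p = starPos lam S₁ X Y Z s p := by
  have ht : tau (S₂ p) - tau (S₁ p) = s p * a := by
    rw [hS, hX, map_add, map_smul, map_smul, nullDir, tau_nullVec]; simp
  rw [starCongr, starPos, ht, hX, hY, hZ]
  simp only [mink_smul_left, mink_smul_right, smul_smul]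
  congr 2
  field_simp

/-- Once ⟨X, Y⟩ = −1, the field W depends on the lifts only through a factor; comparing coefficients
uses (λ−1)μ = λ. -/
theorem starDir_eq_smul {X Y Z : M → V} {a b c : ℝ}
    (hX : X p = a • nullDir F p) (hY : Y p = b • nullDir F₁ p) (hZ : Z p = c • nullDir F₂ p)
    (hpair : mink (X p) (Y p) = -1) (hc : c ≠ 0) (h0 : lam ≠ 0) (hmu : mu = lam * (mu - 1)) :
    ∃ t : ℝ, t ≠ 0 ∧ starDir lam X Y Z p = t • starNull lam mu F F₁ F₂ p := by
  rw [hX, hY, mink_smul_left, mink_smul_right] at hpair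
  have h01 : mink (nullDir F p) (nullDir F₁ p) ≠ 0 := by
    rintro h; rw [h] at hpair; simp at hpair
  have ha : a ≠ 0 := by rintro rfl; simp at hpair
  have hmu0 : mu ≠ 0 := by rintro rfl; simp [h0] at hmu
  have hb' : b = -1 / (a * mink (nullDir F p) (nullDir F₁ p)) := by field_simp; linarith
  refine ⟨-c / (mu * mink (nullDir F p) (nullDir F₁ p)),
    div_ne_zero (neg_ne_zero.2 hc) (mul_ne_zero hmu0 h01), ?_⟩
  rw [starDir, starNull, hX, hY, hZ]
  simp only [mink_smul_left, mink_smul_right, hb']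
  match_scalars
  · field_simp
  · field_simp
    linear_combination (mink (nullDir F₁ p) (nullDir F₂ p)) * hmu
  · field_simp
    linear_combination (-mink (nullDir F p) (nullDir F₂ p)) * hmu

/-- The line through the sphere congruence of the superposition, in terms of scaled lifts. -/
theorem lineThrough_star_eq {X Y Z : M → V} {s : M → ℝ} {a b c : ℝ}
    (hX : X p = a • nullDir F p) (hY : Y p = b • nullDir F₁ p) (hZ : Z p = c • nullDir F₂ p)
    (hpair : mink (X p) (Y p) = -1) (hc : c ≠ 0) (h0 : lam ≠ 0) (hmu : mu = lam * (mu - 1))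
    (h12 : mink (nullDir F₁ p) (nullDir F₂ p) ≠ 0) (hS : S₂ p = S₁ p + s p • X p) :
    starCongr lam F F₁ F₂ S₁ S₂ p = starPos lam S₁ X Y Z s p ∧
    lineThrough (starCongr lam F F₁ F₂ S₁ S₂ p) (starNull lam mu F F₁ F₂ p) =
      lineThrough (starPos lam S₁ X Y Z s p) (starDir lam X Y Z p) := by
  have hb : b ≠ 0 := by
    rintro rfl
    rw [hY, zero_smul, mink_zero_right] at hpair
    norm_num at hpair
  have e := starCongr_eq_starPos (lam := lam) hX hY hZ hb hc h12 hS
  obtain ⟨t, ht, hW⟩ := starDir_eq_smul hX hY hZ hpair hc h0 hmu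
  refine ⟨e, ?_⟩
  rw [← e]
  exact (lineThrough_congr (t := 0) ht hW (by simp)).symm

end Star

section Global

variable {M : Type*} [TopologicalSpace M] [ChartedSpace ℂ M]
variable {q : QuadraticDifferential M} {F F₁ F₂ Fs : M → ContactElement}
variable {S₁ S₂ : M → V} {m₁ m₂ lam mu : ℝ}


variable [IsManifold 𝓘(ℂ, ℂ) ω M]

theorem exists_local_star (h₁ : IsBianchiDarboux q F F₁)
    (h₂ : IsBianchiDarboux q F F₂) (hne : ∀ p, (F₁ p).normal ≠ (F₂ p).normal)
    (hm₁ : m₁ ≠ 0) (hs₁ : ∀ p U W, spectralForm F F₁ p U W = m₁ * (q.coeff p * U * W).re)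
    (hs₂ : ∀ p U W, spectralForm F F₂ p U W = m₂ * (q.coeff p * U * W).re)
    (hS₁ : IsDarbouxCongruence q F F₁ S₁) (hS₂ : IsDarbouxCongruence q F F₂ S₂)
    (h0 : lam ≠ 0) (hmu : mu = lam * (mu - 1))
    (hFs : ∀ p, (Fs p).nullLine =
      lineThrough (starCongr lam F F₁ F₂ S₁ S₂ p) (starNull lam mu F F₁ F₂ p)) (p₀ : M) :
    ∃ U X Y Z s, p₀ ∈ U ∧ Configuration q F F₁ F₂ S₁ m₁ m₂ U X Y Z s ∧
      ∀ p ∈ U, starCongr lam F F₁ F₂ S₁ S₂ p = starPos lam S₁ X Y Z s p ∧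
        (Fs p).nullLine = lineThrough (starPos lam S₁ X Y Z s p) (starDir lam X Y Z p) := by
  obtain ⟨U, X, Y, Z, s, hp, C, hS⟩ :=
    exists_configuration h₁ h₂ hne hm₁ hs₁ hs₂ hS₁ hS₂ p₀
  refine ⟨U, X, Y, Z, s, hp, C, fun p hp => ?_⟩
  obtain ⟨a, -, hX⟩ := C.direction_X p hp
  obtain ⟨b, -, hY⟩ := C.direction_Y p hp
  obtain ⟨c, hc, hZ⟩ := C.direction_Z p hp
  obtain ⟨κ, L⟩ := C.lift p hp
  rw [hFs]
  exact lineThrough_star_eq hX hY hZ L.pair hc.ne' h0 hmu (mink_nullDir_neg (hne p)).ne (hS p hp)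

end Global

/-! ### Pseudo-orthonormal frames and their connection forms. -/

/-- The columns of `A` are a pseudo-orthonormal frame. -/
def Aff.IsOrthonormal (A : Aff) : Prop := A.mat.transpose * gram * A.mat = gram

theorem Aff.isOrthonormal_iff {A : Aff} :
    A.IsOrthonormal ↔ ∀ i j, mink (A.col i) (A.col j) = gram i j := by
  have key : ∀ i j, (A.mat.transpose * gram * A.mat) i j = mink (A.col i) (A.col j) := by
    intro i j
    simp [Matrix.mul_apply, Fin.sum_univ_four, gram, mink, Aff.col]
    ring
  constructor
  · intro h i j
    rw [← key, show A.mat.transpose * gram * A.mat = gram from h]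
  · intro h
    ext i j
    rw [key, h]

theorem gram_mul_gram : gram * gram = 1 := by
  ext i j
  fin_cases i <;> fin_cases j <;> simp [gram, Matrix.mul_apply, Fin.sum_univ_four]

theorem gram_mulVec (x : V) : gram.mulVec x = ![-x 3, x 1, x 2, -x 0] := by
  ext i
  fin_cases i <;> simp [gram, Matrix.mulVec, dotProduct, Fin.sum_univ_four]

theorem Aff.IsOrthonormal.inv_eq {A : Aff} (h : A.IsOrthonormal) :
    A.mat⁻¹ = gram * A.mat.transpose * gram := by
  apply Matrix.inv_eq_left_inv
  rw [Matrix.mul_assoc, Matrix.mul_assoc, ← Matrix.mul_assoc A.mat.transpose,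
    show A.mat.transpose * gram * A.mat = gram from h, gram_mul_gram]

/-- Coordinates with respect to a pseudo-orthonormal frame. -/
theorem Aff.IsOrthonormal.inv_mulVec {A : Aff} (h : A.IsOrthonormal) (x : V) :
    A.mat⁻¹.mulVec x =
      ![-mink (A.col 3) x, mink (A.col 1) x, mink (A.col 2) x, -mink (A.col 0) x] := by
  rw [h.inv_eq, ← Matrix.mulVec_mulVec, ← Matrix.mulVec_mulVec, gram_mulVec, gram_mulVec]
  ext i
  fin_cases i <;> simp [Matrix.mulVec, dotProduct, Fin.sum_univ_four, mink, Aff.col] <;> ring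

theorem Aff.mulVec_eq (A : Aff) (v : V) :
    A.mat.mulVec v = v 0 • A.col 0 + v 1 • A.col 1 + v 2 • A.col 2 + v 3 • A.col 3 := by
  ext i
  simp [Matrix.mulVec, dotProduct, Fin.sum_univ_four, Aff.col]
  ring

theorem Aff.IsOrthonormal.isUnit_det {A : Aff} (h : A.IsOrthonormal) : IsUnit A.mat.det := by
  have e : (gram * A.mat.transpose * gram) * A.mat = 1 := by
    rw [Matrix.mul_assoc, Matrix.mul_assoc, ← Matrix.mul_assoc A.mat.transpose,
      show A.mat.transpose * gram * A.mat = gram from h, gram_mul_gram]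
  exact Matrix.isUnit_det_of_left_inverse e

theorem Aff.IsOrthonormal.expansion {A : Aff} (h : A.IsOrthonormal) (x : V) :
    x = -mink (A.col 3) x • A.col 0 + mink (A.col 1) x • A.col 1 + mink (A.col 2) x • A.col 2 +
      -mink (A.col 0) x • A.col 3 := by
  have e : A.mat.mulVec (A.mat⁻¹.mulVec x) = x := by
    rw [Matrix.mulVec_mulVec, Matrix.mul_nonsing_inv _ h.isUnit_det, Matrix.one_mulVec]
  rw [h.inv_mulVec, Aff.mulVec_eq] at e
  exact e.symm

/-- The scalar product in coordinates with respect to a pseudo-orthonormal frame. -/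
theorem Aff.IsOrthonormal.mink_eq {A : Aff} (h : A.IsOrthonormal) (x y : V) :
    mink x y = -(mink (A.col 3) x * mink (A.col 0) y + mink (A.col 0) x * mink (A.col 3) y) +
      mink (A.col 1) x * mink (A.col 1) y + mink (A.col 2) x * mink (A.col 2) y := by
  conv_lhs => rw [h.expansion y]
  simp only [mink_add_right, mink_smul_right]
  simp only [mink_comm x]
  ring

section Framings

variable {M : Type*} [TopologicalSpace M] [ChartedSpace ℂ M]

theorem smoothAt_col {A : M → Aff} {p : M} (h : ∀ i j, SmoothAt (fun x => (A x).mat i j) p)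
    (j : Fin 4) : SmoothAt (fun x => (A x).col j) p :=
  smoothAt_pi fun i => h i j

/-- The dual frame of (a₁, a₂, a₃, a₄) is given by pairing with −a₄, a₂, a₃, −a₁. -/
theorem conn_eq {A : M → Aff} {p : M} (h : ∀ i j, SmoothAt (fun x => (A x).mat i j) p)
    (hA : (A p).IsOrthonormal) (T : ℂ) (i j : Fin 4) : conn A p T i j =
      ![-mink ((A p).col 3) (diff (fun x => (A x).col j) p T),
        mink ((A p).col 1) (diff (fun x => (A x).col j) p T),
        mink ((A p).col 2) (diff (fun x => (A x).col j) p T),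
        -mink ((A p).col 0) (diff (fun x => (A x).col j) p T)] i := by
  rw [← hA.inv_mulVec]
  simp only [conn, Matrix.mul_apply, Matrix.mulVec, dotProduct, Matrix.of_apply]
  refine Finset.sum_congr rfl fun k _ => ?_
  rw [← diff_apply (smoothAt_col h j) k]
  rfl

theorem connPos_eq {A : M → Aff} {p : M} (hA : (A p).IsOrthonormal) (T : ℂ) : connPos A p T =
      ![-mink ((A p).col 3) (diff (fun x => (A x).pos) p T),
        mink ((A p).col 1) (diff (fun x => (A x).pos) p T),
        mink ((A p).col 2) (diff (fun x => (A x).pos) p T),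
        -mink ((A p).col 0) (diff (fun x => (A x).pos) p T)] := by
  rw [connPos, hA.inv_mulVec]

/-- The connection form is skew with respect to the Lorentz scalar product. -/
theorem mink_col_diff_col {A : M → Aff} {p : M}
    (h : ∀ i j, SmoothAt (fun x => (A x).mat i j) p)
    (hA : ∀ᶠ x in nhds p, (A x).IsOrthonormal) (T : ℂ) (i j : Fin 4) :
    mink ((A p).col i) (diff (fun x => (A x).col j) p T) =
      -mink ((A p).col j) (diff (fun x => (A x).col i) p T) := by
  have h1 : ∀ᶠ x in nhds p, mink ((A x).col i) ((A x).col j) = gram i j := by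
    filter_upwards [hA] with x hx
    exact Aff.isOrthonormal_iff.1 hx i j
  have h2 := diff_eq_zero_of_eventually_const h1 T
  rw [diff_mink (smoothAt_col h i) (smoothAt_col h j),
    mink_comm (diff (fun x => (A x).col i) p T)] at h2
  linarith

variable {q : QuadraticDifferential M} {F G : M → ContactElement} {U : Set M} {A : M → Aff}

theorem ContactElement.nullLine_eq {c : ContactElement} {x y : V} {a : ℝ} (ha : a ≠ 0)
    (hx : x ∈ c.nullLine) (hy : y = a • nullVec c.normal) : c.nullLine = lineThrough x y := by
  obtain ⟨t, rfl⟩ := hx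
  exact (lineThrough_congr ha hy rfl).symm

/-- A pseudo-orthonormal frame whose null directions are scaled lifts of a Bianchi-Darboux pair is
a curved flat framing. -/
theorem isCurvedFlatFraming_of_lift (hU : IsOpen U) {m : ℝ}
    (hpos : ∀ p ∈ U, SmoothAt (fun x => (A x).pos) p)
    (hmat : ∀ p ∈ U, ∀ i j, SmoothAt (fun x => (A x).mat i j) p)
    (hA : ∀ p ∈ U, (A p).IsLaguerre)
    (hF : ∀ p ∈ U, (F p).nullLine = lineThrough (A p).pos ((A p).col 0))
    (hG : ∀ p ∈ U, (G p).nullLine = lineThrough (A p).pos ((A p).col 3))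
    (hdF : ∀ p ∈ U, ∀ T, mink (diff (fun x => (A x).pos) p T) ((A p).col 0) = 0)
    (hdG : ∀ p ∈ U, ∀ T, mink (diff (fun x => (A x).pos) p T) ((A p).col 3) = 0)
    (hL : ∀ p ∈ U, ∃ κ, LiftAt (q.coeff p) m κ ((A p).col 0) ((A p).col 3)
      (diff (fun x => (A x).col 0) p) (diff (fun x => (A x).col 3) p)) :
    IsCurvedFlatFraming F G U A where
  smooth_pos := smoothOn_of_smoothAt hpos
  smooth_mat i j := smoothOn_of_smoothAt fun p hp => hmat p hp i j
  laguerre := hA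
  tangent_one p hp T := by
    rw [connPos_eq (hA p hp).1]
    simp [mink_comm _ (diff (fun x => (A x).pos) p T), hdG p hp]
  tangent_four p hp T := by
    rw [connPos_eq (hA p hp).1]
    simp [mink_comm _ (diff (fun x => (A x).pos) p T), hdF p hp]
  flat p hp T W := by
    obtain ⟨κ, L⟩ := hL p hp
    have hO : (A p).IsOrthonormal := (hA p hp).1
    have hκ := L.pos.ne'
    have e := conn_eq (hmat p hp) hO
    have sk := mink_col_diff_col (hmat p hp)
      (Filter.eventually_of_mem (hU.mem_nhds hp) fun x hx => (hA x hx).1)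
    have hB : ∀ T, mPart (conn A p T) =
        !![0, mink ((A p).col 1) (diff (fun x => (A x).col 3) p T),
            mink ((A p).col 2) (diff (fun x => (A x).col 3) p T), 0;
          mink ((A p).col 1) (diff (fun x => (A x).col 0) p T), 0, 0,
            mink ((A p).col 1) (diff (fun x => (A x).col 3) p T);
          mink ((A p).col 2) (diff (fun x => (A x).col 0) p T), 0, 0,
            mink ((A p).col 2) (diff (fun x => (A x).col 3) p T);
          0, mink ((A p).col 1) (diff (fun x => (A x).col 0) p T),
            mink ((A p).col 2) (diff (fun x => (A x).col 0) p T), 0] := by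
      intro T
      ext i j
      fin_cases i <;> fin_cases j <;>
        simp [mPart, e, sk T 3 1, sk T 3 2, sk T 0 1, sk T 0 2]
    have symmetric : ∀ {D E : ℂ →L[ℝ] V}, (∀ T, mink (D T) ((A p).col 0) = 0) →
        (∀ T, mink (E T) ((A p).col 0) = 0) → ∀ T W, mink (D T) (E W) =
        mink ((A p).col 1) (D T) * mink ((A p).col 1) (E W) +
        mink ((A p).col 2) (D T) * mink ((A p).col 2) (E W) := by
      intro D E hD hE T W
      rw [hO.mink_eq, mink_comm ((A p).col 0) (D T), hD, mink_comm ((A p).col 0) (E W), hE]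
      ring
    have cross : ∀ i T, κ * mink ((A p).col i) (diff (fun x => (A x).col 3) p T) =
        m * (((starRingEnd ℂ) (q.coeff p * T)).re *
            mink ((A p).col i) (diff (fun x => (A x).col 0) p 1) +
          ((starRingEnd ℂ) (q.coeff p * T)).im *
            mink ((A p).col i) (diff (fun x => (A x).col 0) p Complex.I)) := by
      intro i T
      rw [← mink_smul_right, L.right_eq, clm_complex_apply (diff (fun x => (A x).col 0) p),
        mink_smul_right, mink_add_right, mink_smul_right, mink_smul_right]
    have direct : ∀ i (T : ℂ), mink ((A p).col i) (diff (fun x => (A x).col 0) p T) =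
        T.re * mink ((A p).col i) (diff (fun x => (A x).col 0) p 1) +
          T.im * mink ((A p).col i) (diff (fun x => (A x).col 0) p Complex.I) := by
      intro i T
      rw [clm_complex_apply (diff (fun x => (A x).col 0) p) T, mink_add_right, mink_smul_right,
        mink_smul_right]
    have f1 := fun T W => (symmetric L.right_left L.left_left T W).symm.trans (L.spectral T W)
    -- Flatness consists of the symmetry of the spectral form and this identity, the vanishing of
    -- the mixed area form of dX and dY. It holds because dY is dX composed with an antilinear,
    -- hence trace-free, map of the plane.
    have f4 : mink ((A p).col 1) (diff (fun x => (A x).col 0) p T) *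
          mink ((A p).col 2) (diff (fun x => (A x).col 3) p W) +
        mink ((A p).col 1) (diff (fun x => (A x).col 3) p T) *
          mink ((A p).col 2) (diff (fun x => (A x).col 0) p W) =
        mink ((A p).col 1) (diff (fun x => (A x).col 0) p W) *
          mink ((A p).col 2) (diff (fun x => (A x).col 3) p T) +
        mink ((A p).col 1) (diff (fun x => (A x).col 3) p W) *
          mink ((A p).col 2) (diff (fun x => (A x).col 0) p T) := by
      apply mul_left_cancel₀ hκ
      have c1 := cross 1 T
      have c2 := cross 2 T
      have c3 := cross 1 W
      have c4 := cross 2 W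
      have d1 := direct 1 T
      have d2 := direct 2 T
      have d3 := direct 1 W
      have d4 := direct 2 W
      simp only [map_mul, Complex.mul_re, Complex.mul_im, Complex.conj_re, Complex.conj_im]
        at c1 c2 c3 c4
      rw [d1, d2, d3, d4]
      set x₁ := mink ((A p).col 1) (diff (fun x => (A x).col 0) p 1)
      set x₂ := mink ((A p).col 2) (diff (fun x => (A x).col 0) p 1)
      set y₁ := mink ((A p).col 1) (diff (fun x => (A x).col 0) p Complex.I)
      set y₂ := mink ((A p).col 2) (diff (fun x => (A x).col 0) p Complex.I)
      linear_combination (T.re * x₁ + T.im * y₁) * c4 + (W.re * x₂ + W.im * y₂) * c1 -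
        (W.re * x₁ + W.im * y₁) * c2 - (T.re * x₂ + T.im * y₂) * c3
    rw [hB, hB]
    have g1 := f1 T W
    have g1' := f1 W T
    have hsym : (q.coeff p * T * W).re = (q.coeff p * W * T).re := by ring_nf
    ext i j
    fin_cases i <;> fin_cases j <;> simp [Matrix.mul_apply, Fin.sum_univ_four]
    all_goals first
      | linear_combination g1 - g1' + m * hsym
      | linear_combination f4
      | linear_combination -f4
      | linear_combination g1' - g1 - m * hsym
      | ring1
  normalized p hp T := by
    obtain ⟨κ, L⟩ := hL p hp
    rw [conn_eq (hmat p hp) (hA p hp).1]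
    simp [mink_comm ((A p).col 3), L.left_right]
  first_envelope := hF
  second_envelope := hG

end Framings

/-! ### Construction of frames and the gauge g(s, v). -/

/-- `a`, `b` complete the null vectors `X`, `Y` to a positively oriented pseudo-orthonormal
frame. -/
structure IsFrame (X a b Y : V) : Prop where
  null_X : mink X X = 0
  null_Y : mink Y Y = 0
  pair : mink X Y = -1
  aX : mink a X = 0
  aY : mink a Y = 0
  bX : mink b X = 0
  bY : mink b Y = 0
  aa : mink a a = 1
  bb : mink b b = 1
  ab : mink a b = 0
  det : det4 X a b Y = 1

/-- The affine map with given position vector and columns. -/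
def frame (S X a b Y : V) : Aff := ⟨S, (Matrix.of ![X, a, b, Y]).transpose⟩

section FrameColumns

variable (S X a b Y : V)

theorem frame_col_zero : (frame S X a b Y).col 0 = X := rfl
theorem frame_col_one : (frame S X a b Y).col 1 = a := rfl
theorem frame_col_two : (frame S X a b Y).col 2 = b := rfl
theorem frame_col_three : (frame S X a b Y).col 3 = Y := rfl

end FrameColumns

theorem IsFrame.isOrthonormal {X a b Y : V} (h : IsFrame X a b Y) (S : V) :
    (frame S X a b Y).IsOrthonormal := by
  refine Aff.isOrthonormal_iff.2 fun i j => ?_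
  obtain ⟨h1, h2, h3, h4, h5, h6, h7, h8, h9, h10, -⟩ := h
  fin_cases i <;> fin_cases j <;>
    simp only [gram, frame_col_zero, frame_col_one, frame_col_two, frame_col_three,
      Fin.zero_eta, Fin.mk_one, Fin.reduceFinMk, Matrix.of_apply, Matrix.cons_val] <;>
    first | assumption | (rw [mink_comm]; assumption)

theorem IsFrame.isLaguerre {X a b Y : V} (h : IsFrame X a b Y) (hX : 0 < tau X) (S : V) :
    (frame S X a b Y).IsLaguerre := by
  refine ⟨h.isOrthonormal S, ?_, hX⟩
  rw [frame, Matrix.det_transpose]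
  exact h.det

/-- Two orthonormal vectors orthogonal to `X` are corrected by multiples of `X` to a frame. -/
theorem IsFrame.of_first {X Y b₁ b₂ : V} (hX : mink X X = 0) (hY : mink Y Y = 0)
    (hXY : mink X Y = -1) (h1X : mink b₁ X = 0) (h2X : mink b₂ X = 0) (h11 : mink b₁ b₁ = 1)
    (h22 : mink b₂ b₂ = 1) (h12 : mink b₁ b₂ = 0) (hdet : det4 X b₁ b₂ Y = 1) :
    IsFrame X (b₁ + mink b₁ Y • X) (b₂ + mink b₂ Y • X) Y where
  null_X := hX
  null_Y := hY
  pair := hXY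
  aX := by simp [mink_add_left, mink_smul_left, h1X, hX]
  aY := by simp [mink_add_left, mink_smul_left, hXY]
  bX := by simp [mink_add_left, mink_smul_left, h2X, hX]
  bY := by simp [mink_add_left, mink_smul_left, hXY]
  aa := by
    simp [mink_add_left, mink_smul_left, mink_add_right, mink_smul_right, h1X, hX, h11,
      mink_comm X b₁]
  bb := by
    simp [mink_add_left, mink_smul_left, mink_add_right, mink_smul_right, h2X, hX, h22,
      mink_comm X b₂]
  ab := by
    simp [mink_add_left, mink_smul_left, mink_add_right, mink_smul_right, h1X, h2X, hX, h12,
      mink_comm X b₂]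
  det := by
    rw [← hdet]
    simp only [det4_eq, Pi.add_apply, Pi.smul_apply, smul_eq_mul]
    ring

/-- The frame obtained from `A = frame S X a b Y` by the gauge `g(s, v)`. -/
theorem IsFrame.gauge {X a b Y Z : V} (h : IsFrame X a b Y) (hZ : mink Z Z = 0)
    (hw : mink X Z ≠ 0) :
    IsFrame ((-mink X Z)⁻¹ • X) (a + (mink a Z * (-mink X Z)⁻¹) • X)
      (b + (mink b Z * (-mink X Z)⁻¹) • X) Z where
  null_X := by simp [mink_smul_left, mink_smul_right, mink_neg_left, mink_neg_right, h.null_X]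
  null_Y := hZ
  pair := by rw [mink_smul_left]; field_simp
  aX := by simp [mink_add_left, mink_smul_left, mink_smul_right, mink_neg_left, mink_neg_right, h.null_X, h.aX]
  aY := by rw [mink_add_left, mink_smul_left]; field_simp; ring
  bX := by simp [mink_add_left, mink_smul_left, mink_smul_right, mink_neg_left, mink_neg_right, h.null_X, h.bX]
  bY := by rw [mink_add_left, mink_smul_left]; field_simp; ring
  aa := by
    simp [mink_add_left, mink_smul_left, mink_add_right, mink_smul_right,
      mink_neg_left, mink_neg_right, h.aX, h.null_X, h.aa,
      mink_comm X a]
  bb := by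
    simp [mink_add_left, mink_smul_left, mink_add_right, mink_smul_right,
      mink_neg_left, mink_neg_right, h.bX, h.null_X, h.bb,
      mink_comm X b]
  ab := by
    simp [mink_add_left, mink_smul_left, mink_add_right, mink_smul_right,
      mink_neg_left, mink_neg_right, h.aX, h.bX, h.null_X,
      h.ab, mink_comm X b]
  det := by
    have hO := h.isOrthonormal 0
    have e := hO.expansion Z
    rw [frame_col_zero, frame_col_one, frame_col_two, frame_col_three] at e
    have hd := h.det
    have key : ∀ (r t t' α β γ δ : ℝ), det4 (r • X) (a + t • X) (b + t' • X)
        (α • X + β • a + γ • b + δ • Y) = r * δ * det4 X a b Y := by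
      intro r t t' α β γ δ
      simp only [det4_eq, Pi.add_apply, Pi.smul_apply, smul_eq_mul]
      ring
    refine (congrArg (det4 _ _ _) e).trans ?_
    rw [key, hd, inv_mul_cancel₀ (neg_ne_zero.2 hw), one_mul]

section Framings

variable {M : Type*} [TopologicalSpace M] [ChartedSpace ℂ M]

/-- Where X¹ ≠ 0, or X⁴ ≠ 0, explicit orthonormal vectors orthogonal to X depend smoothly on X;
adding multiples of X makes them orthogonal to Y as well. -/
theorem exists_frame {U : Set M} {X Y : M → V} (hU : IsOpen U) (sX : ∀ p ∈ U, SmoothAt X p)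
    (sY : ∀ p ∈ U, SmoothAt Y p) (hX : ∀ p ∈ U, mink (X p) (X p) = 0)
    (hY : ∀ p ∈ U, mink (Y p) (Y p) = 0) (hXY : ∀ p ∈ U, mink (X p) (Y p) = -1) {p₀ : M}
    (hp₀ : p₀ ∈ U) : ∃ (U' : Set M) (a b : M → V), p₀ ∈ U' ∧ U' ⊆ U ∧ IsOpen U' ∧
      ∀ p ∈ U', SmoothAt a p ∧ SmoothAt b p ∧ IsFrame (X p) (a p) (b p) (Y p) := by
  have hX0 : X p₀ ≠ 0 := by
    intro h
    have := hXY p₀ hp₀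
    rw [h, mink_zero_left] at this
    norm_num at this
  have smooth4 : ∀ {f₀ f₁ f₂ f₃ : M → ℝ} {p : M}, SmoothAt f₀ p → SmoothAt f₁ p →
      SmoothAt f₂ p → SmoothAt f₃ p → SmoothAt (fun x => (![f₀ x, f₁ x, f₂ x, f₃ x] : V)) p := by
    intro f₀ f₁ f₂ f₃ p h₀ h₁ h₂ h₃
    refine smoothAt_pi fun i => ?_
    fin_cases i <;> assumption
  by_cases h0 : X p₀ 0 = 0
  · have h3 : X p₀ 3 ≠ 0 := by
      intro h
      have e := tau_ne_zero_of_null (hX p₀ hp₀) hX0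
      rw [tau_apply, h0, h] at e
      simp at e
    have hev : ∀ᶠ x in nhds p₀, X x 3 ≠ 0 ∧ x ∈ U :=
      (((sX p₀ hp₀).apply 3).continuousAt.eventually_ne h3).and (hU.mem_nhds hp₀)
    obtain ⟨U', hsub, hU', hpU'⟩ := mem_nhds_iff.1 hev
    -- The order of the two vectors is reversed compared with the other case, to keep the
    -- determinant equal to +1.
    refine ⟨U', fun x => ![X x 2 / X x 3, 0, 1, 0] + mink ![X x 2 / X x 3, 0, 1, 0] (Y x) • X x,
      fun x => ![X x 1 / X x 3, 1, 0, 0] + mink ![X x 1 / X x 3, 1, 0, 0] (Y x) • X x, hpU',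
      fun x hx => (hsub hx).2, hU', fun p hp => ?_⟩
    obtain ⟨hp3, hpU⟩ := hsub hp
    have s1 := smooth4 (((sX p hpU).apply 2).div ((sX p hpU).apply 3) hp3) (smoothAt_const 0 p)
      (smoothAt_const 1 p) (smoothAt_const 0 p)
    have s2 := smooth4 (((sX p hpU).apply 1).div ((sX p hpU).apply 3) hp3) (smoothAt_const 1 p)
      (smoothAt_const 0 p) (smoothAt_const 0 p)
    have eX := hX p hpU
    have eXY := hXY p hpU
    refine ⟨s1.add ((s1.mink (sY p hpU)).smul (sX p hpU)),
      s2.add ((s2.mink (sY p hpU)).smul (sX p hpU)),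
      IsFrame.of_first eX (hY p hpU) eXY ?_ ?_ ?_ ?_ ?_ ?_⟩
    · simp [mink]; field_simp; ring
    · simp [mink]; field_simp; ring
    · simp [mink]
    · simp [mink]
    · simp [mink]
    · simp only [mink] at eX eXY
      simp [det4_eq]
      field_simp
      linear_combination (-X p 3) * eXY + Y p 3 * eX
  · have hev : ∀ᶠ x in nhds p₀, X x 0 ≠ 0 ∧ x ∈ U :=
      (((sX p₀ hp₀).apply 0).continuousAt.eventually_ne h0).and (hU.mem_nhds hp₀)
    obtain ⟨U', hsub, hU', hpU'⟩ := mem_nhds_iff.1 hev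
    refine ⟨U', fun x => ![0, 1, 0, X x 1 / X x 0] + mink ![0, 1, 0, X x 1 / X x 0] (Y x) • X x,
      fun x => ![0, 0, 1, X x 2 / X x 0] + mink ![0, 0, 1, X x 2 / X x 0] (Y x) • X x, hpU',
      fun x hx => (hsub hx).2, hU', fun p hp => ?_⟩
    obtain ⟨hp3, hpU⟩ := hsub hp
    have s1 := smooth4 (smoothAt_const 0 p) (smoothAt_const 1 p) (smoothAt_const 0 p)
      (((sX p hpU).apply 1).div ((sX p hpU).apply 0) hp3)
    have s2 := smooth4 (smoothAt_const 0 p) (smoothAt_const 0 p) (smoothAt_const 1 p)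
      (((sX p hpU).apply 2).div ((sX p hpU).apply 0) hp3)
    have eX := hX p hpU
    have eXY := hXY p hpU
    refine ⟨s1.add ((s1.mink (sY p hpU)).smul (sX p hpU)),
      s2.add ((s2.mink (sY p hpU)).smul (sX p hpU)),
      IsFrame.of_first eX (hY p hpU) eXY ?_ ?_ ?_ ?_ ?_ ?_⟩
    · simp [mink]; field_simp; ring
    · simp [mink]; field_simp; ring
    · simp [mink]
    · simp [mink]
    · simp [mink]
    · simp only [mink] at eX eXY
      simp [det4_eq]
      field_simp
      linear_combination (-X p 0) * eXY + Y p 0 * eX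

end Framings

/-- The vector fed into the gauge consists of the coordinates of Z in the frame, so the last column
becomes Z. -/
theorem IsFrame.mul_gaugePlus {X a b Y : V} (h : IsFrame X a b Y) (S Z : V) (s : ℝ) :
    (frame S X a b Y).mul (gaugePlus s ![-mink Y Z, mink a Z, mink b Z, -mink X Z]) =
      frame (S + s • X) ((-mink X Z)⁻¹ • X) (a + (mink a Z * (-mink X Z)⁻¹) • X)
        (b + (mink b Z * (-mink X Z)⁻¹) • X) Z := by
  have e := (h.isOrthonormal 0).expansion Z
  rw [frame_col_zero, frame_col_one, frame_col_two, frame_col_three] at e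
  simp only [Aff.mul, Aff.mk.injEq, frame]
  constructor
  · ext i
    simp [gaugePlus, Matrix.mulVec, dotProduct, Fin.sum_univ_four]
    ring
  · ext i j
    have ei := congrFun e i
    fin_cases j <;> simp [gaugePlus, Matrix.mul_apply, Fin.sum_univ_four]
    · ring
    · ring
    · ring
    · simp at ei
      linarith

/-! ### Existence of superposition data. -/

section Framings

variable {M : Type*} [TopologicalSpace M] [ChartedSpace ℂ M]

theorem smoothAt_frame {S X a b Y : M → V} {p : M} (hX : SmoothAt X p) (ha : SmoothAt a p)
    (hb : SmoothAt b p) (hY : SmoothAt Y p) (i j : Fin 4) :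
    SmoothAt (fun x => (frame (S x) (X x) (a x) (b x) (Y x)).mat i j) p := by
  fin_cases j
  · exact hX.apply i
  · exact ha.apply i
  · exact hb.apply i
  · exact hY.apply i

variable {q : QuadraticDifferential M} {F F₁ F₂ : M → ContactElement}
variable {S : M → V} {m₁ m₂ lam : ℝ} {U : Set M} {X Y Z : M → V} {s : M → ℝ}

namespace Configuration

theorem mono (C : Configuration q F F₁ F₂ S m₁ m₂ U X Y Z s) {U' : Set M} (hU' : IsOpen U')
    (h : U' ⊆ U) : Configuration q F F₁ F₂ S m₁ m₂ U' X Y Z s where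
  isOpen := hU'
  smooth_X p hp := C.smooth_X p (h hp)
  smooth_Y p hp := C.smooth_Y p (h hp)
  smooth_Z p hp := C.smooth_Z p (h hp)
  smooth_s p hp := C.smooth_s p (h hp)
  smooth_S p hp := C.smooth_S p (h hp)
  direction_X p hp := C.direction_X p (h hp)
  direction_Y p hp := C.direction_Y p (h hp)
  direction_Z p hp := C.direction_Z p (h hp)
  lift p hp := C.lift p (h hp)
  neg_XZ p hp := C.neg_XZ p (h hp)
  neg_YZ p hp := C.neg_YZ p (h hp)
  null_Z p hp := C.null_Z p (h hp)
  diff_Z p hp := C.diff_Z p (h hp)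
  mem_F p hp := C.mem_F p (h hp)
  mem_F₁ p hp := C.mem_F₁ p (h hp)
  mem_F₂ p hp := C.mem_F₂ p (h hp)
  diff_S_X p hp := C.diff_S_X p (h hp)
  diff_S_Y p hp := C.diff_S_Y p (h hp)
  diff_r p hp := C.diff_r p (h hp)

variable {a b : M → V}

theorem tau_X_pos (C : Configuration q F F₁ F₂ S m₁ m₂ U X Y Z s) {p : M} (hp : p ∈ U) :
    0 < tau (X p) ∧ X p = tau (X p) • nullDir F p := by
  obtain ⟨r, hr, h⟩ := C.direction_X p hp
  have : tau (X p) = r := by rw [h, map_smul, nullDir, tau_nullVec]; simp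
  rw [this]
  exact ⟨hr, h⟩

theorem tau_Z_pos (C : Configuration q F F₁ F₂ S m₁ m₂ U X Y Z s) {p : M} (hp : p ∈ U) :
    0 < tau (Z p) ∧ Z p = tau (Z p) • nullDir F₂ p := by
  obtain ⟨r, hr, h⟩ := C.direction_Z p hp
  have : tau (Z p) = r := by rw [h, map_smul, nullDir, tau_nullVec]; simp
  rw [this]
  exact ⟨hr, h⟩

theorem framing_one (C : Configuration q F F₁ F₂ S m₁ m₂ U X Y Z s)
    (sa : ∀ p ∈ U, SmoothAt a p) (sb : ∀ p ∈ U, SmoothAt b p)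
    (hf : ∀ p ∈ U, IsFrame (X p) (a p) (b p) (Y p)) :
    IsCurvedFlatFraming F F₁ U (fun p => frame (S p) (X p) (a p) (b p) (Y p)) := by
  refine isCurvedFlatFraming_of_lift (q := q) (m := m₁) C.isOpen C.smooth_S (fun p hp =>
    smoothAt_frame (C.smooth_X p hp) (sa p hp) (sb p hp) (C.smooth_Y p hp))
    (fun p hp => (hf p hp).isLaguerre (C.tau_X_pos hp).1 _) ?_ ?_ C.diff_S_X C.diff_S_Y C.lift
  · intro p hp
    obtain ⟨r, hr, h⟩ := C.direction_X p hp
    exact ContactElement.nullLine_eq hr.ne' (C.mem_F p hp) h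
  · intro p hp
    obtain ⟨r, hr, h⟩ := C.direction_Y p hp
    exact ContactElement.nullLine_eq hr.ne' (C.mem_F₁ p hp) h

/-- The lift of F belonging to Z is X/w with w = −⟨X, Z⟩: this gives pairing −1, and ⟨X, dZ⟩ = 0
gives the normalization of the framing. -/
theorem framing_two (C : Configuration q F F₁ F₂ S m₁ m₂ U X Y Z s)
    (hF : IsLIsothermic q F) (hF₂ : IsLIsothermic q F₂)
    (hs₂ : ∀ p T W, spectralForm F F₂ p T W = m₂ * (q.coeff p * T * W).re)
    (sa : ∀ p ∈ U, SmoothAt a p) (sb : ∀ p ∈ U, SmoothAt b p)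
    (hf : ∀ p ∈ U, IsFrame (X p) (a p) (b p) (Y p)) :
    IsCurvedFlatFraming F F₂ U (fun p => frame (S p + s p • X p) ((-mink (X p) (Z p))⁻¹ • X p)
      (a p + (mink (a p) (Z p) * (-mink (X p) (Z p))⁻¹) • X p)
      (b p + (mink (b p) (Z p) * (-mink (X p) (Z p))⁻¹) • X p) (Z p)) := by
  have hw : ∀ p ∈ U, 0 < -mink (X p) (Z p) := fun p hp => neg_pos.2 (C.neg_XZ p hp)
  have swi : ∀ p ∈ U, SmoothAt (fun x => (-mink (X x) (Z x))⁻¹) p := fun p hp =>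
    (C.smooth_w hp).inv (hw p hp).ne'
  have sS : ∀ p ∈ U, SmoothAt (fun x => S x + s x • X x) p := fun p hp =>
    (C.smooth_S p hp).add ((C.smooth_s p hp).smul (C.smooth_X p hp))
  have mem : ∀ p ∈ U, S p + s p • X p ∈ (F p).nullLine := fun p hp => by
    obtain ⟨r, -, h⟩ := C.direction_X p hp
    obtain ⟨t, ht⟩ := C.mem_F p hp
    rw [ht, h, smul_smul, nullDir, add_assoc, ← add_smul]
    exact ⟨_, rfl⟩
  refine isCurvedFlatFraming_of_lift (q := q) (m := m₂) C.isOpen sS (fun p hp =>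
    smoothAt_frame ((swi p hp).smul (C.smooth_X p hp))
      ((sa p hp).add ((((sa p hp).mink (C.smooth_Z p hp)).mul (swi p hp)).smul (C.smooth_X p hp)))
      ((sb p hp).add ((((sb p hp).mink (C.smooth_Z p hp)).mul (swi p hp)).smul (C.smooth_X p hp)))
      (C.smooth_Z p hp))
    (fun p hp => ((hf p hp).gauge (C.null_Z p hp) (C.neg_XZ p hp).ne).isLaguerre ?_ _)
    ?_ ?_ ?_ ?_ ?_
  · rw [map_smul]
    exact mul_pos (inv_pos.2 (hw p hp)) (C.tau_X_pos hp).1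
  · intro p hp
    obtain ⟨r, hr, h⟩ := C.direction_X p hp
    refine ContactElement.nullLine_eq (a := (-mink (X p) (Z p))⁻¹ * r)
      (mul_pos (inv_pos.2 (hw p hp)) hr).ne' (mem p hp) ?_
    rw [frame_col_zero, h, smul_smul]
    rfl
  · intro p hp
    obtain ⟨r, hr, h⟩ := C.direction_Z p hp
    exact ContactElement.nullLine_eq hr.ne' (C.mem_F₂ p hp) h
  · intro p hp T
    have e := mink_diff_of_contact hF (sS p hp)
      (Filter.eventually_of_mem (C.isOpen.mem_nhds hp) mem) T
    rw [frame_col_zero, (C.tau_X_pos hp).2, mink_smul_right, mink_smul_right]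
    change _ * (_ * mink (diff (fun x => S x + s x • X x) p T) (nullDir F p)) = 0
    rw [e, mul_zero, mul_zero]
  · intro p hp T
    have e := mink_diff_of_contact hF₂ (sS p hp)
      (Filter.eventually_of_mem (C.isOpen.mem_nhds hp) C.mem_F₂) T
    rw [frame_col_three, (C.tau_Z_pos hp).2, mink_smul_right]
    change _ * mink (diff (fun x => S x + s x • X x) p T) (nullDir F₂ p) = 0
    rw [e, mul_zero]
  · intro p hp
    have sX := C.smooth_X p hp
    have sZ := C.smooth_Z p hp
    refine liftAt_of_scaling (X := fun x => (-mink (X x) (Z x))⁻¹ • X x) (Y := Z) hF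
      hF₂.smooth_normal (hs₂ p) ((swi p hp).mul (sX.clm tau)) (sZ.clm tau) ?_ ?_ ?_ fun T => ?_
    · filter_upwards [C.isOpen.mem_nhds hp] with x hx
      conv_lhs => rw [(C.tau_X_pos hx).2, smul_smul]
      congr 2
      rw [← (C.tau_X_pos hx).2]
    · filter_upwards [C.isOpen.mem_nhds hp] with x hx using (C.tau_Z_pos hx).2
    · filter_upwards [C.isOpen.mem_nhds hp] with x hx
      exact ((hf x hx).gauge (C.null_Z x hx) (C.neg_XZ x hx).ne).pair
    · have h1 : ∀ᶠ x in nhds p, mink ((-mink (X x) (Z x))⁻¹ • X x) (Z x) = -1 := by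
        filter_upwards [C.isOpen.mem_nhds hp] with x hx
        exact ((hf x hx).gauge (C.null_Z x hx) (C.neg_XZ x hx).ne).pair
      have h2 := diff_eq_zero_of_eventually_const h1 T
      rw [diff_mink ((swi p hp).smul sX) sZ, mink_smul_left _ _ (diff Z p T),
        C.mink_X_diff_Z hp, mul_zero, add_zero] at h2
      exact h2

/-- The coordinate vector of a fixed vector would satisfy dv = −α'v. The variation of Z along dY and
X, with factor 1 − λ = m₂/m₁, changes exactly the entries multiplied by λ in α'_λ. -/
theorem superpositionDatum (C : Configuration q F F₁ F₂ S m₁ m₂ U X Y Z s)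
    (hF : IsLIsothermic q F) (hF₂ : IsLIsothermic q F₂)
    (hs₂ : ∀ p T W, spectralForm F F₂ p T W = m₂ * (q.coeff p * T * W).re)
    (hlam : 1 - lam = m₂ / m₁) (h0 : lam ≠ 0)
    (sa : ∀ p ∈ U, SmoothAt a p) (sb : ∀ p ∈ U, SmoothAt b p)
    (hf : ∀ p ∈ U, IsFrame (X p) (a p) (b p) (Y p)) :
    IsSuperpositionDatum F F₁ F₂ U (fun p => frame (S p) (X p) (a p) (b p) (Y p))
      (fun p => frame (S p + s p • X p) ((-mink (X p) (Z p))⁻¹ • X p)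
        (a p + (mink (a p) (Z p) * (-mink (X p) (Z p))⁻¹) • X p)
        (b p + (mink (b p) (Z p) * (-mink (X p) (Z p))⁻¹) • X p) (Z p)) lam s
      (fun p => ![-mink (Y p) (Z p), mink (a p) (Z p), mink (b p) (Z p), -mink (X p) (Z p)]) := by
  have sv : ∀ p ∈ U, SmoothAt (fun p =>
      (![-mink (Y p) (Z p), mink (a p) (Z p), mink (b p) (Z p), -mink (X p) (Z p)] : V)) p := by
    intro p hp
    refine smoothAt_pi fun i => ?_
    have sZ := C.smooth_Z p hp
    fin_cases i
    · exact C.smooth_u hp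
    · exact (sa p hp).mink sZ
    · exact (sb p hp).mink sZ
    · exact C.smooth_w hp
  have smat : ∀ p ∈ U, ∀ i j,
      SmoothAt (fun x => (frame (S x) (X x) (a x) (b x) (Y x)).mat i j) p := fun p hp =>
    smoothAt_frame (C.smooth_X p hp) (sa p hp) (sb p hp) (C.smooth_Y p hp)
  constructor
  · exact C.isOpen
  · exact C.framing_one sa sb hf
  · exact C.framing_two hF hF₂ hs₂ sa sb hf
  · exact smoothOn_of_smoothAt C.smooth_s
  · exact smoothOn_of_smoothAt sv
  · intro p hp
    have e := ((hf p hp).isOrthonormal 0).mink_eq (Z p) (Z p)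
    rw [C.null_Z p hp, frame_col_zero, frame_col_one, frame_col_two, frame_col_three] at e
    have h1 := C.neg_XZ p hp
    have h2 := C.neg_YZ p hp
    refine ⟨?_, ?_⟩
    · simp [mink] at e ⊢
      linarith
    · simp
      linarith
  · intro p hp
    exact ((hf p hp).mul_gaugePlus _ _ _).symm
  · intro p hp T
    obtain ⟨κ, L⟩ := C.lift p hp
    have sZ := C.smooth_Z p hp
    have hO := (hf p hp).isOrthonormal (S p)
    have e : ∀ i j, conn (fun p => frame (S p) (X p) (a p) (b p) (Y p)) p T i j = _ :=
      conn_eq (smat p hp) hO T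
    have sk : ∀ i j, _ := mink_col_diff_col (smat p hp)
      (Filter.eventually_of_mem (C.isOpen.mem_nhds hp) fun x hx =>
        (hf x hx).isOrthonormal (S x)) T
    have k11 : mink (a p) (diff a p T) = -mink (a p) (diff a p T) := sk 1 1
    have k12 : mink (b p) (diff a p T) = -mink (a p) (diff b p T) := sk 2 1
    have k22 : mink (b p) (diff b p T) = -mink (b p) (diff b p T) := sk 2 2
    have k01 : mink (X p) (diff a p T) = -mink (a p) (diff X p T) := sk 0 1
    have k02 : mink (X p) (diff b p T) = -mink (b p) (diff X p T) := sk 0 2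
    have k31 : mink (Y p) (diff a p T) = -mink (a p) (diff Y p T) := sk 3 1
    have k32 : mink (Y p) (diff b p T) = -mink (b p) (diff Y p T) := sk 3 2
    have l00 : mink (X p) (diff X p T) = 0 := by rw [mink_comm, L.left_left]
    have l30 : mink (Y p) (diff X p T) = 0 := by rw [mink_comm, L.left_right]
    have l03 : mink (X p) (diff Y p T) = 0 := by rw [mink_comm, L.right_left]
    have l33 : mink (Y p) (diff Y p T) = 0 := by rw [mink_comm, L.right_right]
    have hZa := hO.mink_eq (diff a p T) (Z p)
    have hZb := hO.mink_eq (diff b p T) (Z p)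
    have hZX := hO.mink_eq (diff X p T) (Z p)
    have hZY := hO.mink_eq (diff Y p T) (Z p)
    rw [frame_col_zero, frame_col_one, frame_col_two, frame_col_three] at hZa hZb hZX hZY
    have row0 : ∀ j, conn (fun p => frame (S p) (X p) (a p) (b p) (Y p)) p T 0 j =
      -mink (Y p) (diff (fun x => (frame (S x) (X x) (a x) (b x) (Y x)).col j) p T) := e 0
    have row1 : ∀ j, conn (fun p => frame (S p) (X p) (a p) (b p) (Y p)) p T 1 j =
      mink (a p) (diff (fun x => (frame (S x) (X x) (a x) (b x) (Y x)).col j) p T) := e 1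
    have row2 : ∀ j, conn (fun p => frame (S p) (X p) (a p) (b p) (Y p)) p T 2 j =
      mink (b p) (diff (fun x => (frame (S x) (X x) (a x) (b x) (Y x)).col j) p T) := e 2
    have row3 : ∀ j, conn (fun p => frame (S p) (X p) (a p) (b p) (Y p)) p T 3 j =
      -mink (X p) (diff (fun x => (frame (S x) (X x) (a x) (b x) (Y x)).col j) p T) := e 3
    have dv : ∀ i, diff (fun p => (![-mink (Y p) (Z p), mink (a p) (Z p), mink (b p) (Z p),
        -mink (X p) (Z p)] : V)) p T i = _ := fun i => (diff_apply (sv p hp) i T).symm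
    have dZ := C.diff_Z p hp T
    rw [← hlam] at dZ
    ext i
    rw [dv]
    fin_cases i
    · change diff (fun x => -mink (Y x) (Z x)) p T = _
      rw [C.diff_u hlam hp]
      simp [deform, row0, frame_col_zero,
        frame_col_one, frame_col_two, frame_col_three]
      rw [l30, l33, k31, k32, hZY, l03, l33]
      ring
    -- The frame contributes −w⟨a, dY⟩ and dZ contributes (1−λ)w⟨a, dY⟩; together they give the
    -- deformed entry −λw⟨a, dY⟩.
    · change diff (fun x => mink (a x) (Z x)) p T = _
      rw [diff_mink (sa p hp) sZ, dZ, mink_smul_right, mink_add_right, mink_smul_right,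
        mink_smul_right, (hf p hp).aX]
      simp [deform, row1, frame_col_zero,
        frame_col_one, frame_col_two, frame_col_three]
      rw [hZa, k31, k01, k12]
      linear_combination mink (a p) (Z p) * k11
    · change diff (fun x => mink (b x) (Z x)) p T = _
      rw [diff_mink (sb p hp) sZ, dZ, mink_smul_right, mink_add_right, mink_smul_right,
        mink_smul_right, (hf p hp).bX]
      simp [deform, row2, frame_col_zero,
        frame_col_one, frame_col_two, frame_col_three]
      rw [hZb, k32, k02, k12]
      linear_combination mink (b p) (Z p) * k22
    · change diff (fun x => -mink (X x) (Z x)) p T = _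
      rw [C.diff_w hp]
      simp [deform, row3, frame_col_zero,
        frame_col_one, frame_col_two, frame_col_three]
      rw [l00, l03, k01, k02, hZX, l00, l30]
      ring
  · intro p hp T
    have hO := (hf p hp).isOrthonormal (S p)
    have e := hO.mink_eq (diff S p T) (Z p)
    rw [frame_col_zero, frame_col_one, frame_col_two, frame_col_three, mink_comm (Y p),
      C.diff_S_Y p hp, mink_comm (X p) (diff S p T), C.diff_S_X p hp] at e
    rw [connPos_eq (A := fun x => frame (S x) (X x) (a x) (b x) (Y x)) hO]
    change diff (fun x => s x * -mink (X x) (Z x)) p T = mink (a p) (Z p) * mink (a p) (diff S p T) +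
      mink (b p) (Z p) * mink (b p) (diff S p T)
    rw [C.diff_r p hp, e]
    ring
  · exact h0
  · intro p hp
    exact neg_ne_zero.2 (C.neg_YZ p hp).ne

theorem exists_superpositionDatum (C : Configuration q F F₁ F₂ S m₁ m₂ U X Y Z s)
    (hF : IsLIsothermic q F) (hF₂ : IsLIsothermic q F₂)
    (hs₂ : ∀ p T W, spectralForm F F₂ p T W = m₂ * (q.coeff p * T * W).re)
    (hlam : 1 - lam = m₂ / m₁) (h0 : lam ≠ 0) {p₀ : M} (hp₀ : p₀ ∈ U) :
    ∃ (U' : Set M) (A₁ A₂ : M → Aff) (s : M → ℝ) (v : M → V),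
      p₀ ∈ U' ∧ IsSuperpositionDatum F F₁ F₂ U' A₁ A₂ lam s v := by
  choose κ L using C.lift
  obtain ⟨U', a, b, hp₀', hsub, hU', hf⟩ := exists_frame C.isOpen C.smooth_X C.smooth_Y
    (fun p hp => (L p hp).null_left) (fun p hp => (L p hp).null_right)
    (fun p hp => (L p hp).pair) hp₀
  exact ⟨U', _, _, s, _, hp₀', (C.mono hU' hsub).superpositionDatum hF hF₂ hs₂ hlam h0
    (fun p hp => (hf p hp).1) (fun p hp => (hf p hp).2.1) (fun p hp => (hf p hp).2.2)⟩

end Configuration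
end Framings

/-! ### Uniqueness of the superposition. -/

/-- Null lines with different directions meet in at most one point. Hence the position vectors of
the framings are determined by the envelopes. -/
theorem ContactElement.eq_of_mem {c d : ContactElement} (h : c.normal ≠ d.normal) {x y : V}
    (hxc : x ∈ c.nullLine) (hyc : y ∈ c.nullLine) (hxd : x ∈ d.nullLine) (hyd : y ∈ d.nullLine) :
    x = y := by
  have e1 := sub_eq hxc hyc
  have e2 := sub_eq hxd hyd
  have e3 : (tau y - tau x) • nullVec c.normal = (tau y - tau x) • nullVec d.normal :=
    add_left_cancel (e1.symm.trans e2)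
  have e4 := congrArg (fun w => mink w (nullVec c.normal)) e3
  simp only [mink_smul_left, nullDir_null, mul_zero] at e4
  have e5 : tau y - tau x = 0 := (mul_eq_zero.1 e4.symm).resolve_right
    (mink_nullVec_neg d.norm_normal c.norm_normal h.symm).ne
  rw [e1, e5, zero_smul, add_zero]

section Uniqueness

variable {M : Type*} [TopologicalSpace M] [ChartedSpace ℂ M]
variable {q : QuadraticDifferential M} {F G F₁ F₂ : M → ContactElement}
variable {m m₁ m₂ lam mu : ℝ} {U : Set M} {A A₁ A₂ : M → Aff} {s : M → ℝ} {v : M → V} {p : M}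

namespace IsCurvedFlatFraming

theorem smoothAt_mat (h : IsCurvedFlatFraming F G U A) (hU : IsOpen U) (hp : p ∈ U) (i j : Fin 4) :
    SmoothAt (fun x => (A x).mat i j) p :=
  (h.smooth_mat i j).smoothAt hU hp

theorem isOrthonormal (h : IsCurvedFlatFraming F G U A) (hp : p ∈ U) : (A p).IsOrthonormal :=
  (h.laguerre p hp).1

theorem pair (h : IsCurvedFlatFraming F G U A) (hp : p ∈ U) :
    mink ((A p).col 0) ((A p).col 3) = -1 := by
  rw [Aff.isOrthonormal_iff.1 (h.isOrthonormal hp)]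
  simp [gram]

theorem col_zero (h : IsCurvedFlatFraming F G U A) (hp : p ∈ U) :
    (A p).col 0 = tau ((A p).col 0) • nullDir F p :=
  (ContactElement.of_nullLine_eq (h.first_envelope p hp)).2.1

theorem col_three (h : IsCurvedFlatFraming F G U A) (hp : p ∈ U) :
    (A p).col 3 = tau ((A p).col 3) • nullDir G p :=
  (ContactElement.of_nullLine_eq (h.second_envelope p hp)).2.1

theorem pos_mem_first (h : IsCurvedFlatFraming F G U A) (hp : p ∈ U) :
    (A p).pos ∈ (F p).nullLine := by
  rw [h.first_envelope p hp]
  exact ⟨0, by simp⟩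

theorem pos_mem_second (h : IsCurvedFlatFraming F G U A) (hp : p ∈ U) :
    (A p).pos ∈ (G p).nullLine := by
  rw [h.second_envelope p hp]
  exact ⟨0, by simp⟩

/-- The null columns of a normalized curved flat framing are scaled lifts of the envelopes. -/
theorem exists_liftAt (h : IsCurvedFlatFraming F G U A) (hU : IsOpen U) (hF : IsLIsothermic q F)
    (hG : Smooth fun p => (G p).normal)
    (hs : ∀ T W, spectralForm F G p T W = m * (q.coeff p * T * W).re) (hp : p ∈ U) :
    ∃ κ, LiftAt (q.coeff p) m κ ((A p).col 0) ((A p).col 3) (diff (fun x => (A x).col 0) p)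
      (diff (fun x => (A x).col 3) p) := by
  have sc := smoothAt_col (h.smoothAt_mat hU hp)
  refine liftAt_of_scaling (X := fun x => (A x).col 0) (Y := fun x => (A x).col 3) hF hG hs
    ((sc 0).clm tau) ((sc 3).clm tau) ?_ ?_ ?_ fun T => ?_
  · filter_upwards [hU.mem_nhds hp] with x hx using h.col_zero hx
  · filter_upwards [hU.mem_nhds hp] with x hx using h.col_three hx
  · filter_upwards [hU.mem_nhds hp] with x hx using h.pair hx
  -- The normalization α¹₁ = 0 is exactly ⟨da₁, a₄⟩ = 0.
  · have e := conn_eq (h.smoothAt_mat hU hp) (h.isOrthonormal hp) T 0 0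
    rw [h.normalized p hp T] at e
    rw [mink_comm]
    exact neg_eq_zero.1 e.symm

end IsCurvedFlatFraming

namespace IsSuperpositionDatum

theorem pos_two (D : IsSuperpositionDatum F F₁ F₂ U A₁ A₂ lam s v) (hp : p ∈ U) :
    (A₂ p).pos = (A₁ p).pos + s p • (A₁ p).col 0 := by
  rw [D.gauge_eq p hp]
  simp [Aff.mul, gaugePlus, Aff.mulVec_eq]

theorem col_zero_two (D : IsSuperpositionDatum F F₁ F₂ U A₁ A₂ lam s v) (hp : p ∈ U) :
    (A₂ p).col 0 = (v p 3)⁻¹ • (A₁ p).col 0 := by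
  rw [D.gauge_eq p hp]
  ext i
  simp [Aff.mul, gaugePlus, Aff.col, Matrix.mul_apply, Fin.sum_univ_four, mul_comm]

theorem col_three_two (D : IsSuperpositionDatum F F₁ F₂ U A₁ A₂ lam s v) (hp : p ∈ U) :
    (A₂ p).col 3 = v p 0 • (A₁ p).col 0 + v p 1 • (A₁ p).col 1 + v p 2 • (A₁ p).col 2 +
      v p 3 • (A₁ p).col 3 := by
  rw [D.gauge_eq p hp]
  ext i
  simp [Aff.mul, gaugePlus, Aff.col, Matrix.mul_apply, Fin.sum_univ_four, mul_comm]

theorem mink_col_three_two (D : IsSuperpositionDatum F F₁ F₂ U A₁ A₂ lam s v) (hp : p ∈ U) :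
    mink ((A₁ p).col 0) ((A₂ p).col 3) = -v p 3 ∧
      mink ((A₁ p).col 3) ((A₂ p).col 3) = -v p 0 := by
  have e := Aff.isOrthonormal_iff.1 (D.framing_one.isOrthonormal hp)
  rw [D.col_three_two hp]
  simp only [mink_add_right, mink_smul_right, e]
  simp [gram]

theorem v_three_ne (D : IsSuperpositionDatum F F₁ F₂ U A₁ A₂ lam s v) (hp : p ∈ U) :
    v p 3 ≠ 0 := by
  intro h
  have e := D.framing_two.pair hp
  rw [D.col_zero_two hp, h, inv_zero, zero_smul, mink_zero_left] at e
  norm_num at e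

/-- Differentiating the expansion of the new last column, dv = −α'_λ v cancels everything except the
difference α' − α'_λ, which is 1 − λ times the deformed entries. -/
theorem diff_col_three_two (D : IsSuperpositionDatum F F₁ F₂ U A₁ A₂ lam s v) (hp : p ∈ U)
    (T : ℂ) :
    mink ((A₁ p).col 1) (diff (fun x => (A₂ x).col 3) p T) =
        (1 - lam) * v p 3 * mink ((A₁ p).col 1) (diff (fun x => (A₁ x).col 3) p T) ∧
      mink ((A₁ p).col 2) (diff (fun x => (A₂ x).col 3) p T) =
        (1 - lam) * v p 3 * mink ((A₁ p).col 2) (diff (fun x => (A₁ x).col 3) p T) := by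
  have hm := D.framing_one.smoothAt_mat D.isOpen hp
  have hO := D.framing_one.isOrthonormal hp
  have sc := smoothAt_col hm
  have sv := D.smooth_v.smoothAt D.isOpen hp
  have gr := Aff.isOrthonormal_iff.1 hO
  have e : (fun x => (A₂ x).col 3) =ᶠ[nhds p] fun x => v x 0 • (A₁ x).col 0 +
      v x 1 • (A₁ x).col 1 + v x 2 • (A₁ x).col 2 + v x 3 • (A₁ x).col 3 := by
    filter_upwards [D.isOpen.mem_nhds hp] with x hx using D.col_three_two hx
  have s0 := (sv.apply 0).smul (sc 0)
  have s1 := (sv.apply 1).smul (sc 1)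
  have s2 := (sv.apply 2).smul (sc 2)
  have s3 := (sv.apply 3).smul (sc 3)
  have hv := D.v_eq p hp T
  have r1 : ∀ j, conn A₁ p T 1 j =
      mink ((A₁ p).col 1) (diff (fun x => (A₁ x).col j) p T) := conn_eq hm hO T 1
  have r2 : ∀ j, conn A₁ p T 2 j =
      mink ((A₁ p).col 2) (diff (fun x => (A₁ x).col j) p T) := conn_eq hm hO T 2
  have v1 := congrFun hv 1
  have v2 := congrFun hv 2
  rw [diff_congr e, diff_add ((s0.add s1).add s2) s3, diff_add (s0.add s1) s2, diff_add s0 s1,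
    diff_smul (sv.apply 0) (sc 0), diff_smul (sv.apply 1) (sc 1), diff_smul (sv.apply 2) (sc 2),
    diff_smul (sv.apply 3) (sc 3), diff_apply sv, diff_apply sv, diff_apply sv, diff_apply sv]
  simp only [mink_add_right, mink_smul_right, gr]
  rw [Pi.neg_apply, Matrix.mulVec, dotProduct, Fin.sum_univ_four] at v1 v2
  simp [deform, r1, r2] at v1 v2
  simp only [gram, Matrix.of_apply, Matrix.cons_val]
  constructor
  · linear_combination v1
  · linear_combination v2

/-- The parameter of a superposition datum is determined by the spectral parameters. -/
theorem one_sub_lam (D : IsSuperpositionDatum F F₁ F₂ U A₁ A₂ lam s v) (hF : IsLIsothermic q F)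
    (hF₁ : Smooth fun p => (F₁ p).normal) (hF₂ : Smooth fun p => (F₂ p).normal)
    (hs₁ : ∀ p T W, spectralForm F F₁ p T W = m₁ * (q.coeff p * T * W).re)
    (hs₂ : ∀ p T W, spectralForm F F₂ p T W = m₂ * (q.coeff p * T * W).re) (hm₁ : m₁ ≠ 0)
    (hp : p ∈ U) (hq : q.coeff p ≠ 0) : 1 - lam = m₂ / m₁ := by
  obtain ⟨κ, L⟩ := D.framing_one.exists_liftAt D.isOpen hF hF₁ (hs₁ p) hp
  obtain ⟨κ', L'⟩ := D.framing_two.exists_liftAt D.isOpen hF hF₂ (hs₂ p) hp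
  have hm := D.framing_one.smoothAt_mat D.isOpen hp
  have hO := D.framing_one.isOrthonormal hp
  have sc := smoothAt_col hm
  have sv := D.smooth_v.smoothAt D.isOpen hp
  have h3 := D.v_three_ne hp
  have e : (fun x => (A₂ x).col 0) =ᶠ[nhds p] fun x => (v x 3)⁻¹ • (A₁ x).col 0 := by
    filter_upwards [D.isOpen.mem_nhds hp] with x hx using D.col_zero_two hx
  have key : ∀ T W, (1 - lam) * (m₁ * (q.coeff p * T * W).re) = m₂ * (q.coeff p * T * W).re := by
    intro T W
    have s2 := L'.spectral T W
    have z := L'.right_left T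
    rw [D.col_zero_two hp, mink_smul_right] at z
    have z' := (mul_eq_zero.1 z).resolve_left (inv_ne_zero h3)
    rw [diff_congr e, diff_smul ((sv.apply 3).inv h3) (sc 0), mink_add_right, mink_smul_right,
      mink_smul_right, z', hO.mink_eq, mink_comm _ (diff (fun x => (A₁ x).col 0) p W),
      mink_comm _ (diff (fun x => (A₁ x).col 0) p W), L.left_left, L.left_right,
      (D.diff_col_three_two hp T).1, (D.diff_col_three_two hp T).2] at s2
    have s1 := L.spectral T W
    rw [hO.mink_eq, mink_comm _ (diff (fun x => (A₁ x).col 0) p W),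
      mink_comm _ (diff (fun x => (A₁ x).col 0) p W), L.left_left, L.left_right] at s1
    rw [← s1, ← s2]
    field_simp
    ring
  -- These arguments make the quadratic differential equal to |q|² ≠ 0, which can be cancelled.
  have k := key ((starRingEnd ℂ) (q.coeff p)) 1
  rw [mul_one, Complex.mul_conj, Complex.ofReal_re, ← mul_assoc] at k
  have k' := mul_right_cancel₀ (Complex.normSq_pos.2 hq).ne' k
  field_simp
  exact k'

theorem pos_one (D : IsSuperpositionDatum F F₁ F₂ U A₁ A₂ lam s v) {x : V}
    (hne : (F p).normal ≠ (F₁ p).normal) (hx : x ∈ (F p).nullLine) (hx₁ : x ∈ (F₁ p).nullLine)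
    (hp : p ∈ U) : (A₁ p).pos = x :=
  ContactElement.eq_of_mem hne (D.framing_one.pos_mem_first hp) hx
    (D.framing_one.pos_mem_second hp) hx₁

/-- The first column of A₁ g⁻_λ(s, v) is Z with its a₁-coordinate multiplied by λ⁻¹ and its
a₄-coordinate by λ, which is `starDir`; its position vector is `starPos`. Both depend only on the
envelopes once expressed by null directions. -/
theorem lineThrough_gaugeMinus (D : IsSuperpositionDatum F F₁ F₂ U A₁ A₂ lam s v) {S₁ S₂ : M → V}
    (hne₁ : (F p).normal ≠ (F₁ p).normal) (hne₂ : (F p).normal ≠ (F₂ p).normal)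
    (hne : (F₁ p).normal ≠ (F₂ p).normal) (hS₁ : S₁ p ∈ (F p).nullLine)
    (hS₁' : S₁ p ∈ (F₁ p).nullLine) (hS₂ : S₂ p ∈ (F p).nullLine) (hS₂' : S₂ p ∈ (F₂ p).nullLine)
    (hmu : mu = lam * (mu - 1)) (hp : p ∈ U) :
    lineThrough ((A₁ p).mul (gaugeMinus lam (s p) (v p))).pos
        (((A₁ p).mul (gaugeMinus lam (s p) (v p))).col 0) =
      lineThrough (starCongr lam F F₁ F₂ S₁ S₂ p) (starNull lam mu F F₁ F₂ p) := by
  have hP := D.pos_one hne₁ hS₁ hS₁' hp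
  have hP₂ : (A₂ p).pos = S₂ p := ContactElement.eq_of_mem hne₂ (D.framing_two.pos_mem_first hp)
    hS₂ (D.framing_two.pos_mem_second hp) hS₂'
  have hS : S₂ p = S₁ p + s p • (A₁ p).col 0 := by rw [← hP₂, D.pos_two hp, hP]
  have hc : tau ((A₂ p).col 3) ≠ 0 :=
    (ContactElement.of_nullLine_eq (D.framing_two.second_envelope p hp)).1
  rw [(lineThrough_star_eq (X := fun x => (A₁ x).col 0) (Y := fun x => (A₁ x).col 3)
    (Z := fun x => (A₂ x).col 3) (D.framing_one.col_zero hp) (D.framing_one.col_three hp)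
    (D.framing_two.col_three hp) (D.framing_one.pair hp) hc D.lam_ne hmu
    (mink_nullDir_neg hne).ne hS).2]
  obtain ⟨hw, hu⟩ := D.mink_col_three_two hp
  congr 1
  · rw [starPos, hw, hu, ← hP]
    simp [Aff.mul, gaugeMinus, Aff.mulVec_eq]
  · rw [starDir, hw, hu, D.col_three_two hp]
    ext i
    simp [Aff.mul, gaugeMinus, Aff.col, Matrix.mul_apply, Fin.sum_univ_four]
    ring

end IsSuperpositionDatum

theorem isSuperposition_star [IsManifold 𝓘(ℂ, ℂ) ω M] (h₁ : IsBianchiDarboux q F F₁)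
    (h₂ : IsBianchiDarboux q F F₂) (hne : ∀ p, (F₁ p).normal ≠ (F₂ p).normal)
    (hm₁ : m₁ ≠ 0) (hs₁ : ∀ p U W, spectralForm F F₁ p U W = m₁ * (q.coeff p * U * W).re)
    (hs₂ : ∀ p U W, spectralForm F F₂ p U W = m₂ * (q.coeff p * U * W).re) {S₁ S₂ : M → V}
    (hS₁ : IsDarbouxCongruence q F F₁ S₁) (hS₂ : IsDarbouxCongruence q F F₂ S₂)
    (hlam : 1 - lam = m₂ / m₁) (h0 : lam ≠ 0) (hmu : mu = lam * (mu - 1))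
    {Fs : M → ContactElement} (hFs : ∀ p, (Fs p).nullLine =
      lineThrough (starCongr lam F F₁ F₂ S₁ S₂ p) (starNull lam mu F F₁ F₂ p)) :
    IsSuperposition F F₁ F₂ lam Fs := by
  refine ⟨fun p => ?_, fun U A₁ A₂ lam' s v D p hp => ?_⟩
  · obtain ⟨U, X, Y, Z, s, hp, C, -⟩ :=
      exists_configuration h₁ h₂ hne hm₁ hs₁ hs₂ hS₁ hS₂ p
    exact C.exists_superpositionDatum h₁.isothermic_left h₂.isothermic_right hs₂ hlam h0 hp
  · have e := D.one_sub_lam h₁.isothermic_left h₁.isothermic_right.smooth_normal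
      h₂.isothermic_right.smooth_normal hs₁ hs₂ hm₁ hp (h₁.exists_spectral p).1
    obtain rfl : lam' = lam := by linarith
    refine ⟨rfl, ?_⟩
    rw [hFs, D.lineThrough_gaugeMinus (h₁.distinct p) (h₂.distinct p) (hne p)
      (hS₁.envelope_left p) (hS₁.envelope_right p) (hS₂.envelope_left p) (hS₂.envelope_right p)
      hmu hp]

end Uniqueness

end Laguerre

end

theorem theorem5 {M : Type*} [TopologicalSpace M] [ChartedSpace ℂ M]
    [IsManifold 𝓘(ℂ, ℂ) ω M] [ConnectedSpace M]
    (q : Laguerre.QuadraticDifferential M) (F F₁ F₂ : M → Laguerre.ContactElement)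
    (h₁ : Laguerre.IsBianchiDarboux q F F₁) (h₂ : Laguerre.IsBianchiDarboux q F F₂)
    (hspec : ∀ m : ℝ, ¬ (Laguerre.HasSpectralParameter q F F₁ m ∧
      Laguerre.HasSpectralParameter q F F₂ m))
    (hnormal : ∀ p : M, (F₁ p).normal ≠ (F₂ p).normal) :
    ∃ (Fstar : M → Laguerre.ContactElement) (lam mu : ℝ),
      Laguerre.IsLIsothermic q Fstar ∧
      Fstar ≠ F ∧
      Laguerre.IsBianchiDarboux q F₁ Fstar ∧
      Laguerre.IsBianchiDarboux q F₂ Fstar ∧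
      mu = lam * (mu - 1) ∧
      Laguerre.IsSuperposition F F₁ F₂ lam Fstar ∧
      Laguerre.IsSuperposition F F₂ F₁ mu Fstar := by
  obtain ⟨S₁, hS₁⟩ := h₁.exists_congruence
  obtain ⟨S₂, hS₂⟩ := h₂.exists_congruence
  obtain ⟨m₁, hm₁, hs₁⟩ := Laguerre.exists_spectral_parameter h₁
  obtain ⟨m₂, hm₂, hs₂⟩ := Laguerre.exists_spectral_parameter h₂
  -- The hypothesis excludes a common parameter; since both parameters exist, they differ.
  have hne : m₁ ≠ m₂ := by
    rintro rfl
    exact hspec m₁ ⟨hs₁, hs₂⟩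
  have hnormal' : ∀ p, (F₂ p).normal ≠ (F₁ p).normal := fun p => (hnormal p).symm
  -- The values satisfy (1−λ)(1−μ) = 1. They are nonzero because m₁ ≠ m₂ and different from 1
  -- because m₁ and m₂ are nonzero.
  obtain ⟨lam, hlam⟩ : ∃ lam, lam = 1 - m₂ / m₁ := ⟨_, rfl⟩
  obtain ⟨mu, hmu⟩ : ∃ mu, mu = 1 - m₁ / m₂ := ⟨_, rfl⟩
  have hlam' : 1 - lam = m₂ / m₁ := by rw [hlam]; ring
  have hmu' : 1 - mu = m₁ / m₂ := by rw [hmu]; ring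
  have lam0 : lam ≠ 0 := by
    rw [hlam, sub_ne_zero, ne_comm, Ne, div_eq_one_iff_eq hm₁]
    exact hne.symm
  have mu0 : mu ≠ 0 := by
    rw [hmu, sub_ne_zero, ne_comm, Ne, div_eq_one_iff_eq hm₂]
    exact hne
  have lam1 : lam ≠ 1 := by
    intro h
    rw [h, sub_self, eq_comm] at hlam'
    exact div_ne_zero hm₂ hm₁ hlam'
  have mu1 : mu ≠ 1 := by
    intro h
    rw [h, sub_self, eq_comm] at hmu'
    exact div_ne_zero hm₁ hm₂ hmu'
  have rel : mu = lam * (mu - 1) := by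
    rw [hlam, hmu]
    field_simp
    ring
  have rel' : lam = mu * (lam - 1) := by linarith
  have h01 : ∀ p, Laguerre.mink (Laguerre.nullDir F p) (Laguerre.nullDir F₁ p) ≠ 0 := fun p =>
    (Laguerre.mink_nullDir_neg (h₁.distinct p)).ne
  have h02 : ∀ p, Laguerre.mink (Laguerre.nullDir F p) (Laguerre.nullDir F₂ p) ≠ 0 := fun p =>
    (Laguerre.mink_nullDir_neg (h₂.distinct p)).ne
  -- Nonorthogonality to the null direction of F shows that the new direction is nonzero and also
  -- that the normals of F* and F differ, so F* ≠ F.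
  have hN : ∀ p, Laguerre.mink (Laguerre.starNull lam mu F F₁ F₂ p) (Laguerre.nullDir F p) ≠ 0 := by
    intro p
    rw [Laguerre.mink_starNull rel]
    exact neg_ne_zero.2 (mul_ne_zero (mul_ne_zero (mul_ne_zero lam0 mu0) (h01 p)) (h02 p))
  have hex : ∀ p, ∃ c : Laguerre.ContactElement, c.nullLine = Laguerre.lineThrough
      (Laguerre.starCongr lam F F₁ F₂ S₁ S₂ p) (Laguerre.starNull lam mu F F₁ F₂ p) := fun p =>
    Laguerre.exists_contactElement (Laguerre.mink_starNull_self rel)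
      (fun h => hN p (by rw [h, Laguerre.mink_zero_left])) _
  choose Fs hFs using hex
  -- With this symmetric description all results for (F₁, F₂, λ) apply verbatim to (F₂, F₁, μ).
  have hFs' : ∀ p, (Fs p).nullLine = Laguerre.lineThrough
      (Laguerre.starCongr mu F F₂ F₁ S₂ S₁ p) (Laguerre.starNull mu lam F F₂ F₁ p) := by
    intro p
    rw [hFs, Laguerre.lineThrough_star_swap (hS₁.envelope_left p) (hS₂.envelope_left p)
      (Laguerre.mink_nullDir_neg (hnormal p)).ne]
  have B₁ := Laguerre.isBianchiDarboux_star h₁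
    (Laguerre.exists_local_star h₁ h₂ hnormal hm₁ hs₁ hs₂ hS₁ hS₂ lam0 rel hFs) hm₁ hlam' lam0 lam1
  have B₂ := Laguerre.isBianchiDarboux_star h₂
    (Laguerre.exists_local_star h₂ h₁ hnormal' hm₂ hs₂ hs₁ hS₂ hS₁ mu0 rel' hFs') hm₂ hmu' mu0 mu1
  refine ⟨Fs, lam, mu, B₁.isothermic_right, ?_, B₁, B₂, rel,
    Laguerre.isSuperposition_star h₁ h₂ hnormal hm₁ hs₁ hs₂ hS₁ hS₂ hlam' lam0 rel hFs,
    Laguerre.isSuperposition_star h₂ h₁ hnormal' hm₂ hs₂ hs₁ hS₂ hS₁ hmu' mu0 rel' hFs'⟩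
  intro h
  obtain ⟨p⟩ : Nonempty M := inferInstance
  apply hN p
  obtain ⟨-, hW, -⟩ := Laguerre.ContactElement.of_nullLine_eq (hFs p)
  rw [hW, h, Laguerre.mink_smul_left, Laguerre.nullDir, Laguerre.nullDir_null, mul_zero]
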